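/- Let $\rho$ be a two-qubit state (a positive semidefinite operator on $\mathbb C^2\otimes\mathbb C^2$ of trace one). For real unit vectors $a,b,c,d\in\mathbb R^3$ and the Pauli matrices $\sigma_1,\sigma_2,\sigma_3$ let $$\mathcal B=\tfrac12\sum_{i,j=1}^3\big[a_i(c_j+d_j)+b_i(c_j-d_j)\big]\,\sigma_i\otimes\sigma_j,\qquad \beta(\rho)=\max_{\mathcal B}\operatorname{tr}(\rho\mathcal B);$$ $\rho$ violates CHSH if $\beta(\rho)>1$. A local filter is a pair $(A,B)$ of complex $2\times2$ matrices, admissible for $\rho$ if $\operatorname{tr}[(A\otimes B)\rho(A\otimes B)^\dagger]\neq0$; it maps $\rho$ to the state $\rho_{A,B}=(A\otimes B)\rho(A\otimes B)^\dagger/\operatorname{tr}[(A\otimes B)\rho(A\otimes B)^\dagger]$. It is stochastically reversible if $A$ and $B$ are invertible, and optimal for $\rho$ if it is admissible and $\beta(\rho_{C,D})\le\beta(\rho_{A,B})$ for every admissible $(C,D)$. A state is Bell diagonal if in suitable local orthonormal bases it is a convex combination of the four Bell states. A Bell-diagonal normal form of $\rho$ is a Bell-diagonal state in the closure of $\{\rho_{A,B}: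 A,B\text{ invertible}\}$. Then: 1. A local filter $(A,B)$ is optimal for $\rho$ and $\rho_{A,B}$ violates CHSH if and only if $A,B$ are invertible, $\rho_{A,B}$ is Bell diagonal, and $\rho_{A,B}$ violates CHSH. 2. If $\rho$ has full rank, there are invertible $A,B$ such that $\rho_{A,B}$ is Bell diagonal. For arbitrary $\rho$, a Bell-diagonal normal form exists if and only if $\rho$ is not a product state $\sigma\otimes\tau$ with a pure factor; for such a product state, no admissible local filter leads to a CHSH violation. 3. Any two Bell-diagonal normal forms of $\rho$ are equal up to local unitaries. If $\rho$ has rank at least $3$ and the invertible filters $(A,B)$ and $(C,D)$ both bring $\rho$ to a Bell-diagonal state, then $C=s\,UA$ and $D=t\,VB$ with unitaries $U,V$ and nonzero complex numbers $s,t$. 4. If $\rho_0$ is a Bell-diagonal normal form of $\rho$, then $\sup\beta(\rho_{A,B})=\max(1,\beta(\rho_0))$, the supremum being over all admissible local filters. In particular, if $\rho_0$ does not violate CHSH, then no local filter makes $\rho$ violate CHSH. -/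

import Mathlib

open scoped Kronecker ComplexOrder

noncomputable section

namespace CHSHFilter

/-- Operators on one qubit. -/
abbrev Mat2 := Matrix (Fin 2) (Fin 2) ℂ

/-- Operators on two qubits; rows and columns are indexed by pairs of qubit labels. -/
abbrev Mat4 := Matrix (Fin 2 × Fin 2) (Fin 2 × Fin 2) ℂ

/-- A two-qubit state is a positive semidefinite operator of trace one. -/
def IsState (ρ : Mat4) : Prop := ρ.PosSemidef ∧ ρ.trace = 1

/-- A one-qubit state. -/
def IsQubitState (σ : Mat2) : Prop := σ.PosSemidef ∧ σ.trace = 1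

/-- The Pauli matrices `σ_x`, `σ_y`, `σ_z`. -/
def pauli : Fin 3 → Mat2 :=
  ![!![0, 1; 1, 0], !![0, -Complex.I; Complex.I, 0], !![1, 0; 0, -1]]

/-- The CHSH Bell operator
`(1/2) ∑ i j, (a_i (c_j + d_j) + b_i (c_j - d_j)) σ_i ⊗ σ_j`. -/
def bellOperator (a b c d : EuclideanSpace ℝ (Fin 3)) : Mat4 :=
  (1 / 2 : ℂ) • ∑ i, ∑ j,
    ((a i * (c j + d j) + b i * (c j - d j) : ℝ) : ℂ) • (pauli i ⊗ₖ pauli j)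

/-- The expectation values `tr (ρ 𝓑)` over all Bell operators `𝓑` with unit vectors
`a, b, c, d` (these traces are real when `ρ` is Hermitian). -/
def bellValues (ρ : Mat4) : Set ℝ :=
  {x | ∃ a b c d : EuclideanSpace ℝ (Fin 3),
    ‖a‖ = 1 ∧ ‖b‖ = 1 ∧ ‖c‖ = 1 ∧ ‖d‖ = 1 ∧ x = (ρ * bellOperator a b c d).trace.re}

/-- The maximal CHSH value `β(ρ)`; the local classical bound is `1`. -/
def beta (ρ : Mat4) : ℝ := sSup (bellValues ρ)

/-- `ρ` violates a CHSH inequality. -/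
def Violates (ρ : Mat4) : Prop := 1 < beta ρ

/-- The unnormalised outcome `(A ⊗ B) ρ (A ⊗ B)ᴴ` of the local filter `(A, B)`. -/
def filterRaw (ρ : Mat4) (A B : Mat2) : Mat4 := (A ⊗ₖ B) * ρ * (A ⊗ₖ B).conjTranspose

/-- The filter `(A, B)` can succeed on `ρ`: the outcome has nonzero trace. -/
def Admissible (ρ : Mat4) (A B : Mat2) : Prop := (filterRaw ρ A B).trace ≠ 0

/-- The renormalised state after the local filter `(A, B)`. Rescaling `A` and `B` by nonzero
numbers does not change it, so `A` and `B` need not be contractions. -/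
def filtered (ρ : Mat4) (A B : Mat2) : Mat4 := (filterRaw ρ A B).trace⁻¹ • filterRaw ρ A B

/-- Stochastically reversible filters: both local operators are invertible, so that the filter
can be undone with nonzero probability by the local filter `(A⁻¹, B⁻¹)`. -/
def Reversible (A B : Mat2) : Prop := IsUnit A ∧ IsUnit B

/-- `(A, B)` yields the largest CHSH value among all local filters (reversible or not). -/
def IsOptimalFilter (ρ : Mat4) (A B : Mat2) : Prop :=
  Admissible ρ A B ∧ ∀ C D : Mat2, Admissible ρ C D → beta (filtered ρ C D) ≤ beta (filtered ρ A B)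

/-- Two operators differ by a change of the local orthonormal bases. -/
def LocallyUnitarilyEquivalent (ρ ρ' : Mat4) : Prop :=
  ∃ U ∈ Matrix.unitaryGroup (Fin 2) ℂ, ∃ V ∈ Matrix.unitaryGroup (Fin 2) ℂ,
    ρ' = (U ⊗ₖ V) * ρ * (U ⊗ₖ V).conjTranspose

/-- The four Bell vectors, in the order `Φ⁺, Φ⁻, Ψ⁺, Ψ⁻`; the entry `(i, j)` of each matrix,
divided by `√2`, is the amplitude of `|ij⟩`. -/
def bellVector (k : Fin 4) : Fin 2 × Fin 2 → ℂ := fun p =>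
  ((1 / Real.sqrt 2 : ℝ) : ℂ) *
    (![!![1, 0; 0, 1], !![1, 0; 0, -1], !![0, 1; 1, 0], !![0, 1; -1, 0]] k : Mat2) p.1 p.2

/-- The projector on a Bell vector. -/
def bellProjector (k : Fin 4) : Mat4 := Matrix.vecMulVec (bellVector k) (star (bellVector k))

/-- Bell diagonal: in suitable local orthonormal bases, a convex combination of the four
Bell states. -/
def IsBellDiagonal (ρ : Mat4) : Prop :=
  ∃ p ∈ stdSimplex ℝ (Fin 4),
    LocallyUnitarilyEquivalent (∑ k, ((p k : ℝ) : ℂ) • bellProjector k) ρ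

/-- The states that can be reached from `ρ` by reversible local filters. -/
def reversibleOrbit (ρ : Mat4) : Set Mat4 :=
  {ρ' | ∃ A B : Mat2, Reversible A B ∧ ρ' = filtered ρ A B}

/-- `ρ₀` is a Bell diagonal normal form of `ρ`: it is Bell diagonal, and it is reached from `ρ`
by reversible local filters, exactly or (as happens for some singular `ρ`) in the limit. -/
def IsBellNormalForm (ρ ρ₀ : Mat4) : Prop :=
  IsBellDiagonal ρ₀ ∧ ρ₀ ∈ closure (reversibleOrbit ρ)

/-- A product state with at least one pure factor (a state is pure iff it has rank one). -/
def IsProductWithPureFactor (ρ : Mat4) : Prop :=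
  ∃ σ τ : Mat2, IsQubitState σ ∧ IsQubitState τ ∧ (σ.rank = 1 ∨ τ.rank = 1) ∧ ρ = σ ⊗ₖ τ

end CHSHFilter

end

open scoped Kronecker ComplexOrder

noncomputable section

namespace CHSHFilter

open Matrix

/-! ### Simultaneous rotation of anticommuting spin observables -/

/-! The proof follows one invariant of `ρ` under filtering: the decreasing list `λ` of square roots
of the eigenvalues of `ρ` times its spin flip. A one-qubit operator preserves the antisymmetric form
up to its determinant, so an unnormalised filter `(A, B)`, invertible or not, multiplies `λ` by
`|det A| |det B|` (`FlipSpectrum.filterRaw`). Bell-diagonal states are the states fixed by the spin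
flip (`spinFlip_bellMix`, `exists_bellMix_of_spinFlip_eq`), and for them `λ` is the list of weights.
Hence the weights of any normal form of `ρ` must be `λ / ∑ λ` (`IsBellNormalForm.exists_weights`),
which gives uniqueness.

Existence is variational. If no filter of determinant one lowers the trace, both reduced states are
maximally mixed, so the state is spin-flip invariant and hence Bell diagonal
(`IsTraceMinimal.isBellDiagonal`). For full rank the trace is coercive on pairs of unimodular
filters and a minimum is attained. In general the infimum is at least `∑ λ`; if this is positive,
the normalised states along a minimising sequence have a Bell-diagonal limit point. If `λ = 0`, a
state is a product with a pure factor (`IsState.isProductWithPureFactor`), and no filter gives a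
violation.

The quantitative core is `bellMix_filter_inequality`. Local unitaries bring a Bell operator to `s₁
σ_z ⊗ σ_z + s₂ σ_x ⊗ σ_x` with `s₁ ≥ s₂ ≥ 0` and `s₁² + s₂² = 1`. On a state with flip spectrum `λ`
its expectation is at most `s₁ (1 - ∑ λ)` plus its value on the Bell mixture with weights `λ`. If
`ρ₀` is the normal form and a filtered state has spectrum `c p`, with `p` the weights of `ρ₀`, then
`c ≤ 1` and `β ≤ (1 - c) + c β(ρ₀)`. This yields the supremum; a violating optimal filter must have
`c = 1`, which forces invertibility and trace minimality.

Rigidity is the equality case of the arithmetic-geometric mean inequality `|det N| ≤ ‖N‖² / 2`,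
applied to the images of three Bell vectors. -/

lemma exists_unitary_conj_pauli {P Q : Mat2} (hP : P.IsHermitian) (hQ : Q.IsHermitian)
    (hP2 : P * P = 1) (hQ2 : Q * Q = 1) (hPQ : P * Q = -(Q * P)) :
    ∃ U ∈ Matrix.unitaryGroup (Fin 2) ℂ, U * P * Uᴴ = pauli 2 ∧ U * Q * Uᴴ = pauli 0 := by
  -- `x + P x` is a `+1` eigenvector of `P` as soon as it is nonzero. Were it always zero, `P = -1`
  -- would commute with `Q`, and anticommutation would give `Q = 0`. Afterwards `Q` carries the `+1`
  -- eigenvector to a `-1` eigenvector, and the two form the required basis.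
  obtain ⟨x, hx⟩ : ∃ x : Fin 2 → ℂ, x + P *ᵥ x ≠ 0 := by
    by_contra! h
    have hP1 : P = -1 := by
      ext i j
      have := congrFun (h (Pi.single j 1)) i
      simp [Matrix.mulVec_single] at this
      rw [Matrix.neg_apply, Matrix.one_apply]
      simp only [Pi.single_apply] at this
      linear_combination this
    rw [hP1] at hPQ
    have : Q = 0 := by
      have h2 : (2 : ℂ) • Q = 0 := by
        rw [two_smul]
        simp only [neg_mul, one_mul, mul_neg, mul_one, neg_neg] at hPQ
        nth_rewrite 1 [← hPQ]
        simp
      simpa using h2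
    rw [this] at hQ2
    simp at hQ2
  set v₀ := x + P *ᵥ x with hv₀
  have hPv₀ : P *ᵥ v₀ = v₀ := by
    rw [hv₀, Matrix.mulVec_add, Matrix.mulVec_mulVec, hP2, Matrix.one_mulVec, add_comm]
  obtain ⟨r, hr0, hr⟩ : ∃ r : ℝ, r ≠ 0 ∧ star v₀ ⬝ᵥ v₀ = (r : ℂ) * r := by
    have hpos : 0 < star v₀ ⬝ᵥ v₀ := Matrix.dotProduct_star_self_pos_iff.mpr hx
    obtain ⟨h1, h2⟩ := Complex.lt_def.mp hpos
    refine ⟨Real.sqrt (star v₀ ⬝ᵥ v₀).re, (Real.sqrt_pos.mpr h1).ne', ?_⟩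
    rw [← Complex.ofReal_mul, Real.mul_self_sqrt h1.le]
    apply Complex.ext
    · simp
    · rw [← h2]; simp
  set v : Fin 2 → ℂ := (r : ℂ)⁻¹ • v₀ with hv
  have hrc : (r : ℂ) ≠ 0 := by exact_mod_cast hr0
  have hvv : star v ⬝ᵥ v = 1 := by
    rw [hv, star_smul, smul_dotProduct, dotProduct_smul, hr]
    simp
    field_simp
  have hPv : P *ᵥ v = v := by rw [hv, Matrix.mulVec_smul, hPv₀]
  set w := Q *ᵥ v with hw
  have hPw : P *ᵥ w = -w := by
    rw [hw, Matrix.mulVec_mulVec, hPQ, Matrix.neg_mulVec, ← Matrix.mulVec_mulVec, hPv]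
  have hQw : Q *ᵥ w = v := by
    rw [hw, Matrix.mulVec_mulVec, hQ2, Matrix.one_mulVec]
  have adj : ∀ {H : Mat2}, H.IsHermitian → ∀ a b : Fin 2 → ℂ,
      star (H *ᵥ a) ⬝ᵥ b = star a ⬝ᵥ (H *ᵥ b) := by
    intro H hH a b
    rw [Matrix.star_mulVec, hH.eq, ← Matrix.dotProduct_mulVec]
  have hww : star w ⬝ᵥ w = 1 := by
    nth_rewrite 1 [hw]
    rw [adj hQ, hQw, hvv]
  have hvw : star v ⬝ᵥ w = 0 := by
    have h1 := adj hP v w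
    rw [hPv, hPw, dotProduct_neg] at h1
    have : (2 : ℂ) * (star v ⬝ᵥ w) = 0 := by linear_combination h1
    simpa using this
  have hwv : star w ⬝ᵥ v = 0 := by
    have h1 := adj hP w v
    rw [hPv, hPw, star_neg, neg_dotProduct] at h1
    have : (2 : ℂ) * (star w ⬝ᵥ v) = 0 := by linear_combination -h1
    simpa using this
  set V : Mat2 := Matrix.of fun i j => ![v i, w i] j with hV
  have hVV : Vᴴ * V = 1 := by
    simp only [dotProduct, Fin.sum_univ_two, Pi.star_apply] at hvv hww hvw hwv
    ext i j
    fin_cases i <;> fin_cases j <;>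
      simp [Matrix.mul_apply, Fin.sum_univ_two, hV] <;>
      first | exact hvv | exact hww | exact hvw | exact hwv
  have hPV : P * V = V * pauli 2 := by
    ext i j
    have e1 := congrFun hPv i
    have e2 := congrFun hPw i
    simp only [Matrix.mulVec, dotProduct, Fin.sum_univ_two, Pi.neg_apply] at e1 e2
    fin_cases j <;>
      simp [Matrix.mul_apply, Fin.sum_univ_two, hV, pauli, e1, e2]
  have hQV : Q * V = V * pauli 0 := by
    ext i j
    have e1 := congrFun hw.symm i
    have e2 := congrFun hQw i
    simp only [Matrix.mulVec, dotProduct, Fin.sum_univ_two] at e1 e2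
    fin_cases j <;>
      simp [Matrix.mul_apply, Fin.sum_univ_two, hV, pauli, e1, e2]
  refine ⟨Vᴴ, ?_, ?_, ?_⟩
  · rw [Matrix.mem_unitaryGroup_iff, star_eq_conjTranspose, conjTranspose_conjTranspose, hVV]
  · rw [conjTranspose_conjTranspose, Matrix.mul_assoc, hPV, ← Matrix.mul_assoc, hVV, Matrix.one_mul]
  · rw [conjTranspose_conjTranspose, Matrix.mul_assoc, hQV, ← Matrix.mul_assoc, hVV, Matrix.one_mul]

/-- The unnormalised Bell vectors `Φ⁺, Φ⁻, Ψ⁺, Ψ⁻` as matrices. -/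
def bellMat : Fin 4 → Mat2 :=
  ![!![1, 0; 0, 1], !![1, 0; 0, -1], !![0, 1; 1, 0], !![0, 1; -1, 0]]

/-- The spin flip metric on one qubit. -/
def flipMat : Mat2 := !![0, 1; -1, 0]

/-- Matrices fixed by the spin flip, the real multiples of `SU(2)`. -/
def IsFlipReal (M : Mat2) : Prop := M 1 1 = star (M 0 0) ∧ M 1 0 = -star (M 0 1)

/-- Flip-real matrices are the quaternions, with the conjugate transpose as quaternion conjugation:
`M Nᴴ` plus its conjugate is twice its real part. -/
lemma IsFlipReal.anticomm {M N : Mat2} (hM : IsFlipReal M) (hN : IsFlipReal N) :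
    M * Nᴴ + N * Mᴴ = (M * Nᴴ).trace • 1 := by
  obtain ⟨h1, h2⟩ := hM
  obtain ⟨h3, h4⟩ := hN
  ext i j
  fin_cases i <;> fin_cases j <;>
    simp [Matrix.mul_apply, Matrix.trace, Fin.sum_univ_two, h1, h2, h3, h4] <;> ring

/-- This is the double cover of `SO(4)` by `SU(2) × SU(2)` in quaternion form. Dividing the frame by
`M 0` on the right leaves three anticommuting imaginary units. Conjugation by `U` moves two of them
to `i σ_z` and `i σ_x`, and the third is then determined up to a phase, which absorbs the
orientation. -/
lemma exists_unitary_frame {M : Fin 4 → Mat2} (hM : ∀ k, IsFlipReal (M k))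
    (hort : ∀ k l, (M k * (M l)ᴴ).trace = if k = l then 2 else 0) :
    ∃ U ∈ Matrix.unitaryGroup (Fin 2) ℂ, ∃ V ∈ Matrix.unitaryGroup (Fin 2) ℂ,
      ∃ ε : Fin 4 → ℂ, (∀ k, ε k * star (ε k) = 1) ∧ ∀ k, U * M k * Vᵀ = ε k • bellMat k := by
  have hself : ∀ k, M k * (M k)ᴴ = 1 := by
    intro k
    have h := (hM k).anticomm (hM k)
    rw [hort, if_pos rfl, ← two_smul ℂ] at h
    exact smul_right_injective _ (two_ne_zero (α := ℂ)) h
  have hself' : ∀ k, (M k)ᴴ * M k = 1 := fun k => mul_eq_one_comm.mp (hself k)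
  have hanti : ∀ k l, k ≠ l → M k * (M l)ᴴ + M l * (M k)ᴴ = 0 := by
    intro k l hkl
    rw [(hM k).anticomm (hM l), hort, if_neg hkl, zero_smul]
  set X : Fin 4 → Mat2 := fun k => M k * (M 0)ᴴ with hX
  have hXH : ∀ k, k ≠ 0 → (X k)ᴴ = -X k := by
    intro k hk
    have := hanti k 0 hk
    rw [hX]
    simp only [conjTranspose_mul, conjTranspose_conjTranspose]
    exact eq_neg_of_add_eq_zero_right this
  have hXX : ∀ k l, X k * (X l)ᴴ = M k * (M l)ᴴ := by
    intro k l
    simp only [hX, conjTranspose_mul, conjTranspose_conjTranspose]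
    rw [Matrix.mul_assoc, ← Matrix.mul_assoc (M 0)ᴴ, hself', Matrix.one_mul]
  have hXself : ∀ k, k ≠ 0 → X k * X k = -1 := by
    intro k hk
    have := hXX k k
    rw [hXH k hk, hself, Matrix.mul_neg] at this
    rw [← this, neg_neg]
  have hXanti : ∀ k l, k ≠ 0 → l ≠ 0 → k ≠ l → X k * X l = -(X l * X k) := by
    intro k l hk hl hkl
    have := hanti k l hkl
    rw [← hXX, ← hXX, hXH k hk, hXH l hl, Matrix.mul_neg, Matrix.mul_neg] at this
    have h2 := eq_neg_of_add_eq_zero_left this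
    rw [neg_neg] at h2
    rw [← h2, neg_neg]
  have hI : ∀ k, k ≠ 0 → (-Complex.I • X k).IsHermitian := by
    intro k hk
    rw [Matrix.IsHermitian, conjTranspose_smul, hXH k hk]
    simp
  have hI2 : ∀ k, k ≠ 0 → (-Complex.I • X k) * (-Complex.I • X k) = 1 := by
    intro k hk
    rw [smul_mul_smul_comm, hXself k hk]
    simp
  obtain ⟨U, hU, hU1, hU2⟩ := exists_unitary_conj_pauli (hI 1 (by decide)) (hI 2 (by decide))
    (hI2 1 (by decide)) (hI2 2 (by decide)) (by
      rw [smul_mul_smul_comm, smul_mul_smul_comm, hXanti 1 2 (by decide) (by decide) (by decide),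
        smul_neg])
  have hUU : Uᴴ * U = 1 := Matrix.mem_unitaryGroup_iff'.mp hU
  have hUU' : U * Uᴴ = 1 := Matrix.mem_unitaryGroup_iff.mp hU
  have e1 : U * X 1 * Uᴴ = Complex.I • pauli 2 := by
    rw [← hU1, Matrix.mul_smul, Matrix.smul_mul, smul_smul]
    simp
  have e2 : U * X 2 * Uᴴ = Complex.I • pauli 0 := by
    rw [← hU2, Matrix.mul_smul, Matrix.smul_mul, smul_smul]
    simp
  set Y : Mat2 := U * X 3 * Uᴴ with hY
  have hconj : ∀ S T : Mat2, (U * S * Uᴴ) * (U * T * Uᴴ) = U * (S * T) * Uᴴ := by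
    intro S T
    calc (U * S * Uᴴ) * (U * T * Uᴴ) = U * S * (Uᴴ * U) * T * Uᴴ := by noncomm_ring
      _ = U * (S * T) * Uᴴ := by rw [hUU]; noncomm_ring
  have hY1 : Y * pauli 2 = -(pauli 2 * Y) := by
    have : Y * (U * X 1 * Uᴴ) = -((U * X 1 * Uᴴ) * Y) := by
      rw [hconj, hconj, hXanti 3 1 (by decide) (by decide) (by decide)]; simp
    rw [e1, Matrix.mul_smul, Matrix.smul_mul, ← smul_neg] at this
    exact smul_right_injective _ Complex.I_ne_zero this
  have hY2 : Y * pauli 0 = -(pauli 0 * Y) := by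
    have : Y * (U * X 2 * Uᴴ) = -((U * X 2 * Uᴴ) * Y) := by
      rw [hconj, hconj, hXanti 3 2 (by decide) (by decide) (by decide)]; simp
    rw [e2, Matrix.mul_smul, Matrix.smul_mul, ← smul_neg] at this
    exact smul_right_injective _ Complex.I_ne_zero this
  have hY3 : Y * Yᴴ = 1 := by
    have : Yᴴ = U * (X 3)ᴴ * Uᴴ := by
      rw [hY]; simp [conjTranspose_mul, Matrix.mul_assoc]
    rw [this, hconj, hXX, hself, Matrix.mul_one, hUU']
  have y00 : Y 0 0 = 0 := by
    have := congrFun (congrFun hY1 0) 0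
    simp [Matrix.mul_apply, Fin.sum_univ_two, pauli, Matrix.vecMul, dotProduct] at this
    linear_combination this / 2
  have y11 : Y 1 1 = 0 := by
    have := congrFun (congrFun hY1 1) 1
    simp [Matrix.mul_apply, Fin.sum_univ_two, pauli, Matrix.vecMul, dotProduct] at this
    linear_combination -this / 2
  have y10 : Y 1 0 = - Y 0 1 := by
    have := congrFun (congrFun hY2 0) 0
    simp [Matrix.mul_apply, Fin.sum_univ_two, pauli, Matrix.vecMul, dotProduct] at this
    linear_combination this
  have y01 : Y 0 1 * star (Y 0 1) = 1 := by
    have := congrFun (congrFun hY3 0) 0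
    simpa [Matrix.mul_apply, Fin.sum_univ_two, y00] using this
  have hMX : ∀ k, U * M k * ((M 0)ᴴ * Uᴴ) = U * X k * Uᴴ := by
    intro k; simp only [hX]; noncomm_ring
  -- The second unitary undoes `M 0` as well as `U`, so that `U * M k * Vᵀ` is the conjugate of `X
  -- k`.
  refine ⟨U, hU, ((M 0)ᴴ * Uᴴ)ᵀ, ?_, ![1, Complex.I, Complex.I, Y 0 1], ?_, ?_⟩
  · rw [Matrix.mem_unitaryGroup_iff, star_eq_conjTranspose]
    have : ((M 0)ᴴ * Uᴴ)ᵀᴴ = (U * M 0)ᵀ := by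
      rw [← conjTranspose_mul, ← conjTranspose_transpose_eq_transpose_conjTranspose,
        conjTranspose_conjTranspose]
    rw [this, ← transpose_mul]
    have : U * M 0 * ((M 0)ᴴ * Uᴴ) = 1 := by
      rw [hMX]
      simp only [hX]
      rw [hself, Matrix.mul_one, hUU']
    rw [this, transpose_one]
  · intro k
    fin_cases k <;> simp
    exact y01
  · intro k
    rw [transpose_transpose, hMX]
    fin_cases k
    · change U * X 0 * Uᴴ = _
      rw [show X 0 = 1 from hself 0, Matrix.mul_one, hUU']
      simp [bellMat, Matrix.one_fin_two]
    · simp [e1, pauli, bellMat]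
    · simp [e2, pauli, bellMat]
    · change Y = _
      ext i j
      fin_cases i <;> fin_cases j <;> simp [bellMat, y00, y11, y10]

end CHSHFilter

namespace CHSHFilter

open Matrix

/-! ### Filters acting on ensembles of pure states -/

open scoped MatrixOrder in
lemma exists_eq_conjTranspose_mul_self {n : Type*} [Fintype n] [DecidableEq n]
    {A : Matrix n n ℂ} (hA : A.PosSemidef) : ∃ B : Matrix n n ℂ, A = Bᴴ * B := by
  obtain ⟨B, hB⟩ := CStarAlgebra.nonneg_iff_eq_star_mul_self.mp hA.nonneg
  exact ⟨B, hB⟩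

/-- The projector (times half the squared norm) on the vector with amplitudes `N i j / √2`. -/
def proj (N : Mat2) : Mat4 := Matrix.of fun p q => N p.1 p.2 * star (N q.1 q.2) / 2

lemma bellProjector_eq (k : Fin 4) : bellProjector k = proj (bellMat k) := by
  ext p q
  have h : (((1 / Real.sqrt 2 : ℝ) : ℂ)) * ((1 / Real.sqrt 2 : ℝ) : ℂ) = 1 / 2 := by
    rw [← Complex.ofReal_mul, div_mul_div_comm, Real.mul_self_sqrt (by norm_num)]
    norm_num
  simp only [bellProjector, Matrix.vecMulVec_apply, bellVector, proj, Matrix.of_apply, Pi.star_apply,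
    star_mul']
  rw [Complex.star_def, Complex.conj_ofReal]
  change _ * bellMat k p.1 p.2 * (_ * star (bellMat k q.1 q.2)) = _ * star (bellMat k q.1 q.2) / 2
  generalize star (bellMat k q.1 q.2) = x
  linear_combination (bellMat k p.1 p.2) * x * h

lemma kron_mulVec_apply (A B N : Mat2) (p : Fin 2 × Fin 2) :
    ∑ q : Fin 2 × Fin 2, (A ⊗ₖ B) p q * N q.1 q.2 = (A * N * Bᵀ) p.1 p.2 := by
  simp only [Fintype.sum_prod_type, Fin.sum_univ_two, Matrix.mul_apply, Matrix.kroneckerMap_apply,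
    Matrix.transpose_apply]
  ring

/-- A two-qubit vector is stored as its 2 × 2 amplitude matrix, on which `A ⊗ B` acts by `N ↦ A N
Bᵀ`; ensembles of pure states are filtered term by term. -/
lemma filterRaw_proj (N A B : Mat2) : filterRaw (proj N) A B = proj (A * N * Bᵀ) := by
  have h : proj N = (1 / 2 : ℂ) • Matrix.vecMulVec (fun p => N p.1 p.2)
      (star fun p : Fin 2 × Fin 2 => N p.1 p.2) := by
    ext p q; simp [proj, Matrix.vecMulVec_apply]; ring
  have hv : (A ⊗ₖ B) *ᵥ (fun p => N p.1 p.2) = fun p => (A * N * Bᵀ) p.1 p.2 := by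
    ext p; exact kron_mulVec_apply A B N p
  rw [filterRaw, h, Matrix.mul_smul, Matrix.smul_mul, Matrix.mul_vecMulVec, Matrix.vecMulVec_mul,
    ← Matrix.star_mulVec, hv]
  ext p q; simp [proj, Matrix.vecMulVec_apply]; ring

lemma proj_smul (c : ℂ) (N : Mat2) : proj (c • N) = (c * star c) • proj N := by
  ext p q; simp [proj]; ring

lemma trace_proj (N : Mat2) : (proj N).trace = (N * Nᴴ).trace / 2 := by
  simp [proj, Matrix.trace, Fintype.sum_prod_type, Fin.sum_univ_two, Matrix.mul_apply]; ring

lemma trace_proj_re (N : Mat2) : (proj N).trace.re =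
    (‖N 0 0‖ ^ 2 + ‖N 0 1‖ ^ 2 + ‖N 1 0‖ ^ 2 + ‖N 1 1‖ ^ 2) / 2 := by
  simp only [← Complex.normSq_eq_norm_sq, Complex.normSq_apply]
  simp [proj, Matrix.trace, Fintype.sum_prod_type, Fin.sum_univ_two]
  ring

lemma posSemidef_proj (N : Mat2) : (proj N).PosSemidef := by
  have h : proj N = (1 / 2 : ℂ) • Matrix.vecMulVec (fun p => N p.1 p.2)
      (star fun p : Fin 2 × Fin 2 => N p.1 p.2) := by
    ext p q; simp [proj, Matrix.vecMulVec_apply]; ring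
  rw [h]
  have h2 : (0 : ℂ) ≤ 1 / 2 := by rw [Complex.le_def]; constructor <;> norm_num
  exact (Matrix.posSemidef_vecMulVec_self_star _).smul h2

/-- The Bell mixture with weights `p`. -/
def bellMix (p : Fin 4 → ℝ) : Mat4 := ∑ k, ((p k : ℝ) : ℂ) • bellProjector k

lemma filterRaw_smul (c : ℂ) (ρ : Mat4) (A B : Mat2) :
    filterRaw (c • ρ) A B = c • filterRaw ρ A B := by
  simp [filterRaw]

lemma filterRaw_sum {ι : Type*} (s : Finset ι) (f : ι → Mat4) (A B : Mat2) :
    filterRaw (∑ i ∈ s, f i) A B = ∑ i ∈ s, filterRaw (f i) A B := by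
  simp [filterRaw, Matrix.mul_sum, Matrix.sum_mul]

lemma filterRaw_filterRaw (ρ : Mat4) (A B C D : Mat2) :
    filterRaw (filterRaw ρ A B) C D = filterRaw ρ (C * A) (D * B) := by
  simp only [filterRaw, Matrix.mul_kronecker_mul, Matrix.conjTranspose_mul, Matrix.mul_assoc]

lemma filterRaw_one (ρ : Mat4) : filterRaw ρ 1 1 = ρ := by
  simp [filterRaw]

lemma filterRaw_smul_smul (ρ : Mat4) (A B : Mat2) (s t : ℂ) :
    filterRaw ρ (s • A) (t • B) = (s * t * star (s * t)) • filterRaw ρ A B := by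
  simp only [filterRaw, Matrix.smul_kronecker, Matrix.kronecker_smul, Matrix.conjTranspose_smul,
    Matrix.smul_mul, Matrix.mul_smul, smul_smul, star_mul']
  congr 1
  ring

lemma filterRaw_bellMix (p : Fin 4 → ℝ) (A B : Mat2) :
    filterRaw (bellMix p) A B = ∑ k, ((p k : ℝ) : ℂ) • proj (A * bellMat k * Bᵀ) := by
  simp only [bellMix, filterRaw_sum, filterRaw_smul, bellProjector_eq, filterRaw_proj]

lemma PosSemidef_filterRaw {ρ : Mat4} (hρ : ρ.PosSemidef) (A B : Mat2) :
    (filterRaw ρ A B).PosSemidef := hρ.mul_mul_conjTranspose_same _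

lemma trace_eq_re_of_posSemidef {n : Type*} [Fintype n] {ρ : Matrix n n ℂ} (hρ : ρ.PosSemidef) :
    ρ.trace = (ρ.trace.re : ℂ) := by
  obtain ⟨_, h⟩ := Complex.le_def.mp hρ.trace_nonneg
  apply Complex.ext
  · simp
  · rw [← h]; simp

lemma trace_re_nonneg {n : Type*} [Fintype n] {ρ : Matrix n n ℂ} (hρ : ρ.PosSemidef) :
    0 ≤ ρ.trace.re :=
  (Complex.le_def.mp hρ.trace_nonneg).1

lemma posSemidef_bellMix {p : Fin 4 → ℝ} (hp : ∀ k, 0 ≤ p k) : (bellMix p).PosSemidef := by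
  refine Matrix.posSemidef_sum _ fun k _ => ?_
  rw [bellProjector_eq]
  exact (posSemidef_proj _).smul (by exact_mod_cast hp k)

lemma trace_proj_bellMat (k : Fin 4) : (proj (bellMat k)).trace = 1 := by
  rw [trace_proj]
  fin_cases k <;>
    simp [bellMat, Matrix.trace, Fin.sum_univ_two, Matrix.vecMul, dotProduct]

lemma trace_bellMix (p : Fin 4 → ℝ) : (bellMix p).trace = ((∑ k, p k : ℝ) : ℂ) := by
  simp [bellMix, Matrix.trace_sum, Matrix.trace_smul, bellProjector_eq, trace_proj_bellMat]

/-! ### The spin flip and its spectral invariants -/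

/-- The spin flip metric on two qubits. -/
def flipMat4 : Mat4 := flipMat ⊗ₖ flipMat

/-- The spin flip `(σ_y ⊗ σ_y) ρᵀ (σ_y ⊗ σ_y)`. -/
def spinFlip (ρ : Mat4) : Mat4 := flipMat4 * ρᵀ * flipMat4

/-- The antisymmetric form on a two-dimensional space is unique up to scale, and `A` rescales it by
its determinant. -/
lemma transpose_mul_flipMat_mul (A : Mat2) : Aᵀ * flipMat * A = A.det • flipMat := by
  ext i j
  fin_cases i <;> fin_cases j <;>
    simp [flipMat, Matrix.mul_apply, Fin.sum_univ_two, Matrix.det_fin_two] <;> ring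

lemma flipMat_mul_flipMat : flipMat * flipMat = -1 := by
  ext i j
  fin_cases i <;> fin_cases j <;> simp [flipMat, Matrix.mul_apply, Fin.sum_univ_two]

lemma flipMat4_mul_self : flipMat4 * flipMat4 = 1 := by
  rw [flipMat4, ← Matrix.mul_kronecker_mul, flipMat_mul_flipMat]
  ext p q
  simp [Matrix.kroneckerMap_apply, Matrix.one_apply, Prod.ext_iff]
  split_ifs <;> simp_all

lemma conjTranspose_flipMat4 : flipMat4ᴴ = flipMat4 := by
  have h : flipMatᴴ = -flipMat := by
    ext i j; fin_cases i <;> fin_cases j <;> simp [flipMat]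
  rw [flipMat4, Matrix.conjTranspose_kronecker, h]
  ext
  simp

lemma transpose_mul_flipMat4_mul (A B : Mat2) :
    (A ⊗ₖ B)ᵀ * flipMat4 * (A ⊗ₖ B) = (A.det * B.det) • flipMat4 := by
  have h : (A ⊗ₖ B)ᵀ = Aᵀ ⊗ₖ Bᵀ := by ext p q; simp
  rw [h, flipMat4, ← Matrix.mul_kronecker_mul, ← Matrix.mul_kronecker_mul,
    transpose_mul_flipMat_mul, transpose_mul_flipMat_mul, Matrix.smul_kronecker,
    Matrix.kronecker_smul, smul_smul]

/-- `lam` lists the square roots of the eigenvalues of `ρ` times its spin flip. -/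
def FlipSpectrum (ρ : Mat4) (lam : Fin 4 → ℝ) : Prop :=
  ∀ z : ℂ, (Matrix.scalar (Fin 2 × Fin 2) z - ρ * spinFlip ρ).det = ∏ k, (z - ((lam k : ℝ) : ℂ) ^ 2)

lemma det_scalar_sub_smul {M : Mat4} {lam : Fin 4 → ℝ}
    (h : ∀ z : ℂ, (Matrix.scalar (Fin 2 × Fin 2) z - M).det = ∏ k, (z - ((lam k : ℝ) : ℂ) ^ 2))
    (c : ℝ) (z : ℂ) :
    (Matrix.scalar (Fin 2 × Fin 2) z - ((c : ℂ) ^ 2) • M).det =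
      ∏ k, (z - (((c • lam) k : ℝ) : ℂ) ^ 2) := by
  by_cases hc : c = 0
  · subst hc
    simp [Matrix.scalar_apply]
  · have hc' : ((c : ℂ) ^ 2) ≠ 0 := by exact_mod_cast pow_ne_zero 2 hc
    have e : Matrix.scalar (Fin 2 × Fin 2) z - ((c : ℂ) ^ 2) • M =
        ((c : ℂ) ^ 2) • (Matrix.scalar (Fin 2 × Fin 2) (z / (c : ℂ) ^ 2) - M) := by
      rw [smul_sub]
      congr 1
      ext p q
      simp only [Matrix.scalar_apply, Matrix.smul_apply, Matrix.diagonal_apply, smul_eq_mul]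
      split_ifs
      · field_simp
      · simp
    rw [e, Matrix.det_smul, h]
    have : ((c : ℂ) ^ 2) ^ Fintype.card (Fin 2 × Fin 2) = ∏ _k : Fin 4, (c : ℂ) ^ 2 := by simp
    rw [this, ← Finset.prod_mul_distrib]
    refine Finset.prod_congr rfl fun k _ => ?_
    simp only [Pi.smul_apply, smul_eq_mul, Complex.ofReal_mul]
    field_simp

lemma FlipSpectrum.smul {ρ : Mat4} {lam : Fin 4 → ℝ} (h : FlipSpectrum ρ lam) (c : ℝ) :
    FlipSpectrum ((c : ℂ) • ρ) (c • lam) := by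
  intro z
  have e : ((c : ℂ) • ρ) * spinFlip ((c : ℂ) • ρ) = ((c : ℂ) ^ 2) • (ρ * spinFlip ρ) := by
    simp only [spinFlip, Matrix.transpose_smul, Matrix.smul_mul, Matrix.mul_smul, smul_smul]
    congr 1; ring
  rw [e]
  exact det_scalar_sub_smul h c z

/-- With `G = A ⊗ B`, the product of the filtered state and its flip begins with a factor `G`.
Moving it cyclically to the end keeps the characteristic polynomial and closes up `Gᵀ F G`; with the
inner `Gᴴ F Gᴴᵀ`, both collapse to determinants times the flip metric `F`. No inverse is used, so
singular filters are covered. -/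
lemma FlipSpectrum.filterRaw {ρ : Mat4} {lam : Fin 4 → ℝ} (h : FlipSpectrum ρ lam) (A B : Mat2) :
    FlipSpectrum (filterRaw ρ A B) ((‖A.det‖ * ‖B.det‖) • lam) := by
  intro z
  set G : Mat4 := A ⊗ₖ B with hG
  have e1 : CHSHFilter.filterRaw ρ A B * spinFlip (CHSHFilter.filterRaw ρ A B) =
      G * (ρ * (Gᴴ * flipMat4 * Gᴴᵀ) * ρᵀ * Gᵀ * flipMat4) := by
    simp only [CHSHFilter.filterRaw, spinFlip, Matrix.transpose_mul, ← hG, Matrix.mul_assoc]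
  have e2 : Gᴴ * flipMat4 * Gᴴᵀ = star (A.det * B.det) • flipMat4 := by
    have := congrArg (fun M : Mat4 => Mᴴᵀ) (transpose_mul_flipMat4_mul A B)
    have hf : flipMat4ᴴᵀ = flipMat4 := by
      rw [conjTranspose_flipMat4, flipMat4]
      ext p q
      rcases p with ⟨p1, p2⟩
      rcases q with ⟨q1, q2⟩
      fin_cases p1 <;> fin_cases p2 <;> fin_cases q1 <;> fin_cases q2 <;> simp [flipMat]
    simp only [Matrix.conjTranspose_mul, Matrix.transpose_mul, Matrix.conjTranspose_smul,
      Matrix.transpose_smul, hf, ← hG] at this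
    rw [← this]
    rfl
  have e3 : (ρ * (Gᴴ * flipMat4 * Gᴴᵀ) * ρᵀ * Gᵀ * flipMat4) * G =
      (((‖A.det‖ * ‖B.det‖ : ℝ) : ℂ) ^ 2) • (ρ * spinFlip ρ) := by
    rw [e2]
    have : Gᵀ * flipMat4 * G = (A.det * B.det) • flipMat4 := transpose_mul_flipMat4_mul A B
    calc ρ * (star (A.det * B.det) • flipMat4) * ρᵀ * Gᵀ * flipMat4 * G
        = ρ * (star (A.det * B.det) • flipMat4) * ρᵀ * (Gᵀ * flipMat4 * G) := by
          simp only [Matrix.mul_assoc]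
      _ = (star (A.det * B.det) * (A.det * B.det)) • (ρ * spinFlip ρ) := by
          rw [this, spinFlip]
          simp only [Matrix.mul_smul, Matrix.smul_mul, smul_smul, Matrix.mul_assoc]
          congr 1; ring
      _ = _ := by
          congr 1
          rw [Complex.star_def, ← Complex.normSq_eq_conj_mul_self, Complex.normSq_eq_norm_sq, norm_mul]
          push_cast; ring
  have e4 : (Matrix.scalar (Fin 2 × Fin 2) z - CHSHFilter.filterRaw ρ A B *
      spinFlip (CHSHFilter.filterRaw ρ A B)).det =
      (Matrix.scalar (Fin 2 × Fin 2) z -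
        (((‖A.det‖ * ‖B.det‖ : ℝ) : ℂ) ^ 2) • (ρ * spinFlip ρ)).det := by
    rw [← Matrix.eval_charpoly, ← Matrix.eval_charpoly, e1, Matrix.charpoly_mul_comm, e3]
  rw [e4]
  exact det_scalar_sub_smul h _ z

/-- The spectrum is encoded by polynomial identities rather than by an eigenvalue function, so that
limits of states with their spectra need no continuity of eigenvalues. -/
lemma isClosed_flipSpectrum : IsClosed {x : Mat4 × (Fin 4 → ℝ) | FlipSpectrum x.1 x.2} := by
  simp only [FlipSpectrum, Set.ofPred_forall]
  refine isClosed_iInter fun z => isClosed_eq ?_ ?_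
  · refine Continuous.matrix_det ?_
    unfold spinFlip
    fun_prop
  · fun_prop

/-- The characteristic polynomial fixes the multiset of squares, nonnegativity fixes the multiset of
roots, and sorting fixes the list. -/
lemma FlipSpectrum.eq_of_antitone {ρ : Mat4} {lam mu : Fin 4 → ℝ} (h : FlipSpectrum ρ lam)
    (h' : FlipSpectrum ρ mu) (hl : Antitone lam) (hm : Antitone mu) (hl0 : ∀ k, 0 ≤ lam k)
    (hm0 : ∀ k, 0 ≤ mu k) : lam = mu := by
  have key : ∀ nu : Fin 4 → ℝ, FlipSpectrum ρ nu → (ρ * spinFlip ρ).charpoly =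
      (Multiset.map (fun a => Polynomial.X - Polynomial.C a)
        (Multiset.map (fun k => ((nu k : ℝ) : ℂ) ^ 2) Finset.univ.val)).prod := by
    intro nu hnu
    refine Polynomial.funext fun z => ?_
    rw [Matrix.eval_charpoly, hnu z, Polynomial.eval_multiset_prod, Multiset.map_map,
      Multiset.map_map]
    simp [Finset.prod]
  have hroots : Multiset.map (fun k => ((lam k : ℝ) : ℂ) ^ 2) Finset.univ.val =
      Multiset.map (fun k => ((mu k : ℝ) : ℂ) ^ 2) Finset.univ.val := by
    rw [← Polynomial.roots_multiset_prod_X_sub_C (Multiset.map (fun k => ((lam k : ℝ) : ℂ) ^ 2) _),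
      ← key lam h, key mu h', Polynomial.roots_multiset_prod_X_sub_C]
  have hmap : ∀ nu : Fin 4 → ℝ, (∀ k, 0 ≤ nu k) →
      Multiset.map (fun w : ℂ => Real.sqrt w.re)
        (Multiset.map (fun k => ((nu k : ℝ) : ℂ) ^ 2) Finset.univ.val) =
      Multiset.map nu Finset.univ.val := by
    intro nu hnu
    rw [Multiset.map_map]
    refine Multiset.map_congr rfl fun k _ => ?_
    simp only [Function.comp]
    rw [← Complex.ofReal_pow, Complex.ofReal_re, Real.sqrt_sq (hnu k)]
  have hms : Multiset.map lam Finset.univ.val = Multiset.map mu Finset.univ.val := by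
    rw [← hmap lam hl0, ← hmap mu hm0, hroots]
  have hl' : (List.ofFn lam).Pairwise (· ≥ ·) := by
    rw [List.pairwise_ofFn]; exact fun i j hij => hl hij.le
  have hm' : (List.ofFn mu).Pairwise (· ≥ ·) := by
    rw [List.pairwise_ofFn]; exact fun i j hij => hm hij.le
  have hperm : (List.ofFn lam).Perm (List.ofFn mu) := by
    rw [← Multiset.coe_eq_coe]
    simpa [Fin.univ_val_map] using hms
  exact List.ofFn_injective (hperm.eq_of_pairwise (fun a b _ _ h1 h2 => le_antisymm h2 h1) hl' hm')

end CHSHFilter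

namespace CHSHFilter

open Matrix

/-! ### Bell diagonal states are the states invariant under the spin flip -/

lemma LocallyUnitarilyEquivalent.symm {ρ ρ' : Mat4} (h : LocallyUnitarilyEquivalent ρ ρ') :
    LocallyUnitarilyEquivalent ρ' ρ := by
  obtain ⟨U, hU, V, hV, rfl⟩ := h
  refine ⟨Uᴴ, Unitary.star_mem hU, Vᴴ, Unitary.star_mem hV, ?_⟩
  change ρ = filterRaw (filterRaw ρ U V) Uᴴ Vᴴ
  rw [filterRaw_filterRaw, ← star_eq_conjTranspose, ← star_eq_conjTranspose,
    Matrix.mem_unitaryGroup_iff'.mp hU, Matrix.mem_unitaryGroup_iff'.mp hV, filterRaw_one]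

lemma LocallyUnitarilyEquivalent.trans {ρ₁ ρ₂ ρ₃ : Mat4} (h : LocallyUnitarilyEquivalent ρ₁ ρ₂)
    (h' : LocallyUnitarilyEquivalent ρ₂ ρ₃) : LocallyUnitarilyEquivalent ρ₁ ρ₃ := by
  obtain ⟨U, hU, V, hV, rfl⟩ := h
  obtain ⟨U', hU', V', hV', rfl⟩ := h'
  exact ⟨U' * U, mul_mem hU' hU, V' * V, mul_mem hV' hV, filterRaw_filterRaw ρ₁ U V U' V'⟩

lemma norm_det_of_mem_unitaryGroup {U : Mat2} (hU : U ∈ Matrix.unitaryGroup (Fin 2) ℂ) :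
    ‖U.det‖ = 1 := by
  have h := Matrix.det_of_mem_unitary hU
  exact CStarRing.norm_of_mem_unitary h

lemma LocallyUnitarilyEquivalent.flipSpectrum {ρ ρ' : Mat4} {lam : Fin 4 → ℝ}
    (h : LocallyUnitarilyEquivalent ρ ρ') (hl : FlipSpectrum ρ lam) : FlipSpectrum ρ' lam := by
  obtain ⟨U, hU, V, hV, rfl⟩ := h
  have := hl.filterRaw U V
  rwa [norm_det_of_mem_unitaryGroup hU, norm_det_of_mem_unitaryGroup hV, one_mul, one_smul] at this

lemma LocallyUnitarilyEquivalent.posSemidef {ρ ρ' : Mat4} (h : LocallyUnitarilyEquivalent ρ ρ')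
    (hρ : ρ.PosSemidef) : ρ'.PosSemidef := by
  obtain ⟨U, hU, V, hV, rfl⟩ := h
  exact PosSemidef_filterRaw hρ U V

lemma trace_filterRaw_unitary (ρ : Mat4) {U V : Mat2} (hU : U ∈ Matrix.unitaryGroup (Fin 2) ℂ)
    (hV : V ∈ Matrix.unitaryGroup (Fin 2) ℂ) : (filterRaw ρ U V).trace = ρ.trace := by
  rw [filterRaw, Matrix.trace_mul_comm, ← Matrix.mul_assoc, Matrix.conjTranspose_kronecker,
    ← Matrix.mul_kronecker_mul, ← star_eq_conjTranspose, ← star_eq_conjTranspose,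
    Matrix.mem_unitaryGroup_iff'.mp hU, Matrix.mem_unitaryGroup_iff'.mp hV]
  simp

lemma LocallyUnitarilyEquivalent.trace_eq {ρ ρ' : Mat4} (h : LocallyUnitarilyEquivalent ρ ρ') :
    ρ'.trace = ρ.trace := by
  obtain ⟨U, hU, V, hV, rfl⟩ := h
  exact trace_filterRaw_unitary ρ hU hV

lemma LocallyUnitarilyEquivalent.isState {ρ ρ' : Mat4} (h : LocallyUnitarilyEquivalent ρ ρ')
    (hρ : IsState ρ) : IsState ρ' := ⟨h.posSemidef hρ.1, h.trace_eq.trans hρ.2⟩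

/-- Phases that make the Bell vectors invariant under the spin flip. -/
def magicPhase : Fin 4 → ℂ := ![1, Complex.I, Complex.I, 1]

/-- The unitary matrix whose columns are the Bell vectors with phases `magicPhase`. -/
def magic : Matrix (Fin 2 × Fin 2) (Fin 4) ℂ := Matrix.of fun p k =>
  ((1 / Real.sqrt 2 : ℝ) : ℂ) * (magicPhase k * bellMat k p.1 p.2)

lemma ofReal_inv_sqrt_two_mul_self :
    ((1 / Real.sqrt 2 : ℝ) : ℂ) * ((1 / Real.sqrt 2 : ℝ) : ℂ) = 1 / 2 := by
  rw [← Complex.ofReal_mul, div_mul_div_comm, Real.mul_self_sqrt (by norm_num)]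
  norm_num

lemma magicPhase_mul_star (k : Fin 4) : magicPhase k * star (magicPhase k) = 1 := by
  fin_cases k <;> simp [magicPhase]

lemma magic_conjTranspose_mul : magicᴴ * magic = 1 := by
  have h := ofReal_inv_sqrt_two_mul_self
  have h' : ∀ x y : ℂ, star (((1 / Real.sqrt 2 : ℝ) : ℂ) * x) * (((1 / Real.sqrt 2 : ℝ) : ℂ) * y) =
      star x * y / 2 := by
    intro x y
    rw [star_mul', Complex.star_def, Complex.conj_ofReal]
    linear_combination (starRingEnd ℂ) x * y * h
  ext k l
  simp only [Matrix.mul_apply, Matrix.conjTranspose_apply, magic, Matrix.of_apply, h']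
  fin_cases k <;> fin_cases l <;>
    simp [Fintype.sum_prod_type, Fin.sum_univ_two, magicPhase, bellMat] <;>
      first | (norm_num; done) | ring

lemma magic_mul_conjTranspose : magic * magicᴴ = 1 :=
  (Matrix.mul_eq_one_comm_of_equiv (Fintype.equivOfCardEq (by simp))).mp magic_conjTranspose_mul

/-- With these phases every Bell vector is real for the antiunitary spin flip, so in this basis the
spin flip of an operator is its plain transpose. -/
lemma flipMat4_mul_magic : flipMat4 * magic = magicᴴᵀ := by
  ext p k
  have hs : (starRingEnd ℂ) ((1 / Real.sqrt 2 : ℝ) : ℂ) = ((1 / Real.sqrt 2 : ℝ) : ℂ) :=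
    Complex.conj_ofReal _
  rcases p with ⟨i, j⟩
  simp only [Matrix.mul_apply, Matrix.conjTranspose_apply, Matrix.transpose_apply, magic,
    Matrix.of_apply, star_mul', Complex.star_def, hs]
  generalize ((1 / Real.sqrt 2 : ℝ) : ℂ) = s
  fin_cases i <;> fin_cases j <;> fin_cases k <;>
    simp [Fintype.sum_prod_type, Fin.sum_univ_two, magicPhase, bellMat, flipMat4, flipMat]

lemma bellMix_eq_magic (p : Fin 4 → ℝ) :
    bellMix p = magic * Matrix.diagonal (fun k => ((p k : ℝ) : ℂ)) * magicᴴ := by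
  have h := ofReal_inv_sqrt_two_mul_self
  ext x y
  rw [Matrix.mul_apply]
  simp only [bellMix, Matrix.sum_apply, Matrix.mul_diagonal, Matrix.smul_apply, bellProjector_eq,
    proj, Matrix.of_apply, Matrix.conjTranspose_apply, magic, smul_eq_mul]
  refine Finset.sum_congr rfl fun k _ => ?_
  rw [star_mul', star_mul', Complex.star_def, Complex.conj_ofReal]
  have h2 := magicPhase_mul_star k
  rw [Complex.star_def] at h2
  generalize ((1 / Real.sqrt 2 : ℝ) : ℂ) = s at h
  linear_combination (-(p k : ℂ) * bellMat k x.1 x.2 * (starRingEnd ℂ) (bellMat k y.1 y.2) / 2) * h2 -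
    (p k : ℂ) * bellMat k x.1 x.2 * (starRingEnd ℂ) (bellMat k y.1 y.2) * magicPhase k *
      (starRingEnd ℂ) (magicPhase k) * h

lemma spinFlip_bellMix (p : Fin 4 → ℝ) : spinFlip (bellMix p) = bellMix p := by
  have h1 : magicᴴᵀ = flipMat4 * magic := flipMat4_mul_magic.symm
  have h2 : magicᵀ * flipMat4 = magicᴴ := by
    have := congrArg Matrix.conjTranspose h1
    have e : magicᴴᵀᴴ = magicᵀ := by ext; simp
    rw [e, Matrix.conjTranspose_mul, conjTranspose_flipMat4] at this
    rw [this, Matrix.mul_assoc, flipMat4_mul_self, Matrix.mul_one]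
  rw [spinFlip, bellMix_eq_magic, Matrix.transpose_mul, Matrix.transpose_mul, h1,
    Matrix.diagonal_transpose]
  generalize Matrix.diagonal (fun k => ((p k : ℝ) : ℂ)) = D
  calc flipMat4 * (flipMat4 * magic * (D * magicᵀ)) * flipMat4
      = (flipMat4 * flipMat4) * magic * D * (magicᵀ * flipMat4) := by
        simp only [Matrix.mul_assoc]
    _ = _ := by rw [flipMat4_mul_self, h2, Matrix.one_mul]

/-- A Bell mixture is its own spin flip, so the product in question is its square, diagonal in the
magic basis with entries `p k ^ 2`. -/
lemma flipSpectrum_bellMix (p : Fin 4 → ℝ) : FlipSpectrum (bellMix p) p := by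
  intro z
  rw [spinFlip_bellMix]
  have e : Matrix.scalar (Fin 2 × Fin 2) z - bellMix p * bellMix p =
      magic * Matrix.diagonal (fun k => z - ((p k : ℝ) : ℂ) ^ 2) * magicᴴ := by
    have hd : Matrix.diagonal (fun k => z - ((p k : ℝ) : ℂ) ^ 2) = z • (1 : Matrix (Fin 4) (Fin 4) ℂ) -
        Matrix.diagonal (fun k => ((p k : ℝ) : ℂ)) * Matrix.diagonal (fun k => ((p k : ℝ) : ℂ)) := by
      rw [Matrix.diagonal_mul_diagonal]
      ext i j
      by_cases hij : i = j
      · subst hij; simp [sq]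
      · simp [hij]
    rw [hd, Matrix.mul_sub, Matrix.sub_mul, bellMix_eq_magic]
    congr 1
    · rw [Matrix.mul_smul, Matrix.mul_one, Matrix.smul_mul, magic_mul_conjTranspose]
      ext i j
      simp [Matrix.scalar_apply, Matrix.diagonal_apply, Matrix.one_apply]
    · generalize Matrix.diagonal (fun k => ((p k : ℝ) : ℂ)) = D
      calc magic * D * magicᴴ * (magic * D * magicᴴ)
          = magic * D * (magicᴴ * magic) * D * magicᴴ := by
            simp only [Matrix.mul_assoc]
        _ = _ := by rw [magic_conjTranspose_mul, Matrix.mul_one]; simp only [Matrix.mul_assoc]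
  rw [e, Matrix.det_conj_of_mul_eq_one magic_mul_conjTranspose magic_conjTranspose_mul,
    Matrix.det_diagonal]

lemma nonneg_of_posSemidef_bellMix {p : Fin 4 → ℝ} (h : (bellMix p).PosSemidef) (k : Fin 4) :
    0 ≤ p k := by
  have h1 := h.conjTranspose_mul_mul_same magic
  have h2 : magicᴴ * bellMix p * magic = Matrix.diagonal (fun k => ((p k : ℝ) : ℂ)) := by
    rw [bellMix_eq_magic]
    generalize Matrix.diagonal (fun k => ((p k : ℝ) : ℂ)) = D
    calc magicᴴ * (magic * D * magicᴴ) * magic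
        = (magicᴴ * magic) * D * (magicᴴ * magic) := by simp only [Matrix.mul_assoc]
      _ = _ := by rw [magic_conjTranspose_mul, Matrix.one_mul, Matrix.mul_one]
  rw [h2, Matrix.posSemidef_diagonal_iff] at h1
  exact_mod_cast h1 k

/-- In the magic basis a flip-invariant Hermitian operator is both Hermitian and symmetric, hence
real. A real orthogonal matrix diagonalises it, and real combinations of magic vectors are again
flip-real. -/
lemma exists_flipReal_decomposition {ρ : Mat4} (hρ : ρ.IsHermitian) (hf : spinFlip ρ = ρ) :
    ∃ (e : Fin 4 → ℝ) (M : Fin 4 → Mat2), (∀ k, IsFlipReal (M k)) ∧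
      (∀ k l, (M k * (M l)ᴴ).trace = if k = l then 2 else 0) ∧
      ρ = ∑ k, ((e k : ℝ) : ℂ) • proj (M k) := by
  set S : Matrix (Fin 4) (Fin 4) ℂ := magicᴴ * ρ * magic with hS
  have hSH : Sᴴ = S := by
    rw [hS, Matrix.conjTranspose_mul, Matrix.conjTranspose_mul, hρ.eq,
      Matrix.conjTranspose_conjTranspose, Matrix.mul_assoc]
  have hST : Sᵀ = S := by
    have h2 : magicᵀ = magicᴴ * flipMat4 := by
      have := congrArg Matrix.conjTranspose flipMat4_mul_magic
      have e : magicᴴᵀᴴ = magicᵀ := by ext; simp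
      rw [← e, ← this, Matrix.conjTranspose_mul, conjTranspose_flipMat4]
    have : Sᵀ = magicᴴ * spinFlip ρ * magic := by
      rw [hS, Matrix.transpose_mul, Matrix.transpose_mul, h2, ← flipMat4_mul_magic, spinFlip]
      simp only [Matrix.mul_assoc]
    rw [this, hf]
  have hSre : ∀ i j, ((S i j).re : ℂ) = S i j := by
    intro i j
    have h1 : star (S j i) = S i j := congrFun (congrFun hSH i) j
    have h2 : S j i = S i j := congrFun (congrFun hST i) j
    rw [h2] at h1
    exact Complex.conj_eq_iff_re.mp h1
  set R : Matrix (Fin 4) (Fin 4) ℝ := Matrix.of fun i j => (S i j).re with hR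
  have hRH : R.IsHermitian := by
    ext i j
    have h2 : S j i = S i j := congrFun (congrFun hST i) j
    simp [hR, h2]
  obtain ⟨O, e, hOO, hspec⟩ : ∃ (O : Matrix (Fin 4) (Fin 4) ℝ) (e : Fin 4 → ℝ),
      Oᵀ * O = 1 ∧ R = O * Matrix.diagonal e * Oᵀ := by
    refine ⟨hRH.eigenvectorUnitary, hRH.eigenvalues, ?_, ?_⟩
    · rw [← Matrix.conjTranspose_eq_transpose_of_trivial, ← star_eq_conjTranspose]
      exact Unitary.coe_star_mul_self hRH.eigenvectorUnitary
    · have := hRH.spectral_theorem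
      rw [Unitary.conjStarAlgAut_apply] at this
      rw [← Matrix.conjTranspose_eq_transpose_of_trivial, ← star_eq_conjTranspose]
      simpa using this
  refine ⟨e, fun k => ∑ l, ((O l k : ℝ) : ℂ) • (magicPhase l • bellMat l), ?_, ?_, ?_⟩
  · intro k
    constructor <;>
    simp [Fin.sum_univ_four, magicPhase, bellMat, Matrix.add_apply]
    ring
  · intro k l
    have h := congrFun (congrFun hOO k) l
    rw [Matrix.mul_apply, Fin.sum_univ_four, Matrix.one_apply] at h
    simp only [Matrix.transpose_apply] at h
    have hc := congrArg Complex.ofReal h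
    simp only [Complex.ofReal_add, Complex.ofReal_mul, apply_ite Complex.ofReal,
      Complex.ofReal_one, Complex.ofReal_zero] at hc
    have e : (if k = l then (2 : ℂ) else 0) = 2 * if k = l then 1 else 0 := by split_ifs <;> simp
    rw [e, ← hc]
    obtain ⟨o, ho⟩ : ∃ o : Fin 4 → Fin 4 → ℂ, ∀ i j, ((O i j : ℝ) : ℂ) = o i j :=
      ⟨_, fun _ _ => rfl⟩
    have hos : ∀ i j, (starRingEnd ℂ) (o i j) = o i j := fun i j => by
      rw [← ho, Complex.conj_ofReal]
    simp only [ho]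
    simp [Fin.sum_univ_four, magicPhase, bellMat, Matrix.trace, Fin.sum_univ_two, hos,
      Matrix.vecMul, dotProduct]
    ring_nf
    simp only [Complex.I_sq]
    ring
  · have hρS : ρ = magic * S * magicᴴ := by
      rw [hS]
      calc ρ = (magic * magicᴴ) * ρ * (magic * magicᴴ) := by
            rw [magic_mul_conjTranspose, Matrix.one_mul, Matrix.mul_one]
        _ = _ := by simp only [Matrix.mul_assoc]
    set Oc : Matrix (Fin 4) (Fin 4) ℂ := O.map Complex.ofReal with hOc
    have hSO : S = Oc * Matrix.diagonal (fun k => ((e k : ℝ) : ℂ)) * Ocᴴ := by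
      ext i j
      have := congrFun (congrFun hspec i) j
      rw [← hSre i j]
      change ((R i j : ℝ) : ℂ) = _
      rw [this]
      simp [Matrix.mul_apply, Matrix.diagonal_apply, hOc]
    have hcol : ∀ p k, (magic * Oc) p k = ((1 / Real.sqrt 2 : ℝ) : ℂ) *
        (∑ l, ((O l k : ℝ) : ℂ) • (magicPhase l • bellMat l)) p.1 p.2 := by
      intro p k
      simp only [Matrix.mul_apply, magic, Matrix.of_apply, hOc, Matrix.map_apply, Matrix.sum_apply,
        Matrix.smul_apply, smul_eq_mul, Finset.mul_sum]
      refine Finset.sum_congr rfl fun l _ => by ring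
    have h2 : ρ = (magic * Oc) * Matrix.diagonal (fun k => ((e k : ℝ) : ℂ)) *
        (magic * Oc)ᴴ := by
      rw [hρS, hSO, Matrix.conjTranspose_mul]
      simp only [Matrix.mul_assoc]
    rw [h2]
    ext p q
    rw [Matrix.mul_apply, Matrix.sum_apply]
    refine Finset.sum_congr rfl fun k _ => ?_
    rw [Matrix.mul_diagonal, Matrix.conjTranspose_apply, hcol, hcol, star_mul', Complex.star_def,
      Complex.conj_ofReal, Matrix.smul_apply, proj, Matrix.of_apply, smul_eq_mul, Complex.star_def]
    linear_combination (((e k : ℝ) : ℂ) *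
      (∑ l, ((O l k : ℝ) : ℂ) • (magicPhase l • bellMat l)) p.1 p.2 * (starRingEnd ℂ)
      ((∑ l, ((O l k : ℝ) : ℂ) • (magicPhase l • bellMat l)) q.1 q.2)) *
      ofReal_inv_sqrt_two_mul_self

/-- The eigenvectors form an orthonormal frame of flip-real matrices, which local unitaries carry to
the Bell frame. Sorting the eigenvalues before choosing the frame makes the weights decreasing. -/
lemma exists_bellMix_of_spinFlip_eq {ρ : Mat4} (hρ : ρ.IsHermitian) (hf : spinFlip ρ = ρ) :
    ∃ p : Fin 4 → ℝ, Antitone p ∧ LocallyUnitarilyEquivalent (bellMix p) ρ := by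
  obtain ⟨e, M, hM, hort, hdec⟩ := exists_flipReal_decomposition hρ hf
  set π := Tuple.sort (fun k => -e k) with hπ
  have hanti : Antitone (e ∘ π) := by
    intro i j hij
    have := Tuple.monotone_sort (fun k => -e k) hij
    simpa using this
  obtain ⟨U, hU, V, hV, ε, hε, hUV⟩ := exists_unitary_frame (M := M ∘ π) (fun k => hM _)
    (fun k l => by simp [hort])
  refine ⟨e ∘ π, hanti, LocallyUnitarilyEquivalent.symm ⟨U, hU, V, hV, ?_⟩⟩
  change _ = filterRaw ρ U V
  rw [hdec, filterRaw_sum, bellMix]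
  rw [← Equiv.sum_comp π (fun k => filterRaw (((e k : ℝ) : ℂ) • proj (M k)) U V)]
  refine Finset.sum_congr rfl fun k _ => ?_
  rw [filterRaw_smul, filterRaw_proj, bellProjector_eq]
  have := hUV k
  simp only [Function.comp] at this
  rw [this, proj_smul, hε, one_smul, Function.comp]

lemma IsBellDiagonal.of_bellMix {ρ : Mat4} {p : Fin 4 → ℝ} (hρ : IsState ρ)
    (h : LocallyUnitarilyEquivalent (bellMix p) ρ) :
    (∀ k, 0 ≤ p k) ∧ ∑ k, p k = 1 ∧ IsBellDiagonal ρ := by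
  have h0 : ∀ k, 0 ≤ p k := nonneg_of_posSemidef_bellMix (h.symm.posSemidef hρ.1)
  have h1 : ∑ k, p k = 1 := by
    have := h.trace_eq
    rw [hρ.2, trace_bellMix] at this
    exact_mod_cast this.symm
  exact ⟨h0, h1, p, ⟨h0, h1⟩, h⟩

lemma IsBellDiagonal.isState {ρ : Mat4} (h : IsBellDiagonal ρ) : IsState ρ := by
  obtain ⟨p, hp, hl⟩ := h
  refine LocallyUnitarilyEquivalent.isState hl ⟨posSemidef_bellMix hp.1, ?_⟩
  change (bellMix p).trace = 1
  rw [trace_bellMix, hp.2, Complex.ofReal_one]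

lemma IsBellDiagonal.exists_antitone {ρ : Mat4} (h : IsBellDiagonal ρ) :
    ∃ p : Fin 4 → ℝ, Antitone p ∧ (∀ k, 0 ≤ p k) ∧ ∑ k, p k = 1 ∧
      LocallyUnitarilyEquivalent (bellMix p) ρ := by
  have hs := h.isState
  obtain ⟨p, hp, hl⟩ := h
  have hps : (bellMix p).PosSemidef := posSemidef_bellMix hp.1
  -- The weights are sorted by decomposing the Bell mixture anew, which avoids exhibiting the local
  -- unitaries that permute Bell states.
  obtain ⟨q, hq, hl'⟩ := exists_bellMix_of_spinFlip_eq hps.1 (spinFlip_bellMix p)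
  have hl2 : LocallyUnitarilyEquivalent (bellMix q) ρ := hl'.trans hl
  obtain ⟨h0, h1, _⟩ := IsBellDiagonal.of_bellMix hs hl2
  exact ⟨q, hq, h0, h1, hl2⟩

end CHSHFilter

namespace CHSHFilter

open Matrix

/-! ### States whose trace cannot be lowered by unimodular filters -/

/-- The reduced state of the first qubit. -/
def reduceLeft (ρ : Mat4) : Mat2 := ∑ j, ρ.submatrix (fun i => (i, j)) fun i => (i, j)

/-- The reduced state of the second qubit. -/
def reduceRight (ρ : Mat4) : Mat2 := ∑ i, ρ.submatrix (fun j => (i, j)) fun j => (i, j)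

lemma trace_filterRaw_left (ρ : Mat4) (A : Mat2) :
    (filterRaw ρ A 1).trace = (A * reduceLeft ρ * Aᴴ).trace := by
  rw [filterRaw, Matrix.trace_mul_comm, ← Matrix.mul_assoc, Matrix.conjTranspose_kronecker,
    ← Matrix.mul_kronecker_mul, Matrix.trace_mul_comm (A * reduceLeft ρ), ← Matrix.mul_assoc]
  generalize Aᴴ * A = H
  simp [Matrix.trace, reduceLeft, Matrix.mul_apply, Fintype.sum_prod_type, Fin.sum_univ_two,
    Matrix.kroneckerMap_apply, Matrix.one_apply]
  ring

lemma trace_filterRaw_right (ρ : Mat4) (B : Mat2) :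
    (filterRaw ρ 1 B).trace = (B * reduceRight ρ * Bᴴ).trace := by
  rw [filterRaw, Matrix.trace_mul_comm, ← Matrix.mul_assoc, Matrix.conjTranspose_kronecker,
    ← Matrix.mul_kronecker_mul, Matrix.trace_mul_comm (B * reduceRight ρ), ← Matrix.mul_assoc]
  generalize Bᴴ * B = H
  simp [Matrix.trace, reduceRight, Matrix.mul_apply, Fintype.sum_prod_type, Fin.sum_univ_two,
    Matrix.kroneckerMap_apply, Matrix.one_apply]
  ring

lemma isUnit_of_det_ne_zero {A : Mat2} (h : A.det ≠ 0) : IsUnit A :=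
  (Matrix.isUnit_iff_isUnit_det A).mpr h.isUnit

lemma det_ne_zero_of_isUnit {A : Mat2} (h : IsUnit A) : A.det ≠ 0 :=
  ((Matrix.isUnit_iff_isUnit_det A).mp h).ne_zero

/-- A single test filter suffices: `Aᴴ A = 1 + adj X`, positive definite even for singular `X`. With
`m = det X`, the trace is `1 + 2m` and `|det A|² = 2 + m`, so the hypothesis gives `(4m - 1)(m + 1)
≥ 0` and `m ≥ 1/4`. At trace one this is the maximal determinant, attained only at half the
identity. -/
lemma eq_half_of_forall_norm_det_le {X : Mat2} (hX : X.PosSemidef) (htr : X.trace = 1)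
    (h : ∀ A : Mat2, IsUnit A → ‖A.det‖ ≤ (A * X * Aᴴ).trace.re) : X = (1 / 2 : ℂ) • 1 := by
  have hE : flipMatᴴ = -flipMat := by
    ext i j; fin_cases i <;> fin_cases j <;> simp [flipMat]
  -- Conjugating the transpose by the antisymmetric form gives the adjugate of `X`.
  have hH : (1 + flipMat * Xᵀ * flipMatᴴ).PosDef :=
    Matrix.PosDef.one.add_posSemidef (hX.transpose.mul_mul_conjTranspose_same flipMat)
  obtain ⟨A, hA⟩ := exists_eq_conjTranspose_mul_self hH.posSemidef
  have hXH := hX.1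
  have x10 : X 1 0 = star (X 0 1) := (congrFun (congrFun hXH 1) 0).symm
  have x00 : X 0 0 = ((X 0 0).re : ℂ) :=
    (Complex.conj_eq_iff_re.mp (congrFun (congrFun hXH 0) 0)).symm
  have x11 : X 1 1 = ((X 1 1).re : ℂ) :=
    (Complex.conj_eq_iff_re.mp (congrFun (congrFun hXH 1) 1)).symm
  set a := (X 0 0).re
  set d := (X 1 1).re
  set z := X 0 1 with hz
  have had : a + d = 1 := by
    have : ((a + d : ℝ) : ℂ) = 1 := by
      rw [← htr, Matrix.trace, Fin.sum_univ_two, Matrix.diag_apply, Matrix.diag_apply, x00, x11]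
      push_cast; ring
    exact_mod_cast this
  have hHe : 1 + flipMat * Xᵀ * flipMatᴴ = !![1 + (d : ℂ), -z; -star z, 1 + (a : ℂ)] := by
    rw [hE]
    ext i j
    fin_cases i <;> fin_cases j <;>
      simp [flipMat, Matrix.mul_apply, Fin.sum_univ_two, Matrix.vecMul, dotProduct, x10, x00, x11,
        ← hz]
  have hzz : z * star z = ((‖z‖ ^ 2 : ℝ) : ℂ) := by
    rw [Complex.star_def, Complex.mul_conj, Complex.normSq_eq_norm_sq]
  set m := a * d - ‖z‖ ^ 2 with hm
  have hdet : ‖A.det‖ ^ 2 = 2 + m := by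
    have h1 : (Aᴴ * A).det = ((2 + m : ℝ) : ℂ) := by
      rw [← hA, hHe, Matrix.det_fin_two_of]
      have : ((a + d : ℝ) : ℂ) = 1 := by rw [had]; simp
      push_cast [hm] at this hzz ⊢
      linear_combination -hzz + this
    rw [Matrix.det_mul, Matrix.det_conjTranspose, Complex.star_def,
      ← Complex.normSq_eq_conj_mul_self, Complex.normSq_eq_norm_sq] at h1
    exact_mod_cast h1
  have htrace : (A * X * Aᴴ).trace.re = 1 + 2 * m := by
    have h1 : (A * X * Aᴴ).trace = ((1 + 2 * m : ℝ) : ℂ) := by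
      rw [Matrix.trace_mul_comm, ← Matrix.mul_assoc, ← hA, hHe]
      have : ((a + d : ℝ) : ℂ) = 1 := by rw [had]; simp
      simp [Matrix.trace, Fin.sum_univ_two, Matrix.vecMul, dotProduct, x10, x00, x11, ← hz]
      rw [Complex.star_def] at hzz
      push_cast [hm] at this hzz ⊢
      linear_combination this - 2 * hzz
    rw [h1, Complex.ofReal_re]
  have hdpos : A.det ≠ 0 := by
    have h1 : (Aᴴ * A).det ≠ 0 := by rw [← hA]; exact hH.det_pos.ne'
    rw [Matrix.det_mul] at h1
    exact right_ne_zero_of_mul h1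
  have h1 := h A (isUnit_of_det_ne_zero hdpos)
  rw [htrace] at h1
  have hpos : 0 < ‖A.det‖ := norm_pos_iff.mpr hdpos
  have hm1 : 1 / 4 ≤ m := by
    have h2 : ‖A.det‖ ^ 2 ≤ (1 + 2 * m) ^ 2 := by gcongr
    rw [hdet] at h2
    nlinarith
  have hd : d = 1 - a := by linarith
  have hz0 : ‖z‖ ^ 2 = 0 := by
    rw [hm, hd] at hm1
    nlinarith [sq_nonneg (2 * a - 1), sq_nonneg ‖z‖]
  have ha : a = 1 / 2 := by
    rw [hm, hd, hz0] at hm1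
    nlinarith [sq_nonneg (2 * a - 1)]
  have hz1 : z = 0 := by simpa using hz0
  ext i j
  fin_cases i <;> fin_cases j
  · simp [x00, ha]
  · simp [← hz, hz1]
  · simp [x10, hz1]
  · simp [x11, hd, ha]; norm_num

/-- The spin flip changes the sign of each Pauli matrix on each qubit, so it only affects the terms
`σ_i ⊗ 1` and `1 ⊗ σ_j`; these vanish when both reduced states are maximally mixed. -/
lemma spinFlip_eq_of_reduce {ρ : Mat4} (hl : reduceLeft ρ = (1 / 2 : ℂ) • 1)
    (hr : reduceRight ρ = (1 / 2 : ℂ) • 1) : spinFlip ρ = ρ := by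
  have l := fun i j => congrFun (congrFun hl i) j
  have r := fun i j => congrFun (congrFun hr i) j
  simp only [reduceLeft, reduceRight, Fin.sum_univ_two, Matrix.add_apply, Matrix.submatrix_apply,
    Matrix.smul_apply, Matrix.one_apply, smul_eq_mul] at l r
  have l00 := l 0 0
  have l01 := l 0 1
  have l10 := l 1 0
  have l11 := l 1 1
  have r00 := r 0 0
  have r01 := r 0 1
  have r10 := r 1 0
  have r11 := r 1 1
  simp at l00 l01 l10 l11 r00 r01 r10 r11
  ext ⟨i, j⟩ ⟨k, m⟩
  fin_cases i <;> fin_cases j <;> fin_cases k <;> fin_cases m <;>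
    simp [spinFlip, flipMat4, flipMat, Matrix.mul_apply, Fintype.sum_prod_type, Fin.sum_univ_two,
      Matrix.kroneckerMap_apply] <;> grind

/-- The property of a state that no unimodular filter lowers its trace. -/
def IsTraceMinimal (ρ : Mat4) : Prop :=
  ∀ A B : Mat2, Reversible A B → ‖A.det‖ * ‖B.det‖ ≤ (filterRaw ρ A B).trace.re

lemma IsTraceMinimal.isBellDiagonal {ρ : Mat4} (hρ : IsState ρ) (h : IsTraceMinimal ρ) :
    IsBellDiagonal ρ := by
  have hps : ∀ f : Fin 2 → Fin 2 → Fin 2 × Fin 2,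
      (∑ j, ρ.submatrix (f j) (f j)).PosSemidef := fun f =>
    Matrix.posSemidef_sum _ fun j _ => hρ.1.submatrix _
  have hl : reduceLeft ρ = (1 / 2 : ℂ) • 1 := by
    refine eq_half_of_forall_norm_det_le (hps _) ?_ fun A hA => ?_
    · have := trace_filterRaw_left ρ 1
      rw [filterRaw_one, hρ.2] at this
      simpa using this.symm
    · have := h A 1 ⟨hA, isUnit_one⟩
      rwa [trace_filterRaw_left, Matrix.det_one, norm_one, mul_one] at this
  have hr : reduceRight ρ = (1 / 2 : ℂ) • 1 := by
    refine eq_half_of_forall_norm_det_le (hps _) ?_ fun A hA => ?_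
    · have := trace_filterRaw_right ρ 1
      rw [filterRaw_one, hρ.2] at this
      simpa using this.symm
    · have := h 1 A ⟨isUnit_one, hA⟩
      rwa [trace_filterRaw_right, Matrix.det_one, norm_one, one_mul] at this
  obtain ⟨p, _, hp⟩ := exists_bellMix_of_spinFlip_eq hρ.1.1 (spinFlip_eq_of_reduce hl hr)
  exact (IsBellDiagonal.of_bellMix hρ hp).2.2

end CHSHFilter

namespace CHSHFilter

open Matrix

/-! ### Normal forms of states of full rank -/

/-- Arithmetic-geometric mean inequality for the singular values of `N`, the trace being half the
squared Frobenius norm. -/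
lemma norm_det_le_trace_proj (N : Mat2) : ‖N.det‖ ≤ (proj N).trace.re := by
  rw [trace_proj_re, Matrix.det_fin_two]
  have h := norm_sub_le (N 0 0 * N 1 1) (N 0 1 * N 1 0)
  rw [norm_mul, norm_mul] at h
  nlinarith [sq_nonneg (‖N 0 0‖ - ‖N 1 1‖), sq_nonneg (‖N 0 1‖ - ‖N 1 0‖)]

lemma norm_entry_sq_le (N : Mat2) (i j : Fin 2) : ‖N i j‖ ^ 2 ≤ 2 * (proj N).trace.re := by
  rw [trace_proj_re]
  fin_cases i <;> fin_cases j <;> simp <;> nlinarith [sq_nonneg ‖N 0 0‖, sq_nonneg ‖N 0 1‖,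
    sq_nonneg ‖N 1 0‖, sq_nonneg ‖N 1 1‖]

section Frobenius

attribute [local instance] Matrix.frobeniusNormedRing

/-- Coercivity: writing `σ = Cᴴ C` with `C` invertible, `G` is recovered from `G Cᴴ` by a fixed
matrix and the Frobenius norm is submultiplicative. This compactifies the minimisation over filters.
-/
lemma exists_trace_lower_bound {n : Type*} [Fintype n] [DecidableEq n] {σ : Matrix n n ℂ}
    (hσ : σ.PosDef) :
    ∃ ε : ℝ, 0 < ε ∧ ∀ G : Matrix n n ℂ, ε * (G * Gᴴ).trace.re ≤ (G * σ * Gᴴ).trace.re := by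
  obtain ⟨C, rfl⟩ := exists_eq_conjTranspose_mul_self hσ.posSemidef
  have hC : IsUnit C := by
    have := hσ.isUnit
    exact isUnit_of_mul_isUnit_right this
  have hnorm : ∀ X : Matrix n n ℂ, (X * Xᴴ).trace.re = ‖X‖ ^ 2 := by
    intro X
    rw [Matrix.frobenius_norm_def, ← Real.sqrt_eq_rpow, Real.sq_sqrt (by positivity)]
    simp only [Matrix.trace, Matrix.diag_apply, Matrix.mul_apply, Matrix.conjTranspose_apply,
      Complex.re_sum]
    refine Finset.sum_congr rfl fun i _ => Finset.sum_congr rfl fun j _ => ?_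
    rw [Complex.star_def, Complex.mul_conj, Complex.ofReal_re, Complex.normSq_eq_norm_sq]
    norm_cast
  obtain ⟨D, hD⟩ : ∃ D, D * C = 1 :=
    ⟨C⁻¹, Matrix.nonsing_inv_mul _ ((Matrix.isUnit_iff_isUnit_det C).mp hC)⟩
  refine ⟨1 / (‖Dᴴ‖ ^ 2 + 1), by positivity, fun G => ?_⟩
  have h1 : G * (Cᴴ * C) * Gᴴ = (G * Cᴴ) * (G * Cᴴ)ᴴ := by
    rw [Matrix.conjTranspose_mul, Matrix.conjTranspose_conjTranspose]
    simp only [Matrix.mul_assoc]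
  have h2 : G = (G * Cᴴ) * Dᴴ := by
    rw [Matrix.mul_assoc, ← Matrix.conjTranspose_mul, hD, Matrix.conjTranspose_one, Matrix.mul_one]
  rw [h1, hnorm, hnorm, one_div, inv_mul_le_iff₀ (by positivity)]
  have h3 : ‖G‖ ≤ ‖G * Cᴴ‖ * ‖Dᴴ‖ := by
    nth_rewrite 1 [h2]
    exact norm_mul_le _ _
  have h4 : ‖G‖ ^ 2 ≤ (‖G * Cᴴ‖ * ‖Dᴴ‖) ^ 2 := by gcongr
  nlinarith [sq_nonneg ‖G * Cᴴ‖]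

end Frobenius

lemma isCompact_entrywise_ball (R : ℝ) : IsCompact {A : Mat2 | ∀ i j, ‖A i j‖ ≤ R} := by
  have h : IsCompact (Set.pi Set.univ fun _ : Fin 2 => Set.pi Set.univ fun _ : Fin 2 =>
      Metric.closedBall (0 : ℂ) R) :=
    isCompact_univ_pi fun _ => isCompact_univ_pi fun _ => isCompact_closedBall _ _
  have e : {A : Mat2 | ∀ i j, ‖A i j‖ ≤ R} = Set.pi Set.univ fun _ : Fin 2 =>
      Set.pi Set.univ fun _ : Fin 2 => Metric.closedBall (0 : ℂ) R := by
    refine Set.ext fun A => ⟨fun h i _ j _ => mem_closedBall_zero_iff.mpr (h i j),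
      fun h i j => mem_closedBall_zero_iff.mp (h i trivial j trivial)⟩
  rw [e]
  exact h

lemma continuous_filterRaw :
    Continuous fun x : Mat4 × Mat2 × Mat2 => filterRaw x.1 x.2.1 x.2.2 := by
  have h : Continuous fun x : Mat4 × Mat2 × Mat2 => (x.2.1 ⊗ₖ x.2.2 : Mat4) := by
    refine continuous_matrix fun p q => ?_
    simp only [Matrix.kroneckerMap_apply]
    fun_prop
  unfold filterRaw
  exact (h.matrix_mul continuous_fst).matrix_mul h.matrix_conjTranspose

lemma exists_unimodular_smul {A : Mat2} (hA : A.det ≠ 0) :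
    ∃ (c : ℂ) (A' : Mat2), A'.det = 1 ∧ A = c • A' ∧ ‖c‖ ^ 2 = ‖A.det‖ := by
  obtain ⟨c, hc⟩ := IsAlgClosed.exists_pow_nat_eq A.det (n := 2) (by norm_num)
  have hc0 : c ≠ 0 := by rintro rfl; exact hA (by rw [← hc]; simp)
  refine ⟨c, c⁻¹ • A, ?_, by rw [smul_inv_smul₀ hc0], by rw [← hc, norm_pow]⟩
  rw [Matrix.det_smul, ← hc, Fintype.card_fin, inv_pow, inv_mul_cancel₀ (pow_ne_zero 2 hc0)]

lemma trace_filterRaw_smul_smul_re (ρ : Mat4) (A B : Mat2) (s t : ℂ) :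
    (filterRaw ρ (s • A) (t • B)).trace.re = ‖s‖ ^ 2 * ‖t‖ ^ 2 * (filterRaw ρ A B).trace.re := by
  rw [filterRaw_smul_smul, Matrix.trace_smul, Complex.star_def, Complex.mul_conj, smul_eq_mul,
    Complex.re_ofReal_mul, Complex.normSq_eq_norm_sq, norm_mul, mul_pow]

/-- The filtered trace scales exactly as `|det A| |det B|` when the filters are multiplied by
scalars, so a bound on the unimodular filters extends to all invertible ones. -/
lemma mul_norm_det_le_of_unimodular {ρ : Mat4} {m : ℝ}
    (h : ∀ A B : Mat2, A.det = 1 → B.det = 1 → m ≤ (filterRaw ρ A B).trace.re) {A B : Mat2}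
    (hAB : Reversible A B) : m * (‖A.det‖ * ‖B.det‖) ≤ (filterRaw ρ A B).trace.re := by
  obtain ⟨a, A', hA', hA, ha⟩ := exists_unimodular_smul (det_ne_zero_of_isUnit hAB.1)
  obtain ⟨b, B', hB', hB, hb⟩ := exists_unimodular_smul (det_ne_zero_of_isUnit hAB.2)
  rw [← ha, ← hb, hA, hB, trace_filterRaw_smul_smul_re, mul_comm]
  exact mul_le_mul_of_nonneg_left (h A' B' hA' hB') (by positivity)

lemma isState_filtered {ρ : Mat4} (hρ : ρ.PosSemidef) {A B : Mat2} (h : Admissible ρ A B) :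
    IsState (filtered ρ A B) := by
  have hps := PosSemidef_filterRaw hρ A B
  refine ⟨hps.smul ?_, ?_⟩
  · rw [trace_eq_re_of_posSemidef hps, ← Complex.ofReal_inv]
    exact_mod_cast inv_nonneg.mpr (trace_re_nonneg hps)
  · rw [filtered, Matrix.trace_smul, smul_eq_mul, inv_mul_cancel₀ h]

lemma filtered_eq {ρ : Mat4} (hρ : ρ.PosSemidef) (A B : Mat2) :
    filtered ρ A B = (((filterRaw ρ A B).trace.re⁻¹ : ℝ) : ℂ) • filterRaw ρ A B := by
  rw [filtered, Complex.ofReal_inv, ← trace_eq_re_of_posSemidef (PosSemidef_filterRaw hρ A B)]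

lemma trace_filterRaw_filtered_re {ρ : Mat4} (hρ : ρ.PosSemidef) (A B C D : Mat2) :
    (filterRaw (filtered ρ A B) C D).trace.re =
      (filterRaw ρ A B).trace.re⁻¹ * (filterRaw ρ (C * A) (D * B)).trace.re := by
  rw [filtered_eq hρ, filterRaw_smul, filterRaw_filterRaw, Matrix.trace_smul, smul_eq_mul,
    Complex.re_ofReal_mul]

lemma Reversible.mul {A B C D : Mat2} (h : Reversible A B) (h' : Reversible C D) :
    Reversible (A * C) (B * D) := ⟨h.1.mul h'.1, h.2.mul h'.2⟩

lemma isTraceMinimal_filtered {ρ : Mat4} (hρ : ρ.PosSemidef) {A B : Mat2} (hA : A.det = 1)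
    (hB : B.det = 1) (hpos : 0 < (filterRaw ρ A B).trace.re)
    (h : ∀ C D : Mat2, C.det = 1 → D.det = 1 →
      (filterRaw ρ A B).trace.re ≤ (filterRaw ρ C D).trace.re) :
    IsTraceMinimal (filtered ρ A B) := by
  intro C D hCD
  rw [trace_filterRaw_filtered_re hρ, inv_mul_eq_div, le_div_iff₀ hpos, mul_comm]
  have := mul_norm_det_le_of_unimodular h (hCD.mul ⟨isUnit_of_det_ne_zero (A := A) (by simp [hA]),
    isUnit_of_det_ne_zero (A := B) (by simp [hB])⟩)
  simpa [Matrix.det_mul, hA, hB] using this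

lemma trace_kronecker_mul_conjTranspose_re (A B : Mat2) :
    ((A ⊗ₖ B) * (A ⊗ₖ B)ᴴ).trace.re = 4 * (proj A).trace.re * (proj B).trace.re := by
  rw [Matrix.conjTranspose_kronecker, ← Matrix.mul_kronecker_mul, Matrix.trace_kronecker]
  have h : ∀ X : Mat2, (X * Xᴴ).trace = ((2 * (proj X).trace.re : ℝ) : ℂ) := by
    intro X
    rw [Complex.ofReal_mul, ← trace_eq_re_of_posSemidef (posSemidef_proj X), trace_proj]
    push_cast; ring
  rw [h, h, ← Complex.ofReal_mul, Complex.ofReal_re]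
  ring

lemma exists_filtered_isBellDiagonal {ρ : Mat4} (hρ : ρ.PosDef) :
    ∃ A B : Mat2, Reversible A B ∧ Admissible ρ A B ∧ IsBellDiagonal (filtered ρ A B) := by
  obtain ⟨ε, hε, hlow⟩ := exists_trace_lower_bound hρ
  set Φ : Mat2 × Mat2 → ℝ := fun x => (filterRaw ρ x.1 x.2).trace.re with hΦ
  have hΦc : Continuous Φ := by
    have h := (continuous_filterRaw.comp (continuous_const.prodMk continuous_id :
      Continuous fun x : Mat2 × Mat2 => (ρ, x))).matrix_trace
    exact Complex.continuous_re.comp h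
  have hlow' : ∀ A B : Mat2, ε * (4 * (proj A).trace.re * (proj B).trace.re) ≤ Φ (A, B) := by
    intro A B
    rw [← trace_kronecker_mul_conjTranspose_re]
    exact hlow _
  set K : Set (Mat2 × Mat2) := {x | x.1.det = 1 ∧ x.2.det = 1 ∧ Φ x ≤ Φ (1, 1)} with hK
  have hKclosed : IsClosed K := by
    refine IsClosed.inter ?_ (IsClosed.inter ?_ ?_)
    · exact isClosed_eq continuous_fst.matrix_det continuous_const
    · exact isClosed_eq continuous_snd.matrix_det continuous_const
    · exact isClosed_le hΦc continuous_const
  set r := Φ (1, 1) / (4 * ε) with hr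
  -- Coercivity bounds only the product of the two squared norms. Determinant one keeps each factor
  -- at least `1`, so each is bounded by itself.
  have hbound : ∀ A B : Mat2, B.det = 1 → Φ (A, B) ≤ Φ (1, 1) → (proj A).trace.re ≤ r := by
    intro A B hB h
    have h1 := norm_det_le_trace_proj B
    rw [hB, norm_one] at h1
    have h2 := hlow' A B
    have h3 := trace_re_nonneg (posSemidef_proj A)
    rw [hr, le_div_iff₀ (by positivity)]
    nlinarith [mul_nonneg hε.le (mul_nonneg h3 (sub_nonneg.mpr h1))]
  have hbound' : ∀ A B : Mat2, A.det = 1 → Φ (A, B) ≤ Φ (1, 1) → (proj B).trace.re ≤ r := by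
    intro A B hA h
    have h1 := norm_det_le_trace_proj A
    rw [hA, norm_one] at h1
    have h2 := hlow' A B
    have h3 := trace_re_nonneg (posSemidef_proj B)
    rw [hr, le_div_iff₀ (by positivity)]
    nlinarith [mul_nonneg hε.le (mul_nonneg h3 (sub_nonneg.mpr h1))]
  have hentry : ∀ A : Mat2, (proj A).trace.re ≤ r → ∀ i j, ‖A i j‖ ≤ Real.sqrt (2 * r) := by
    intro A hA i j
    refine Real.le_sqrt_of_sq_le ((norm_entry_sq_le A i j).trans ?_)
    linarith
  have hKcompact : IsCompact K := by
    refine IsCompact.of_isClosed_subset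
      ((isCompact_entrywise_ball (Real.sqrt (2 * r))).prod
        (isCompact_entrywise_ball (Real.sqrt (2 * r)))) hKclosed ?_
    rintro ⟨A, B⟩ ⟨hA, hB, h⟩
    exact ⟨hentry A (hbound A B hB h), hentry B (hbound' A B hA h)⟩
  have hK1 : ((1, 1) : Mat2 × Mat2) ∈ K := ⟨Matrix.det_one, Matrix.det_one, le_rfl⟩
  obtain ⟨⟨A, B⟩, ⟨hA, hB, hAB⟩, hmin⟩ := hKcompact.exists_isMinOn ⟨_, hK1⟩ hΦc.continuousOn
  have hglob : ∀ C D : Mat2, C.det = 1 → D.det = 1 → Φ (A, B) ≤ Φ (C, D) := by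
    intro C D hC hD
    by_contra! hlt
    exact absurd (hmin (show (C, D) ∈ K from ⟨hC, hD, hlt.le.trans hAB⟩)) (not_le.mpr hlt)
  have hpos : 0 < (filterRaw ρ A B).trace.re := by
    have h1 := norm_det_le_trace_proj A
    have h2 := norm_det_le_trace_proj B
    rw [hA, norm_one] at h1
    rw [hB, norm_one] at h2
    refine lt_of_lt_of_le ?_ (hlow' A B)
    have : 0 < (proj A).trace.re := by linarith
    have : 0 < (proj B).trace.re := by linarith
    positivity
  have hadm : Admissible ρ A B := fun h0 => by rw [h0] at hpos; simp at hpos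
  exact ⟨A, B, ⟨isUnit_of_det_ne_zero (by simp [hA]), isUnit_of_det_ne_zero (by simp [hB])⟩, hadm,
    (isTraceMinimal_filtered hρ.posSemidef hA hB hpos hglob).isBellDiagonal
      (isState_filtered hρ.posSemidef hadm)⟩

end CHSHFilter

namespace CHSHFilter

open Matrix

/-! ### The trace inequality for filtered Bell mixtures -/

/-- Half the quadratic form of `1 - σ_z ⊗ σ_z`. -/
def zzForm (N : Mat2) : ℝ := ‖N 0 1‖ ^ 2 + ‖N 1 0‖ ^ 2

/-- Half the quadratic form of `1 - σ_z ⊗ σ_z - σ_x ⊗ σ_x`. -/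
def zxForm (N : Mat2) : ℝ := zzForm N - (star (N 0 0) * N 1 1 + star (N 0 1) * N 1 0).re

lemma zzForm_nonneg (N : Mat2) : 0 ≤ zzForm N := by unfold zzForm; positivity

/-- The correlation `σ_z ⊗ σ_z + σ_x ⊗ σ_x` is at most `1` on product vectors, and the determinant
measures the distance from a product vector. -/
lemma neg_norm_det_le_zxForm (N : Mat2) : -‖N.det‖ ≤ zxForm N := by
  have h1 : (star (N 0 0) * N 1 1).re ≤ ‖N 0 0 * N 1 1‖ := by
    refine (Complex.re_le_norm _).trans ?_
    rw [norm_mul, norm_mul, norm_star]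
  have h2 : (star (N 0 1) * N 1 0).re ≤ ‖N 0 1‖ * ‖N 1 0‖ := by
    refine (Complex.re_le_norm _).trans ?_
    rw [norm_mul, norm_star]
  have h3 : ‖N 0 0 * N 1 1‖ ≤ ‖N.det‖ + ‖N 0 1‖ * ‖N 1 0‖ := by
    rw [Matrix.det_fin_two, ← norm_mul (N 0 1)]
    have := norm_add_le (N 0 0 * N 1 1 - N 0 1 * N 1 0) (N 0 1 * N 1 0)
    rwa [sub_add_cancel] at this
  rw [zxForm, zzForm, Complex.add_re]
  nlinarith [sq_nonneg (‖N 0 1‖ - ‖N 1 0‖)]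

/-- The matrix of a product vector. -/
def outer (x y : Fin 2 → ℂ) : Mat2 := Matrix.vecMulVec x y

lemma det_outer (x y : Fin 2 → ℂ) : (outer x y).det = 0 := by
  rw [outer, Matrix.det_fin_two]
  simp only [Matrix.vecMulVec_apply]
  ring

lemma zxForm_outer_nonneg (x y : Fin 2 → ℂ) : 0 ≤ zxForm (outer x y) := by
  have := neg_norm_det_le_zxForm (outer x y)
  rwa [det_outer, norm_zero, neg_zero] at this

lemma zzForm_add_sub (X Y : Mat2) :
    zzForm (X + Y) + zzForm (X - Y) = 2 * (zzForm X + zzForm Y) := by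
  simp only [zzForm, Complex.sq_norm, Complex.normSq_apply, Matrix.add_apply, Matrix.sub_apply,
    Complex.add_re, Complex.add_im, Complex.sub_re, Complex.sub_im]
  ring

lemma zxForm_add_sub (X Y : Mat2) :
    zxForm (X + Y) + zxForm (X - Y) = 2 * (zxForm X + zxForm Y) := by
  have h := zzForm_add_sub X Y
  simp only [zxForm, Complex.star_def, Matrix.add_apply, Matrix.sub_apply, map_add, map_sub,
    Complex.add_re, Complex.sub_re, Complex.mul_re, Complex.sub_im, Complex.add_im, Complex.conj_re,
    Complex.conj_im]
  linear_combination h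

section

variable (A B : Mat2)

lemma mul_bellMat_zero : A * bellMat 0 * Bᵀ =
    outer (fun i => A i 0) (fun i => B i 0) + outer (fun i => A i 1) (fun i => B i 1) := by
  ext i j
  simp [bellMat, outer, Matrix.mul_apply, Fin.sum_univ_two, Matrix.vecMulVec_apply]

lemma mul_bellMat_one : A * bellMat 1 * Bᵀ =
    outer (fun i => A i 0) (fun i => B i 0) - outer (fun i => A i 1) (fun i => B i 1) := by
  ext i j
  simp [bellMat, outer, Matrix.mul_apply, Fin.sum_univ_two, Matrix.vecMulVec_apply]
  ring

lemma mul_bellMat_two : A * bellMat 2 * Bᵀ =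
    outer (fun i => A i 0) (fun i => B i 1) + outer (fun i => A i 1) (fun i => B i 0) := by
  ext i j
  simp [bellMat, outer, Matrix.mul_apply, Fin.sum_univ_two, Matrix.vecMulVec_apply]
  ring

lemma mul_bellMat_three : A * bellMat 3 * Bᵀ =
    outer (fun i => A i 0) (fun i => B i 1) - outer (fun i => A i 1) (fun i => B i 0) := by
  ext i j
  simp [bellMat, outer, Matrix.mul_apply, Fin.sum_univ_two, Matrix.vecMulVec_apply]
  ring

lemma norm_det_mul_bellMat (k : Fin 4) : ‖(A * bellMat k * Bᵀ).det‖ = ‖A.det‖ * ‖B.det‖ := by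
  have h : ‖(bellMat k).det‖ = 1 := by
    fin_cases k <;> simp [bellMat, Matrix.det_fin_two]
  rw [Matrix.det_mul, Matrix.det_mul, Matrix.det_transpose, norm_mul, norm_mul, h, mul_one]

/-- Three symmetric Bell projectors minus the antisymmetric one make the swap, whose partial
transpose is twice the projector on `Φ⁺`. Since `σ_z` and `σ_x` are symmetric, partial transposition
leaves the observable alone and merely conjugates `B`. -/
lemma zzForm_partialTranspose :
    zzForm (A * bellMat 0 * Bᵀ) + zzForm (A * bellMat 1 * Bᵀ) + zzForm (A * bellMat 2 * Bᵀ) -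
      zzForm (A * bellMat 3 * Bᵀ) = 2 * zzForm (A * Bᴴ) := by
  rw [mul_bellMat_zero, mul_bellMat_one, mul_bellMat_two, mul_bellMat_three]
  simp only [zzForm, outer, Complex.sq_norm, Complex.normSq_apply, Matrix.add_apply,
    Matrix.sub_apply, Matrix.vecMulVec_apply, Matrix.mul_apply, Fin.sum_univ_two,
    Matrix.conjTranspose_apply, Complex.star_def, Complex.add_re, Complex.add_im, Complex.sub_re,
    Complex.sub_im, Complex.mul_re, Complex.mul_im, Complex.conj_re, Complex.conj_im]
  ring

lemma zxForm_partialTranspose :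
    zxForm (A * bellMat 0 * Bᵀ) + zxForm (A * bellMat 1 * Bᵀ) + zxForm (A * bellMat 2 * Bᵀ) -
      zxForm (A * bellMat 3 * Bᵀ) = 2 * zxForm (A * Bᴴ) := by
  have h := zzForm_partialTranspose A B
  simp only [zxForm]
  rw [mul_bellMat_zero, mul_bellMat_one, mul_bellMat_two, mul_bellMat_three] at h ⊢
  generalize zzForm _ = z1 at h ⊢
  generalize zzForm _ = z2 at h ⊢
  generalize zzForm _ = z3 at h ⊢
  generalize zzForm _ = z4 at h ⊢
  generalize zzForm _ = z5 at h ⊢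
  simp only [outer, Matrix.add_apply,
    Matrix.sub_apply, Matrix.vecMulVec_apply, Matrix.mul_apply, Fin.sum_univ_two,
    Matrix.conjTranspose_apply, Complex.star_def, Complex.add_re, Complex.add_im, Complex.sub_re,
    Complex.sub_im, Complex.mul_re, Complex.mul_im, Complex.conj_re, Complex.conj_im]
  linear_combination h

/-- The squared norm of row `i`. -/
def rowSq (i : Fin 2) : ℝ := ‖A i 0‖ ^ 2 + ‖A i 1‖ ^ 2

/-- The inner product of the two rows. -/
def rowInner : ℂ := A 0 0 * star (A 1 0) + A 0 1 * star (A 1 1)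

lemma rowSq_nonneg (i : Fin 2) : 0 ≤ rowSq A i := by unfold rowSq; positivity

lemma rowSq_mul_rowSq : rowSq A 0 * rowSq A 1 = ‖A.det‖ ^ 2 + ‖rowInner A‖ ^ 2 := by
  simp only [rowSq, rowInner, Matrix.det_fin_two, Complex.sq_norm, Complex.normSq_apply,
    Complex.star_def, Complex.add_re, Complex.add_im, Complex.sub_re, Complex.sub_im,
    Complex.mul_re, Complex.mul_im, Complex.conj_re, Complex.conj_im]
  ring

/-- The arithmetic-geometric mean reduces the right side to the product of all four row norms;
`rowSq_mul_rowSq` and Cauchy-Schwarz in the plane then bound it below. -/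
lemma le_rowSq_mul_add : 2 * (‖A.det‖ * ‖B.det‖ + ‖rowInner A‖ * ‖rowInner B‖) ≤
    rowSq A 0 * rowSq B 1 + rowSq A 1 * rowSq B 0 := by
  have h1 := rowSq_mul_rowSq A
  have h2 := rowSq_mul_rowSq B
  have a0 := rowSq_nonneg A 0
  have a1 := rowSq_nonneg A 1
  have b0 := rowSq_nonneg B 0
  have b1 := rowSq_nonneg B 1
  refine le_of_sq_le_sq ?_ (by positivity)
  have e : (rowSq A 0 * rowSq B 1 + rowSq A 1 * rowSq B 0) ^ 2 =
      4 * ((rowSq A 0 * rowSq A 1) * (rowSq B 0 * rowSq B 1)) +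
      (rowSq A 0 * rowSq B 1 - rowSq A 1 * rowSq B 0) ^ 2 := by ring
  rw [e, h1, h2]
  nlinarith [sq_nonneg (‖A.det‖ * ‖rowInner B‖ - ‖B.det‖ * ‖rowInner A‖),
    sq_nonneg (rowSq A 0 * rowSq B 1 - rowSq A 1 * rowSq B 0)]

/-- The four Bell projectors add up to the identity, so the sum depends only on `A Aᴴ` and `B Bᴴ`.
-/
lemma sum_zzForm : zzForm (A * bellMat 0 * Bᵀ) + zzForm (A * bellMat 1 * Bᵀ) +
    zzForm (A * bellMat 2 * Bᵀ) + zzForm (A * bellMat 3 * Bᵀ) =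
    2 * (rowSq A 0 * rowSq B 1 + rowSq A 1 * rowSq B 0) := by
  rw [mul_bellMat_zero, mul_bellMat_one, mul_bellMat_two, mul_bellMat_three, zzForm_add_sub,
    add_assoc, zzForm_add_sub]
  simp only [zzForm, outer, Matrix.vecMulVec_apply, norm_mul, rowSq]
  ring

lemma sum_zxForm : zxForm (A * bellMat 0 * Bᵀ) + zxForm (A * bellMat 1 * Bᵀ) +
    zxForm (A * bellMat 2 * Bᵀ) + zxForm (A * bellMat 3 * Bᵀ) =
    2 * (rowSq A 0 * rowSq B 1 + rowSq A 1 * rowSq B 0) -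
      4 * ((rowInner A).re * (rowInner B).re) := by
  rw [mul_bellMat_zero, mul_bellMat_one, mul_bellMat_two, mul_bellMat_three, zxForm_add_sub,
    add_assoc, zxForm_add_sub]
  simp only [zxForm, zzForm, outer, Matrix.vecMulVec_apply, norm_mul, rowSq, rowInner,
    Complex.star_def, Complex.add_re, Complex.mul_re, Complex.mul_im, Complex.conj_re,
    Complex.conj_im, map_mul]
  ring

lemma four_mul_le_sum_zzForm : 4 * (‖A.det‖ * ‖B.det‖) ≤
    zzForm (A * bellMat 0 * Bᵀ) + zzForm (A * bellMat 1 * Bᵀ) +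
    zzForm (A * bellMat 2 * Bᵀ) + zzForm (A * bellMat 3 * Bᵀ) := by
  rw [sum_zzForm]
  have h := le_rowSq_mul_add A B
  have : 0 ≤ ‖rowInner A‖ * ‖rowInner B‖ := by positivity
  linarith

lemma four_mul_le_sum_zxForm : 4 * (‖A.det‖ * ‖B.det‖) ≤
    zxForm (A * bellMat 0 * Bᵀ) + zxForm (A * bellMat 1 * Bᵀ) +
    zxForm (A * bellMat 2 * Bᵀ) + zxForm (A * bellMat 3 * Bᵀ) := by
  rw [sum_zxForm]
  have h := le_rowSq_mul_add A B
  have : (rowInner A).re * (rowInner B).re ≤ ‖rowInner A‖ * ‖rowInner B‖ := by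
    refine (le_abs_self _).trans ?_
    rw [abs_mul]
    exact mul_le_mul (Complex.abs_re_le_norm _) (Complex.abs_re_le_norm _) (abs_nonneg _)
      (norm_nonneg _)
  linarith

end

/-- Abel summation for decreasing weights, adapted to the available bounds: the weighted sum is
`(μ₀-μ₁) w₀ + (μ₁-μ₂)(w₀+w₁) + ½(μ₂-μ₃)(w₀+w₁+w₂-w₃) + ½(μ₂+μ₃)(w₀+w₁+w₂+w₃)`, with nonnegative
coefficients. The slack `κ` is `0` for `zzForm` and `1` for `zxForm`. -/
lemma weighted_sum_ge {mu w : Fin 4 → ℝ} {δ κ : ℝ} (hmu : Antitone mu) (hmu0 : ∀ k, 0 ≤ mu k)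
    (h0 : -(κ * δ) ≤ w 0) (h1 : 0 ≤ w 0 + w 1) (h3 : -(2 * (κ * δ)) ≤ w 0 + w 1 + w 2 - w 3)
    (h4 : 4 * δ ≤ w 0 + w 1 + w 2 + w 3) :
    (2 * (mu 2 + mu 3) - κ * (mu 2 - mu 3) - κ * (mu 0 - mu 1)) * δ ≤
      mu 0 * w 0 + mu 1 * w 1 + mu 2 * w 2 + mu 3 * w 3 := by
  have c2 : 0 ≤ mu 0 - mu 1 := sub_nonneg.mpr (hmu (by decide))
  have c1 : 0 ≤ mu 1 - mu 2 := sub_nonneg.mpr (hmu (by decide))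
  have c3 : 0 ≤ mu 2 - mu 3 := sub_nonneg.mpr (hmu (by decide))
  have c0 : 0 ≤ mu 2 + mu 3 := add_nonneg (hmu0 _) (hmu0 _)
  have e0 := mul_nonneg c0 (sub_nonneg.mpr h4)
  have e1 := mul_nonneg c1 h1
  have e2 := mul_nonneg c2 (sub_nonneg.mpr h0)
  have e3 := mul_nonneg c3 (sub_nonneg.mpr h3)
  linarith

/-- The operator `s₁ σ_z ⊗ σ_z + s₂ σ_x ⊗ σ_x`. -/
def standardBell (s₁ s₂ : ℝ) : Mat4 :=
  (s₁ : ℂ) • (pauli 2 ⊗ₖ pauli 2) + (s₂ : ℂ) • (pauli 0 ⊗ₖ pauli 0)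

lemma trace_proj_mul_standardBell (N : Mat2) (s₁ s₂ : ℝ) :
    (proj N * standardBell s₁ s₂).trace.re =
      s₁ * (proj N).trace.re - (s₁ - s₂) * zzForm N - s₂ * zxForm N := by
  rw [trace_proj_re]
  simp [standardBell, zzForm, zxForm, proj, pauli, Matrix.trace, Matrix.mul_apply,
    Fintype.sum_prod_type, Fin.sum_univ_two, Matrix.kroneckerMap_apply, Complex.sq_norm,
    Complex.normSq_apply]
  ring

lemma trace_filterRaw_bellMix_mul_re (mu : Fin 4 → ℝ) (A B : Mat2) (X : Mat4) :
    (filterRaw (bellMix mu) A B * X).trace.re =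
      ∑ k, mu k * (proj (A * bellMat k * Bᵀ) * X).trace.re := by
  rw [filterRaw_bellMix, Matrix.sum_mul, Matrix.trace_sum, Complex.re_sum]
  refine Finset.sum_congr rfl fun k _ => ?_
  rw [Matrix.smul_mul, Matrix.trace_smul, smul_eq_mul, Complex.re_ofReal_mul]

/-- The Bell operator equals `s₁ - (s₁ - s₂)(1 - σ_z ⊗ σ_z) - s₂ (1 - σ_z ⊗ σ_z - σ_x ⊗ σ_x)` with
nonnegative coefficients, so lower bounds for the two forms give an upper bound for the expectation.
-/
lemma bellMix_filter_inequality (A B : Mat2) {mu : Fin 4 → ℝ} (hmu : Antitone mu)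
    (hmu0 : ∀ k, 0 ≤ mu k) {s₁ s₂ : ℝ} (hs₂ : 0 ≤ s₂) (hs : s₂ ≤ s₁) :
    (filterRaw (bellMix mu) A B * standardBell s₁ s₂).trace.re ≤
      s₁ * ((filterRaw (bellMix mu) A B).trace.re - ‖A.det‖ * ‖B.det‖ * ∑ k, mu k) +
      ‖A.det‖ * ‖B.det‖ * (s₁ * (mu 0 + mu 1 - mu 2 - mu 3) +
        s₂ * (mu 0 + mu 2 - mu 1 - mu 3)) := by
  set δ := ‖A.det‖ * ‖B.det‖ with hδ
  have ht1 := trace_filterRaw_bellMix_mul_re mu A B 1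
  rw [Matrix.mul_one] at ht1
  simp only [Matrix.mul_one] at ht1
  rw [trace_filterRaw_bellMix_mul_re, ht1]
  simp only [trace_proj_mul_standardBell, Fin.sum_univ_four]
  have hzx := fun k => neg_norm_det_le_zxForm (A * bellMat k * Bᵀ)
  simp only [norm_det_mul_bellMat, ← hδ] at hzx
  have hdetH : ‖(A * Bᴴ).det‖ = δ := by
    rw [Matrix.det_mul, Matrix.det_conjTranspose, norm_mul, norm_star]
  have hz := weighted_sum_ge (w := fun k => zzForm (A * bellMat k * Bᵀ)) (δ := δ) (κ := 0) hmu hmu0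
    (by simpa using zzForm_nonneg _) (add_nonneg (zzForm_nonneg _) (zzForm_nonneg _))
    (by
      simp only [zzForm_partialTranspose, zero_mul, mul_zero, neg_zero]
      linarith [zzForm_nonneg (A * Bᴴ)]) (four_mul_le_sum_zzForm A B)
  have hx := weighted_sum_ge (w := fun k => zxForm (A * bellMat k * Bᵀ)) (δ := δ) (κ := 1) hmu hmu0
    (by simpa using hzx 0)
    (by
      -- The images of `Φ⁺` and `Φ⁻` are the sum and difference of two product vectors, on which
      -- `zxForm` is nonnegative.
      simp only [mul_bellMat_zero, mul_bellMat_one, zxForm_add_sub]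
      have := zxForm_outer_nonneg (fun i => A i 0) (fun i => B i 0)
      have := zxForm_outer_nonneg (fun i => A i 1) (fun i => B i 1)
      linarith)
    (by
      simp only [zxForm_partialTranspose]
      have := neg_norm_det_le_zxForm (A * Bᴴ)
      rw [hdetH] at this
      linarith) (four_mul_le_sum_zxForm A B)
  have h1 := mul_le_mul_of_nonneg_left hz (sub_nonneg.mpr hs)
  have h2 := mul_le_mul_of_nonneg_left hx hs₂
  linarith

lemma norm_det_mul_sum_le_trace (A B : Mat2) {mu : Fin 4 → ℝ} (hmu0 : ∀ k, 0 ≤ mu k) :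
    ‖A.det‖ * ‖B.det‖ * ∑ k, mu k ≤ (filterRaw (bellMix mu) A B).trace.re := by
  rw [filterRaw_bellMix, Matrix.trace_sum, Complex.re_sum, Finset.mul_sum]
  refine Finset.sum_le_sum fun k _ => ?_
  rw [Matrix.trace_smul, smul_eq_mul, Complex.re_ofReal_mul, mul_comm, ← norm_det_mul_bellMat A B k]
  exact mul_le_mul_of_nonneg_left (norm_det_le_trace_proj _) (hmu0 k)

end CHSHFilter

namespace CHSHFilter

open Matrix

/-! ### Bell operators in standard position -/

/-- The spin observable in the direction `x`. -/
def spin (x : EuclideanSpace ℝ (Fin 3)) : Mat2 := ∑ i, ((x i : ℝ) : ℂ) • pauli i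

lemma spin_eq (x : EuclideanSpace ℝ (Fin 3)) :
    spin x = !![(x 2 : ℂ), x 0 - x 1 * Complex.I; x 0 + x 1 * Complex.I, -(x 2 : ℂ)] := by
  ext i j
  fin_cases i <;> fin_cases j <;> simp [spin, pauli, Fin.sum_univ_three, Matrix.add_apply]
  ring

lemma spin_add (x y : EuclideanSpace ℝ (Fin 3)) : spin (x + y) = spin x + spin y := by
  simp only [spin, ← Finset.sum_add_distrib, PiLp.add_apply, Complex.ofReal_add, add_smul]

lemma spin_smul (r : ℝ) (x : EuclideanSpace ℝ (Fin 3)) : spin (r • x) = (r : ℂ) • spin x := by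
  simp only [spin, Finset.smul_sum, PiLp.smul_apply, smul_eq_mul, Complex.ofReal_mul, mul_smul]

lemma spin_sub (x y : EuclideanSpace ℝ (Fin 3)) : spin (x - y) = spin x - spin y := by
  rw [sub_eq_add_neg, spin_add, ← neg_one_smul ℝ y, spin_smul]
  simp [sub_eq_add_neg]

lemma isHermitian_spin (x : EuclideanSpace ℝ (Fin 3)) : (spin x).IsHermitian := by
  rw [spin_eq]
  ext i j
  fin_cases i <;> fin_cases j <;> simp
  ring

lemma inner_fin_three (x y : EuclideanSpace ℝ (Fin 3)) :
    inner ℝ x y = x 0 * y 0 + x 1 * y 1 + x 2 * y 2 := by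
  simp [PiLp.inner_apply, Fin.sum_univ_three]
  ring

/-- The Clifford relation: orthogonal directions give anticommuting observables, unit directions
give involutions. -/
lemma spin_mul_add_mul (x y : EuclideanSpace ℝ (Fin 3)) :
    spin x * spin y + spin y * spin x = ((2 * inner ℝ x y : ℝ) : ℂ) • 1 := by
  rw [spin_eq, spin_eq, inner_fin_three]
  ext i j
  fin_cases i <;> fin_cases j <;> simp <;> ring_nf <;> simp only [Complex.I_sq] <;> ring

lemma spin_mul_self (x : EuclideanSpace ℝ (Fin 3)) :
    spin x * spin x = ((‖x‖ ^ 2 : ℝ) : ℂ) • 1 := by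
  have h := spin_mul_add_mul x x
  rw [← two_smul ℂ, real_inner_self_eq_norm_sq, Complex.ofReal_mul, mul_smul] at h
  exact smul_right_injective _ (two_ne_zero (α := ℂ)) (by simpa using h)

lemma exists_unitary_conj_spin {x y : EuclideanSpace ℝ (Fin 3)} (hx : ‖x‖ = 1) (hy : ‖y‖ = 1)
    (hxy : inner ℝ x y = 0) :
    ∃ U ∈ Matrix.unitaryGroup (Fin 2) ℂ, spin x = Uᴴ * pauli 2 * U ∧ spin y = Uᴴ * pauli 0 * U := by
  obtain ⟨U, hU, h1, h2⟩ := exists_unitary_conj_pauli (isHermitian_spin x) (isHermitian_spin y)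
    (by rw [spin_mul_self, hx]; simp) (by rw [spin_mul_self, hy]; simp)
    (eq_neg_of_add_eq_zero_left (by rw [spin_mul_add_mul, hxy]; simp))
  have hUU : Uᴴ * U = 1 := Matrix.mem_unitaryGroup_iff'.mp hU
  have key : ∀ X : Mat2, Uᴴ * (U * X * Uᴴ) * U = X := by
    intro X
    calc Uᴴ * (U * X * Uᴴ) * U = (Uᴴ * U) * X * (Uᴴ * U) := by noncomm_ring
      _ = X := by rw [hUU, Matrix.one_mul, Matrix.mul_one]
  exact ⟨U, hU, by rw [← h1, key], by rw [← h2, key]⟩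

lemma bellOperator_eq (a b c d : EuclideanSpace ℝ (Fin 3)) : bellOperator a b c d =
    spin a ⊗ₖ spin ((1 / 2 : ℝ) • (c + d)) + spin b ⊗ₖ spin ((1 / 2 : ℝ) • (c - d)) := by
  rw [spin_smul, spin_smul]
  ext p q
  simp only [bellOperator, spin, Matrix.smul_apply, Matrix.kroneckerMap_apply,
    Matrix.add_apply, smul_eq_mul, Fin.sum_univ_three, PiLp.add_apply, PiLp.sub_apply]
  push_cast
  ring

lemma exists_unit_orthogonal (v : EuclideanSpace ℝ (Fin 3)) :
    ∃ e : EuclideanSpace ℝ (Fin 3), ‖e‖ = 1 ∧ inner ℝ e v = 0 := by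
  have hne : (Submodule.span ℝ {v})ᗮ ≠ ⊥ := by
    intro h
    rw [Submodule.orthogonal_eq_bot_iff] at h
    have h1 := finrank_span_le_card (R := ℝ) ({v} : Set (EuclideanSpace ℝ (Fin 3)))
    rw [h, finrank_top, finrank_euclideanSpace_fin, Set.toFinset_singleton,
      Finset.card_singleton] at h1
    omega
  obtain ⟨x, hx, hx0⟩ := Submodule.exists_mem_ne_zero_of_ne_bot hne
  have hxv : inner ℝ x v = 0 := by
    rw [real_inner_comm]
    exact (Submodule.mem_orthogonal_singleton_iff_inner_right).mp hx
  refine ⟨(‖x‖)⁻¹ • x, ?_, ?_⟩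
  · rw [norm_smul, norm_inv, norm_norm, inv_mul_cancel₀ (norm_ne_zero_iff.mpr hx0)]
  · rw [inner_smul_left, hxv, mul_zero]

lemma exists_direction {u v : EuclideanSpace ℝ (Fin 3)} (h : inner ℝ u v = 0) :
    ∃ e : EuclideanSpace ℝ (Fin 3), ‖e‖ = 1 ∧ u = ‖u‖ • e ∧ inner ℝ e v = 0 := by
  by_cases hu : u = 0
  · obtain ⟨e, he, hev⟩ := exists_unit_orthogonal v
    exact ⟨e, he, by simp [hu], hev⟩
  · have hu' := norm_ne_zero_iff.mpr hu
    refine ⟨(‖u‖)⁻¹ • u, ?_, ?_, ?_⟩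
    · rw [norm_smul, norm_inv, norm_norm, inv_mul_cancel₀ hu']
    · rw [smul_inv_smul₀ hu']
    · rw [inner_smul_left, h, mul_zero]

lemma exists_orthonormal_pair {u v : EuclideanSpace ℝ (Fin 3)} (h : inner ℝ u v = 0) :
    ∃ e f : EuclideanSpace ℝ (Fin 3), ‖e‖ = 1 ∧ ‖f‖ = 1 ∧ inner ℝ e f = 0 ∧ u = ‖u‖ • e ∧
      v = ‖v‖ • f := by
  obtain ⟨e, he, hu, hev⟩ := exists_direction h
  obtain ⟨f, hf, hv, hfe⟩ := exists_direction (u := v) (v := e) (by rw [real_inner_comm]; exact hev)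
  exact ⟨e, f, he, hf, by rw [real_inner_comm]; exact hfe, hu, hv⟩

lemma exists_angle (x y : ℝ) : ∃ θ : ℝ, Real.cos (2 * θ) * y = Real.sin (2 * θ) * x := by
  by_cases hz : (⟨x, y⟩ : ℂ) = 0
  · have hx : x = 0 := congrArg Complex.re hz
    have hy : y = 0 := congrArg Complex.im hz
    exact ⟨0, by simp [hx, hy]⟩
  · refine ⟨Complex.arg ⟨x, y⟩ / 2, ?_⟩
    rw [mul_div_cancel₀ _ (two_ne_zero), Complex.cos_arg hz, Complex.sin_arg]
    ring

/-- The vectors `c + d` and `c - d` are orthogonal, and the correlation tensor of the Bell operator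
has rank at most two. Its singular value decomposition gives orthogonal directions on both sides,
which unitaries turn into `z` and `x`; `s₁, s₂` are the singular values. -/
lemma exists_standardBell (a b c d : EuclideanSpace ℝ (Fin 3)) (ha : ‖a‖ = 1) (hb : ‖b‖ = 1)
    (hc : ‖c‖ = 1) (hd : ‖d‖ = 1) :
    ∃ s₁ s₂ : ℝ, 0 ≤ s₂ ∧ s₂ ≤ s₁ ∧ s₁ ^ 2 + s₂ ^ 2 = 1 ∧
      ∃ U ∈ Matrix.unitaryGroup (Fin 2) ℂ, ∃ V ∈ Matrix.unitaryGroup (Fin 2) ℂ,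
        ∀ σ : Mat4, (σ * bellOperator a b c d).trace =
          (filterRaw σ U V * standardBell s₁ s₂).trace := by
  set u := (1 / 2 : ℝ) • (c + d) with hu
  set v := (1 / 2 : ℝ) • (c - d) with hv
  have huv : inner ℝ u v = 0 := by
    rw [hu, hv, inner_smul_left, inner_smul_right, inner_add_left, inner_sub_right,
      inner_sub_right, real_inner_self_eq_norm_sq, real_inner_self_eq_norm_sq, hc, hd,
      real_inner_comm d c]
    simp
  have hnorm : ‖u‖ ^ 2 + ‖v‖ ^ 2 = 1 := by
    rw [hu, hv, norm_smul, norm_smul, mul_pow, mul_pow]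
    have := parallelogram_law_with_norm ℝ c d
    rw [hc, hd] at this
    norm_num
    nlinarith
  obtain ⟨e, f, he, hf, hef, hue, hvf⟩ := exists_orthonormal_pair huv
  set x := ‖u‖ • a with hx
  set y := ‖v‖ • b with hy
  have hxn : ‖x‖ ^ 2 = ‖u‖ ^ 2 := by rw [hx, norm_smul, norm_norm, ha, mul_one]
  have hyn : ‖y‖ ^ 2 = ‖v‖ ^ 2 := by rw [hy, norm_smul, norm_norm, hb, mul_one]
  have hop : bellOperator a b c d = spin x ⊗ₖ spin e + spin y ⊗ₖ spin f := by
    rw [bellOperator_eq, ← hu, ← hv, hue, hvf, hx, hy]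
    simp only [spin_smul, Matrix.smul_kronecker, Matrix.kronecker_smul]
  -- Rotating the pairs `(x, y)` and `(e, f)` by the same angle leaves `x ⊗ e + y ⊗ f` unchanged.
  -- This angle makes the rotated `x` and `y` orthogonal.
  obtain ⟨θ, hθ⟩ := exists_angle (‖x‖ ^ 2 - ‖y‖ ^ 2) (2 * inner ℝ x y)
  rw [Real.cos_two_mul', Real.sin_two_mul] at hθ
  have hcs := Real.sin_sq_add_cos_sq θ
  set C := Real.cos θ
  set S := Real.sin θ
  have hxy' : inner ℝ (C • x + S • y) (C • y - S • x) = 0 := by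
    simp only [inner_add_left, inner_sub_right, inner_smul_left, inner_smul_right,
      real_inner_self_eq_norm_sq, real_inner_comm x y, conj_trivial]
    linear_combination hθ / 2
  have hnn : ∀ p q : EuclideanSpace ℝ (Fin 3),
      ‖C • p + S • q‖ ^ 2 = C ^ 2 * ‖p‖ ^ 2 + S ^ 2 * ‖q‖ ^ 2 + 2 * C * S * inner ℝ p q ∧
      ‖C • q - S • p‖ ^ 2 = C ^ 2 * ‖q‖ ^ 2 + S ^ 2 * ‖p‖ ^ 2 - 2 * C * S * inner ℝ p q := by
    intro p q
    constructor
    · rw [norm_add_sq_real, norm_smul, norm_smul, inner_smul_left, inner_smul_right, mul_pow,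
        mul_pow, Real.norm_eq_abs, Real.norm_eq_abs, sq_abs, sq_abs, conj_trivial]
      ring
    · rw [norm_sub_sq_real, norm_smul, norm_smul, inner_smul_left, inner_smul_right, mul_pow,
        mul_pow, Real.norm_eq_abs, Real.norm_eq_abs, sq_abs, sq_abs, conj_trivial,
        real_inner_comm]
      ring
  have he' : ‖C • e + S • f‖ = 1 := by
    have := (hnn e f).1
    rw [he, hf, hef] at this
    rw [← sq_eq_sq₀ (norm_nonneg _) zero_le_one, this]
    linear_combination hcs
  have hf' : ‖C • f - S • e‖ = 1 := by
    have := (hnn e f).2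
    rw [he, hf, hef] at this
    rw [← sq_eq_sq₀ (norm_nonneg _) zero_le_one, this]
    linear_combination hcs
  have hef' : inner ℝ (C • e + S • f) (C • f - S • e) = 0 := by
    simp only [inner_add_left, inner_sub_right, inner_smul_left, inner_smul_right,
      real_inner_self_eq_norm_sq, real_inner_comm e f, conj_trivial, he, hf, hef]
    ring
  have hop' : bellOperator a b c d = spin (C • x + S • y) ⊗ₖ spin (C • e + S • f) +
      spin (C • y - S • x) ⊗ₖ spin (C • f - S • e) := by
    rw [hop]
    have hcs' : (S : ℂ) ^ 2 + (C : ℂ) ^ 2 = 1 := by exact_mod_cast hcs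
    ext p q
    simp only [spin_add, spin_sub, spin_smul, Matrix.add_apply, Matrix.sub_apply,
      Matrix.kroneckerMap_apply, Matrix.smul_apply, smul_eq_mul]
    linear_combination (-(spin x p.1 q.1 * spin e p.2 q.2) - spin y p.1 q.1 * spin f p.2 q.2) * hcs'
  obtain ⟨g, h, hg, hh, hgh, hxg, hyh⟩ := exists_orthonormal_pair hxy'
  have hs : ‖C • x + S • y‖ ^ 2 + ‖C • y - S • x‖ ^ 2 = 1 := by
    rw [(hnn x y).1, (hnn x y).2, ← hnorm, ← hxn, ← hyn]
    linear_combination (‖x‖ ^ 2 + ‖y‖ ^ 2) * hcs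
  have htr : ∀ (s₁ s₂ : ℝ) (U V : Mat2) (σ : Mat4),
      (filterRaw σ U V * standardBell s₁ s₂).trace =
      (σ * ((s₁ : ℂ) • ((Uᴴ * pauli 2 * U) ⊗ₖ (Vᴴ * pauli 2 * V)) +
        (s₂ : ℂ) • ((Uᴴ * pauli 0 * U) ⊗ₖ (Vᴴ * pauli 0 * V)))).trace := by
    intro s₁ s₂ U V σ
    have e : (s₁ : ℂ) • ((Uᴴ * pauli 2 * U) ⊗ₖ (Vᴴ * pauli 2 * V)) +
        (s₂ : ℂ) • ((Uᴴ * pauli 0 * U) ⊗ₖ (Vᴴ * pauli 0 * V)) =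
        (U ⊗ₖ V)ᴴ * standardBell s₁ s₂ * (U ⊗ₖ V) := by
      simp only [standardBell, Matrix.mul_kronecker_mul, Matrix.conjTranspose_kronecker,
        Matrix.mul_add, Matrix.add_mul, Matrix.mul_smul, Matrix.smul_mul]
    rw [e, filterRaw, Matrix.mul_assoc, Matrix.mul_assoc, Matrix.trace_mul_comm]
    simp only [Matrix.mul_assoc]
  have hop2 : ∀ σ : Mat4, σ * bellOperator a b c d =
      σ * (((‖C • x + S • y‖ : ℝ) : ℂ) • (spin g ⊗ₖ spin (C • e + S • f)) +
        ((‖C • y - S • x‖ : ℝ) : ℂ) • (spin h ⊗ₖ spin (C • f - S • e))) := by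
    intro σ
    rw [hop']
    nth_rewrite 1 [hxg]
    nth_rewrite 1 [hyh]
    rw [spin_smul, spin_smul, Matrix.smul_kronecker, Matrix.smul_kronecker]
  -- The larger singular value is assigned to the `z` axis.
  rcases le_total ‖C • y - S • x‖ ‖C • x + S • y‖ with hle | hle
  · obtain ⟨U, hU, hU1, hU2⟩ := exists_unitary_conj_spin hg hh hgh
    obtain ⟨V, hV, hV1, hV2⟩ := exists_unitary_conj_spin he' hf' hef'
    refine ⟨_, _, norm_nonneg _, hle, hs, U, hU, V, hV, fun σ => ?_⟩
    rw [htr, hop2, ← hU1, ← hU2, ← hV1, ← hV2]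
  · obtain ⟨U, hU, hU1, hU2⟩ := exists_unitary_conj_spin hh hg (by rw [real_inner_comm]; exact hgh)
    obtain ⟨V, hV, hV1, hV2⟩ := exists_unitary_conj_spin hf' he'
      (by rw [real_inner_comm]; exact hef')
    refine ⟨_, _, norm_nonneg _, hle, by rw [add_comm]; exact hs, U, hU, V, hV, fun σ => ?_⟩
    rw [htr, hop2, ← hU1, ← hU2, ← hV1, ← hV2, add_comm]

end CHSHFilter

namespace CHSHFilter

open Matrix

/-! ### The bound on CHSH values by the flip spectrum -/

/-- `lam` is the ordered flip spectrum of `σ`, and it bounds the CHSH values of `σ`. -/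
structure ChshBound (σ : Mat4) (lam : Fin 4 → ℝ) : Prop where
  antitone : ∀ i j : Fin 4, i ≤ j → lam j ≤ lam i
  nonneg : ∀ k, 0 ≤ lam k
  flipSpectrum : FlipSpectrum σ lam
  sum_le_trace : ∑ k, lam k ≤ σ.trace.re
  standardBell_le : ∀ s₁ s₂ : ℝ, ∀ U V : Mat2, 0 ≤ s₂ → s₂ ≤ s₁ →
    U ∈ Matrix.unitaryGroup (Fin 2) ℂ → V ∈ Matrix.unitaryGroup (Fin 2) ℂ →
    (filterRaw σ U V * standardBell s₁ s₂).trace.re ≤ s₁ * (σ.trace.re - ∑ k, lam k) +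
      (s₁ * (lam 0 + lam 1 - lam 2 - lam 3) + s₂ * (lam 0 + lam 2 - lam 1 - lam 3))

lemma ChshBound.filterRaw_bellMix (A B : Mat2) {mu : Fin 4 → ℝ} (hmu : Antitone mu)
    (hmu0 : ∀ k, 0 ≤ mu k) : ChshBound (filterRaw (bellMix mu) A B) ((‖A.det‖ * ‖B.det‖) • mu) where
  antitone i j hij := mul_le_mul_of_nonneg_left (hmu hij) (by positivity)
  nonneg k := mul_nonneg (by positivity) (hmu0 k)
  flipSpectrum := (flipSpectrum_bellMix mu).filterRaw A B
  sum_le_trace := by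
    simp only [Pi.smul_apply, smul_eq_mul, ← Finset.mul_sum]
    exact norm_det_mul_sum_le_trace A B hmu0
  standardBell_le s₁ s₂ U V hs₂ hs hU hV := by
    rw [filterRaw_filterRaw]
    have h := bellMix_filter_inequality (U * A) (V * B) hmu hmu0 hs₂ hs
    rw [← filterRaw_filterRaw, trace_filterRaw_unitary _ hU hV, filterRaw_filterRaw,
      Matrix.det_mul, Matrix.det_mul, norm_mul, norm_mul, norm_det_of_mem_unitaryGroup hU,
      norm_det_of_mem_unitaryGroup hV, one_mul, one_mul] at h
    refine h.trans (le_of_eq ?_)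
    simp only [Pi.smul_apply, smul_eq_mul, ← Finset.mul_sum]
    ring

lemma bellMix_smul (c : ℝ) (p : Fin 4 → ℝ) : bellMix (c • p) = (c : ℂ) • bellMix p := by
  simp only [bellMix, Finset.smul_sum, smul_smul, Pi.smul_apply, smul_eq_mul, Complex.ofReal_mul]

lemma filterRaw_inv {ρ : Mat4} {A B : Mat2} (h : Reversible A B) :
    filterRaw (filterRaw ρ A B) A⁻¹ B⁻¹ = ρ := by
  rw [filterRaw_filterRaw, Matrix.nonsing_inv_mul _ ((Matrix.isUnit_iff_isUnit_det A).mp h.1),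
    Matrix.nonsing_inv_mul _ ((Matrix.isUnit_iff_isUnit_det B).mp h.2), filterRaw_one]

lemma filterRaw_eq_smul_filtered {ρ : Mat4} {A B : Mat2} (h : Admissible ρ A B) :
    filterRaw ρ A B = (filterRaw ρ A B).trace • filtered ρ A B := by
  rw [filtered, smul_inv_smul₀ h]

/-- Undoing the filter that makes `σ` Bell diagonal exhibits `σ` itself as a filtered Bell mixture,
to which the trace inequality applies. -/
lemma exists_chshBound_of_posDef {σ : Mat4} (hσ : σ.PosDef) : ∃ lam, ChshBound σ lam := by
  obtain ⟨A, B, hAB, hadm, hbd⟩ := exists_filtered_isBellDiagonal hσ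
  obtain ⟨p, hp, hp0, _, U, _, V, _, hUV⟩ := hbd.exists_antitone
  set r := (filterRaw σ A B).trace.re with hr
  have hps := PosSemidef_filterRaw hσ.posSemidef A B
  have hr0 : 0 ≤ r := trace_re_nonneg hps
  have e : σ = filterRaw (bellMix (r • p)) (A⁻¹ * U) (B⁻¹ * V) := by
    rw [← filterRaw_filterRaw, bellMix_smul, filterRaw_smul, hr, ← trace_eq_re_of_posSemidef hps]
    change _ = filterRaw ((filterRaw σ A B).trace •
      ((U ⊗ₖ V) * bellMix p * (U ⊗ₖ V).conjTranspose)) A⁻¹ B⁻¹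
    rw [← hUV, ← filterRaw_eq_smul_filtered hadm, filterRaw_inv hAB]
  exact ⟨_, e ▸ ChshBound.filterRaw_bellMix _ _
    (fun i j hij => mul_le_mul_of_nonneg_left (hp hij) hr0) fun k => mul_nonneg hr0 (hp0 k)⟩

/-! ### Passage of the bound from full rank to arbitrary states -/

lemma isClosed_chshBound : IsClosed {x : Mat4 × (Fin 4 → ℝ) | ChshBound x.1 x.2} := by
  have htr : Continuous fun x : Mat4 × (Fin 4 → ℝ) => x.1.trace.re :=
    Complex.continuous_re.comp continuous_fst.matrix_trace
  have hlam : ∀ k, Continuous fun x : Mat4 × (Fin 4 → ℝ) => x.2 k := fun k =>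
    (continuous_apply k).comp continuous_snd
  have e : {x : Mat4 × (Fin 4 → ℝ) | ChshBound x.1 x.2} =
      {x | ∀ i j : Fin 4, i ≤ j → x.2 j ≤ x.2 i} ∩ ({x | ∀ k, 0 ≤ x.2 k} ∩
      ({x | FlipSpectrum x.1 x.2} ∩ ({x | ∑ k, x.2 k ≤ x.1.trace.re} ∩
      {x | ∀ s₁ s₂ : ℝ, ∀ U V : Mat2, 0 ≤ s₂ → s₂ ≤ s₁ →
        U ∈ Matrix.unitaryGroup (Fin 2) ℂ → V ∈ Matrix.unitaryGroup (Fin 2) ℂ →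
        (filterRaw x.1 U V * standardBell s₁ s₂).trace.re ≤ s₁ * (x.1.trace.re - ∑ k, x.2 k) +
          (s₁ * (x.2 0 + x.2 1 - x.2 2 - x.2 3) +
            s₂ * (x.2 0 + x.2 2 - x.2 1 - x.2 3))}))) :=
    Set.ext fun x => ⟨fun ⟨h1, h2, h3, h4, h5⟩ => ⟨h1, h2, h3, h4, h5⟩,
      fun ⟨h1, h2, h3, h4, h5⟩ => ⟨h1, h2, h3, h4, h5⟩⟩
  rw [e]
  refine IsClosed.inter ?_ (IsClosed.inter ?_ (isClosed_flipSpectrum.inter (IsClosed.inter ?_ ?_)))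
  · simp only [Set.ofPred_forall]
    exact isClosed_iInter fun i => isClosed_iInter fun j => isClosed_iInter fun _ =>
      isClosed_le (hlam j) (hlam i)
  · simp only [Set.ofPred_forall]
    exact isClosed_iInter fun k => isClosed_le continuous_const (hlam k)
  · exact isClosed_le (continuous_finsetSum _ fun k _ => hlam k) htr
  · simp only [Set.ofPred_forall]
    refine isClosed_iInter fun s₁ => isClosed_iInter fun s₂ => isClosed_iInter fun U =>
      isClosed_iInter fun V => isClosed_iInter fun _ => isClosed_iInter fun _ =>
      isClosed_iInter fun _ => isClosed_iInter fun _ => isClosed_le ?_ ?_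
    · refine Complex.continuous_re.comp (Continuous.matrix_trace ?_)
      unfold filterRaw
      fun_prop
    · fun_prop

lemma exists_chshBound {σ : Mat4} (hσ : σ.PosSemidef) : ∃ lam, ChshBound σ lam := by
  set τ : ℕ → Mat4 := fun n => σ + ((1 / ((n : ℝ) + 1) : ℝ) : ℂ) • 1 with hτ
  have hpd : ∀ n, (τ n).PosDef := by
    intro n
    refine Matrix.PosDef.posSemidef_add hσ (Matrix.PosDef.one.smul ?_)
    exact_mod_cast Nat.one_div_pos_of_nat (α := ℝ) (n := n)
  choose lam hlam using fun n => exists_chshBound_of_posDef (hpd n)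
  have hlim : Filter.Tendsto τ Filter.atTop (nhds σ) := by
    have h1 := (tendsto_one_div_add_atTop_nhds_zero_nat (𝕜 := ℝ))
    have h2 : Filter.Tendsto (fun n : ℕ => ((1 / ((n : ℝ) + 1) : ℝ) : ℂ)) Filter.atTop (nhds 0) := by
      rw [← Complex.ofReal_zero]
      exact (Complex.continuous_ofReal.tendsto 0).comp h1
    have h3 := (tendsto_const_nhds (x := σ)).add (h2.smul (tendsto_const_nhds (x := (1 : Mat4))))
    rw [zero_smul, add_zero] at h3
    exact h3
  -- The spectrum is bounded by the trace; the `4` is the trace of the identity, added with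
  -- coefficient at most `1`.
  have hbox : ∀ n, lam n ∈ Set.pi Set.univ fun _ : Fin 4 => Set.Icc (0 : ℝ) (σ.trace.re + 4) := by
    intro n k _
    refine ⟨(hlam n).nonneg k, ?_⟩
    have h1 : lam n k ≤ ∑ k, lam n k :=
      Finset.single_le_sum (fun k _ => (hlam n).nonneg k) (Finset.mem_univ k)
    have h2 : (τ n).trace.re = σ.trace.re + (1 / ((n : ℝ) + 1)) * 4 := by
      simp only [hτ, Matrix.trace_add, Matrix.trace_smul, Complex.add_re, smul_eq_mul,
        Complex.re_ofReal_mul, Matrix.trace_one]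
      simp
    have h3 : 1 / ((n : ℝ) + 1) ≤ 1 := by
      rw [div_le_one (by positivity)]
      linarith [Nat.cast_nonneg (α := ℝ) n]
    have := (hlam n).sum_le_trace
    rw [h2] at this
    linarith
  obtain ⟨l, _, φ, hφ, hl⟩ := (isCompact_univ_pi fun _ : Fin 4 =>
    isCompact_Icc (a := (0 : ℝ)) (b := σ.trace.re + 4)).tendsto_subseq hbox
  refine ⟨l, ?_⟩
  have h := isClosed_chshBound.mem_of_tendsto ((hlim.comp hφ.tendsto_atTop).prodMk_nhds hl)
    (Filter.Eventually.of_forall fun n => hlam (φ n))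
  exact h

/-! ### Maximal CHSH values -/

/-- Conjugation keeps a spin observable Hermitian, traceless and involutive, so its Bloch vector can
be read off the entries and has norm one. -/
lemma exists_spin_eq_conj {U : Mat2} (hU : U ∈ Matrix.unitaryGroup (Fin 2) ℂ)
    {a : EuclideanSpace ℝ (Fin 3)} (ha : ‖a‖ = 1) :
    ∃ a' : EuclideanSpace ℝ (Fin 3), ‖a'‖ = 1 ∧ spin a' = U * spin a * Uᴴ := by
  have hUU : Uᴴ * U = 1 := Matrix.mem_unitaryGroup_iff'.mp hU
  set X := U * spin a * Uᴴ with hX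
  have hXH : X.IsHermitian := Matrix.isHermitian_mul_mul_conjTranspose U (isHermitian_spin a)
  have hXtr : X.trace = 0 := by
    rw [hX, Matrix.trace_mul_comm, ← Matrix.mul_assoc, hUU, Matrix.one_mul, spin_eq]
    simp [Matrix.trace, Fin.sum_univ_two]
  have hXX : X * X = 1 := by
    have hUU' : U * Uᴴ = 1 := Matrix.mem_unitaryGroup_iff.mp hU
    calc X * X = U * spin a * (Uᴴ * U) * spin a * Uᴴ := by rw [hX]; noncomm_ring
      _ = U * (spin a * spin a) * Uᴴ := by rw [hUU, Matrix.mul_one]; noncomm_ring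
      _ = 1 := by rw [spin_mul_self, ha]; simp [hUU']
  have x10 : X 1 0 = star (X 0 1) := (congrFun (congrFun hXH 1) 0).symm
  have x00 : X 0 0 = ((X 0 0).re : ℂ) :=
    (Complex.conj_eq_iff_re.mp (congrFun (congrFun hXH 0) 0)).symm
  have x11 : X 1 1 = -X 0 0 := by
    rw [Matrix.trace, Fin.sum_univ_two] at hXtr
    simp only [Matrix.diag_apply] at hXtr
    linear_combination hXtr
  set a' : EuclideanSpace ℝ (Fin 3) := !₂[(X 0 1).re, -(X 0 1).im, (X 0 0).re] with ha'
  have hspin : spin a' = X := by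
    rw [spin_eq]
    ext i j
    fin_cases i <;> fin_cases j
    · simp [ha', ← x00]
    · apply Complex.ext <;> simp [ha']
    · apply Complex.ext <;> simp [ha', x10]
    · simp [ha', x11, ← x00]
  refine ⟨a', ?_, hspin⟩
  have h := spin_mul_self a'
  rw [hspin, hXX] at h
  have h2 := congrFun (congrFun h 0) 0
  simp only [Matrix.one_apply_eq, Matrix.smul_apply, smul_eq_mul, mul_one] at h2
  have h3 : ‖a'‖ ^ 2 = 1 := by exact_mod_cast h2.symm
  exact (sq_eq_sq₀ (norm_nonneg _) zero_le_one).mp (by rw [h3, one_pow])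

lemma LocallyUnitarilyEquivalent.bellValues_subset {ρ ρ' : Mat4}
    (h : LocallyUnitarilyEquivalent ρ ρ') : bellValues ρ ⊆ bellValues ρ' := by
  obtain ⟨U, hU, V, hV, rfl⟩ := h
  rintro _ ⟨a, b, c, d, ha, hb, hc, hd, rfl⟩
  obtain ⟨a', ha', hsa⟩ := exists_spin_eq_conj hU ha
  obtain ⟨b', hb', hsb⟩ := exists_spin_eq_conj hU hb
  obtain ⟨c', hc', hsc⟩ := exists_spin_eq_conj hV hc
  obtain ⟨d', hd', hsd⟩ := exists_spin_eq_conj hV hd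
  refine ⟨a', b', c', d', ha', hb', hc', hd', ?_⟩
  set G : Mat4 := U ⊗ₖ V with hG
  have hGG : Gᴴ * G = 1 := by
    rw [hG, Matrix.conjTranspose_kronecker, ← Matrix.mul_kronecker_mul, ← star_eq_conjTranspose,
      ← star_eq_conjTranspose, Matrix.mem_unitaryGroup_iff'.mp hU,
      Matrix.mem_unitaryGroup_iff'.mp hV, Matrix.one_kronecker_one]
  have e : bellOperator a' b' c' d' = G * bellOperator a b c d * Gᴴ := by
    rw [bellOperator_eq, bellOperator_eq, spin_smul, spin_smul, spin_smul, spin_smul, spin_add,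
      spin_sub, spin_add, spin_sub, hsa, hsb, hsc, hsd, Matrix.mul_add, Matrix.add_mul, hG,
      Matrix.conjTranspose_kronecker, ← Matrix.mul_kronecker_mul, ← Matrix.mul_kronecker_mul,
      ← Matrix.mul_kronecker_mul, ← Matrix.mul_kronecker_mul]
    simp only [Matrix.mul_smul, Matrix.smul_mul, Matrix.mul_add, Matrix.add_mul, Matrix.mul_sub,
      Matrix.sub_mul]
  rw [e]
  congr 1
  calc (ρ * bellOperator a b c d).trace
      = (Gᴴ * G * ρ * (Gᴴ * G) * bellOperator a b c d).trace := by
        rw [hGG, Matrix.one_mul, Matrix.mul_one]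
    _ = (Gᴴ * (G * ρ * Gᴴ * G * bellOperator a b c d)).trace := by simp only [Matrix.mul_assoc]
    _ = (G * ρ * Gᴴ * G * bellOperator a b c d * Gᴴ).trace := Matrix.trace_mul_comm _ _
    _ = _ := by simp only [Matrix.mul_assoc]

lemma trace_bellMix_mul_standardBell (p : Fin 4 → ℝ) (s₁ s₂ : ℝ) :
    (bellMix p * standardBell s₁ s₂).trace.re =
      s₁ * (p 0 + p 1 - p 2 - p 3) + s₂ * (p 0 + p 2 - p 1 - p 3) := by
  have h := trace_filterRaw_bellMix_mul_re p 1 1 (standardBell s₁ s₂)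
  rw [filterRaw_one] at h
  rw [h]
  simp only [Matrix.one_mul, Matrix.transpose_one, Matrix.mul_one, trace_proj_mul_standardBell,
    trace_proj_bellMat, Fin.sum_univ_four]
  simp [zzForm, zxForm, bellMat]
  ring

lemma mem_bellValues_bellMix (p : Fin 4 → ℝ) {s₁ s₂ : ℝ} (hs : s₁ ^ 2 + s₂ ^ 2 = 1) :
    s₁ * (p 0 + p 1 - p 2 - p 3) + s₂ * (p 0 + p 2 - p 1 - p 3) ∈ bellValues (bellMix p) := by
  set z : EuclideanSpace ℝ (Fin 3) := EuclideanSpace.single 2 1 with hz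
  set x : EuclideanSpace ℝ (Fin 3) := EuclideanSpace.single 0 1 with hx
  have hzn : ‖z‖ = 1 := by simp [hz]
  have hxn : ‖x‖ = 1 := by simp [hx]
  have hzx : inner ℝ z x = 0 := by rw [inner_fin_three]; simp [hz, hx]
  have hnorm : ∀ t : ℝ, s₁ ^ 2 + t ^ 2 = 1 → ‖s₁ • z + t • x‖ = 1 := by
    intro t ht
    rw [← sq_eq_sq₀ (norm_nonneg _) zero_le_one, norm_add_sq_real, norm_smul, norm_smul, hzn, hxn,
      inner_smul_left, inner_smul_right, hzx]
    simpa using ht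
  -- With these settings the half sum and half difference of `c` and `d` are `s₁ z` and `s₂ x`, so
  -- the Bell operator is the standard one.
  refine ⟨z, x, s₁ • z + s₂ • x, s₁ • z + (-s₂) • x, hzn, hxn, hnorm _ hs,
    hnorm _ (by rw [neg_sq]; exact hs), ?_⟩
  rw [← trace_bellMix_mul_standardBell, bellOperator_eq]
  have e1 : (1 / 2 : ℝ) • (s₁ • z + s₂ • x + (s₁ • z + (-s₂) • x)) = s₁ • z := by module
  have e2 : (1 / 2 : ℝ) • (s₁ • z + s₂ • x - (s₁ • z + (-s₂) • x)) = s₂ • x := by module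
  have sz : spin z = pauli 2 := by
    simp [spin, hz]
  have sx : spin x = pauli 0 := by
    simp [spin, hx]
  rw [e1, e2, spin_smul, spin_smul, sz, sx, Matrix.kronecker_smul, Matrix.kronecker_smul,
    standardBell]

lemma ChshBound.le_of_mem_bellValues {σ : Mat4} {lam : Fin 4 → ℝ} (h : ChshBound σ lam)
    (hσ : IsState σ) {x : ℝ} (hx : x ∈ bellValues σ) :
    ∃ s₁ s₂ : ℝ, 0 ≤ s₂ ∧ s₂ ≤ s₁ ∧ s₁ ≤ 1 ∧ s₁ ^ 2 + s₂ ^ 2 = 1 ∧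
      x ≤ s₁ * (1 - ∑ k, lam k) +
        (s₁ * (lam 0 + lam 1 - lam 2 - lam 3) + s₂ * (lam 0 + lam 2 - lam 1 - lam 3)) := by
  obtain ⟨a, b, c, d, ha, hb, hc, hd, rfl⟩ := hx
  obtain ⟨s₁, s₂, h2, h1, hs, U, hU, V, hV, hUV⟩ := exists_standardBell a b c d ha hb hc hd
  refine ⟨s₁, s₂, h2, h1, by nlinarith, hs, ?_⟩
  have := h.standardBell_le s₁ s₂ U V h2 h1 hU hV
  rw [hσ.2, Complex.one_re] at this
  rw [hUV]
  exact this

lemma bellValues_nonempty (σ : Mat4) : (bellValues σ).Nonempty :=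
  ⟨_, EuclideanSpace.single 0 1, EuclideanSpace.single 0 1, EuclideanSpace.single 0 1,
    EuclideanSpace.single 0 1, by simp, by simp, by simp, by simp, rfl⟩

/-- Needed because a real `sSup` of an unbounded set defaults to zero; the constant `3` is a crude
bound. -/
lemma IsState.bddAbove_bellValues {σ : Mat4} (hσ : IsState σ) : BddAbove (bellValues σ) := by
  obtain ⟨lam, h⟩ := exists_chshBound hσ.1
  refine ⟨3, fun x hx => ?_⟩
  obtain ⟨s₁, s₂, h2, h1, hs1, hs, hle⟩ := h.le_of_mem_bellValues hσ hx
  have hsum := h.sum_le_trace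
  rw [hσ.2, Complex.one_re, Fin.sum_univ_four] at hsum
  rw [Fin.sum_univ_four] at hle
  have := h.nonneg 0
  have := h.nonneg 1
  have := h.nonneg 2
  have := h.nonneg 3
  nlinarith

lemma beta_le_one_of_flipSpectrum_zero {σ : Mat4} (hσ : IsState σ) (h0 : FlipSpectrum σ 0) :
    beta σ ≤ 1 := by
  obtain ⟨lam, h⟩ := exists_chshBound hσ.1
  have e : lam = 0 := h.flipSpectrum.eq_of_antitone h0 (fun i j hij => h.antitone i j hij)
    antitone_const h.nonneg fun _ => le_rfl
  subst e
  refine csSup_le (bellValues_nonempty σ) fun x hx => ?_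
  obtain ⟨s₁, s₂, h2, h1, hs1, hs, hle⟩ := h.le_of_mem_bellValues hσ hx
  simpa using hle.trans (by simpa using hs1)

/-- The bound on a CHSH value splits as `s₁ (1 - c)`, at most `1 - c`, plus `c` times a number that
is itself a CHSH value of `ρ₀`, for the same `s₁, s₂`. -/
lemma beta_le_of_flipSpectrum_smul {σ ρ₀ : Mat4} {p : Fin 4 → ℝ} {c : ℝ} (hσ : IsState σ)
    (hρ₀ : IsState ρ₀) (hp : Antitone p) (hp0 : ∀ k, 0 ≤ p k) (hp1 : ∑ k, p k = 1)
    (hl : LocallyUnitarilyEquivalent (bellMix p) ρ₀) (hc : 0 ≤ c) (h : FlipSpectrum σ (c • p)) :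
    c ≤ 1 ∧ beta σ ≤ (1 - c) + c * beta ρ₀ := by
  obtain ⟨lam, hb⟩ := exists_chshBound hσ.1
  have e : lam = c • p := hb.flipSpectrum.eq_of_antitone h (fun i j hij => hb.antitone i j hij)
    (fun i j hij => mul_le_mul_of_nonneg_left (hp hij) hc) hb.nonneg
    fun k => mul_nonneg hc (hp0 k)
  subst e
  have hsum : ∑ k, (c • p) k = c := by
    simp only [Pi.smul_apply, smul_eq_mul, ← Finset.mul_sum, hp1, mul_one]
  have hc1 : c ≤ 1 := by
    have := hb.sum_le_trace
    rwa [hσ.2, Complex.one_re, hsum] at this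
  refine ⟨hc1, csSup_le (bellValues_nonempty σ) fun x hx => ?_⟩
  obtain ⟨s₁, s₂, h2, h1, hs1, hs, hle⟩ := hb.le_of_mem_bellValues hσ hx
  have hβ := le_csSup hρ₀.bddAbove_bellValues (hl.bellValues_subset (mem_bellValues_bellMix p hs))
  rw [hsum] at hle
  simp only [Pi.smul_apply, smul_eq_mul] at hle
  change _ ≤ beta ρ₀ at hβ
  have h3 := mul_le_mul_of_nonneg_left hβ hc
  nlinarith

end CHSHFilter

namespace CHSHFilter

open Matrix

/-! ### Product states with a pure factor -/

lemma spinFlip_mul_eq_zero_of_det {σ τ : Mat2} (h : σ.det * τ.det = 0) :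
    (σ ⊗ₖ τ) * spinFlip (σ ⊗ₖ τ) = 0 := by
  have e := transpose_mul_flipMat4_mul σᵀ τᵀ
  have ht : ∀ A B : Mat2, (A ⊗ₖ B)ᵀ = Aᵀ ⊗ₖ Bᵀ := fun A B => by ext p q; simp
  rw [Matrix.det_transpose, Matrix.det_transpose, h, zero_smul, ht, Matrix.transpose_transpose,
    Matrix.transpose_transpose] at e
  rw [spinFlip, ht, ← Matrix.mul_assoc, ← Matrix.mul_assoc, e, Matrix.zero_mul]

lemma flipSpectrum_zero_of_mul_eq_zero {ρ : Mat4} (h : ρ * spinFlip ρ = 0) : FlipSpectrum ρ 0 := by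
  intro z
  simp [h, Matrix.scalar_apply]

lemma det_eq_zero_of_rank_eq_one {σ : Mat2} (h : σ.rank = 1) : σ.det = 0 := by
  by_contra hd
  have := Matrix.rank_of_isUnit σ (isUnit_of_det_ne_zero hd)
  rw [h, Fintype.card_fin] at this
  omega

lemma IsProductWithPureFactor.flipSpectrum {ρ : Mat4} (h : IsProductWithPureFactor ρ) :
    FlipSpectrum ρ 0 := by
  obtain ⟨σ, τ, _, _, hr, rfl⟩ := h
  refine flipSpectrum_zero_of_mul_eq_zero (spinFlip_mul_eq_zero_of_det ?_)
  rcases hr with hr | hr <;> rw [det_eq_zero_of_rank_eq_one hr] <;> simp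

lemma FlipSpectrum.trace_eq_zero {ρ : Mat4} (h : FlipSpectrum ρ 0) :
    (ρ * spinFlip ρ).trace = 0 := by
  have e : (ρ * spinFlip ρ).charpoly = Polynomial.X ^ 4 := by
    refine Polynomial.funext fun z => ?_
    rw [Matrix.eval_charpoly, h z]
    simp
  rw [Matrix.trace_eq_neg_charpoly_coeff, e, Polynomial.coeff_X_pow]
  simp

lemma exists_eq_outer {K : Mat2} (h : K.det = 0) : ∃ x y : Fin 2 → ℂ, K = outer x y := by
  rw [Matrix.det_fin_two] at h
  by_cases hK : K = 0
  · exact ⟨0, 0, by rw [hK, outer]; simp⟩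
  · obtain ⟨i, j, hij⟩ : ∃ i j, K i j ≠ 0 := by
      by_contra! h0
      exact hK (by ext i j; simp [h0])
    refine ⟨fun k => K k j, fun l => K i l / K i j, ?_⟩
    ext k l
    rw [outer, Matrix.vecMulVec_apply]
    field_simp
    fin_cases i <;> fin_cases j <;> fin_cases k <;> fin_cases l <;> simp <;>
      first | ring1 | linear_combination h | linear_combination -h

/-- The polarisation of the determinant. -/
def detForm (K L : Mat2) : ℂ := K 0 0 * L 1 1 - K 0 1 * L 1 0 - K 1 0 * L 0 1 + K 1 1 * L 0 0

/-- Totally isotropic subspaces of the determinant form on 2 × 2 matrices lie in one of the two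
rulings of the quadric of rank-one matrices: a common column vector or a common row vector. -/
lemma outer_family_of_detForm_eq_zero {ι : Type*} (K : ι → Mat2)
    (h : ∀ r s, detForm (K r) (K s) = 0) :
    (∃ x : Fin 2 → ℂ, ∃ z : ι → Fin 2 → ℂ, ∀ r, K r = outer x (z r)) ∨
      ∃ y : Fin 2 → ℂ, ∃ z : ι → Fin 2 → ℂ, ∀ r, K r = outer (z r) y := by
  have hdet : ∀ r, (K r).det = 0 := by
    intro r
    have := h r r
    rw [detForm] at this
    rw [Matrix.det_fin_two]
    linear_combination this / 2
  have hcol : ∀ x : Fin 2 → ℂ, x ≠ 0 → (∀ r j, x 1 * K r 0 j = x 0 * K r 1 j) →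
      ∃ z : ι → Fin 2 → ℂ, ∀ r, K r = outer x (z r) := by
    intro x hx hK
    obtain ⟨i, hi⟩ := Function.ne_iff.mp hx
    refine ⟨fun r j => K r i j / x i, fun r => ?_⟩
    ext k j
    rw [outer, Matrix.vecMulVec_apply]
    have := hK r j
    have hi' : x i ≠ 0 := hi
    field_simp
    fin_cases i <;> fin_cases k <;> simp <;>
      first | ring1 | linear_combination this | linear_combination -this
  have hrow : ∀ y : Fin 2 → ℂ, y ≠ 0 → (∀ r i, y 1 * K r i 0 = y 0 * K r i 1) →
      ∃ z : ι → Fin 2 → ℂ, ∀ r, K r = outer (z r) y := by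
    intro y hy hK
    obtain ⟨j, hj⟩ := Function.ne_iff.mp hy
    refine ⟨fun r i => K r i j / y j, fun r => ?_⟩
    ext i k
    rw [outer, Matrix.vecMulVec_apply]
    have := hK r i
    have hj' : y j ≠ 0 := hj
    field_simp
    fin_cases j <;> fin_cases k <;> simp <;>
      first | ring1 | linear_combination this | linear_combination -this
  by_cases hK : ∀ r, K r = 0
  · exact Or.inl ⟨0, 0, fun r => by rw [hK, outer]; simp⟩
  push Not at hK
  obtain ⟨r₀, hr₀⟩ := hK
  obtain ⟨x, y, hxy⟩ := exists_eq_outer (hdet r₀)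
  have hx : x ≠ 0 := by rintro rfl; exact hr₀ (by rw [hxy, outer]; simp)
  have hy : y ≠ 0 := by rintro rfl; exact hr₀ (by rw [hxy, outer]; simp)
  have hb : ∀ r, x 1 * (y 1 * K r 0 0 - y 0 * K r 0 1) - x 0 * (y 1 * K r 1 0 - y 0 * K r 1 1) = 0 := by
    intro r
    have := h r r₀
    rw [hxy, detForm, outer] at this
    simp only [Matrix.vecMulVec_apply] at this
    linear_combination this
  by_cases hc : ∀ r j, x 1 * K r 0 j = x 0 * K r 1 j
  · exact Or.inl ⟨x, hcol x hx hc⟩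
  push Not at hc
  -- If some member has a column vector independent of `x`, its row vector `y'` must be parallel to
  -- `y`. Isotropy against both members then forces the rows of every other member along `y'`.
  obtain ⟨r₁, j₁, hj₁⟩ := hc
  obtain ⟨x', y', hxy'⟩ := exists_eq_outer (hdet r₁)
  have hb₁ := hb r₁
  rw [hxy', outer] at hj₁ hb₁
  simp only [Matrix.vecMulVec_apply] at hj₁ hb₁
  have hω : x 1 * x' 0 - x 0 * x' 1 ≠ 0 := by
    intro h0
    exact hj₁ (by linear_combination y' j₁ * h0)
  have hy' : y 1 * y' 0 = y 0 * y' 1 := by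
    have : (x 1 * x' 0 - x 0 * x' 1) * (y 1 * y' 0 - y 0 * y' 1) = 0 := by linear_combination hb₁
    exact sub_eq_zero.mp ((mul_eq_zero.mp this).resolve_left hω)
  have hy'0 : y' ≠ 0 := by
    rintro rfl
    exact hj₁ (by simp)
  refine Or.inr ⟨y', hrow y' hy'0 fun r i => ?_⟩
  have h1 : x' 1 * (y' 1 * K r 0 0 - y' 0 * K r 0 1) -
      x' 0 * (y' 1 * K r 1 0 - y' 0 * K r 1 1) = 0 := by
    have := h r r₁
    rw [hxy', detForm, outer] at this
    simp only [Matrix.vecMulVec_apply] at this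
    linear_combination this
  have h2 : x 1 * (y' 1 * K r 0 0 - y' 0 * K r 0 1) -
      x 0 * (y' 1 * K r 1 0 - y' 0 * K r 1 1) = 0 := by
    obtain ⟨i, hi⟩ := Function.ne_iff.mp hy
    have hi' : y i ≠ 0 := hi
    have := hb r
    have e : y i * (x 1 * (y' 1 * K r 0 0 - y' 0 * K r 0 1) -
        x 0 * (y' 1 * K r 1 0 - y' 0 * K r 1 1)) = 0 := by
      fin_cases i
      · simp only [Fin.zero_eta]
        linear_combination y' 0 * this + (-(x 1 * K r 0 0) + x 0 * K r 1 0) * hy'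
      · simp only [Fin.mk_one]
        linear_combination y' 1 * this + (-(x 1 * K r 0 1) + x 0 * K r 1 1) * hy'
    exact (mul_eq_zero.mp e).resolve_left hi'
  have k0 : y' 1 * K r 0 0 - y' 0 * K r 0 1 = 0 := by
    have : (x 1 * x' 0 - x 0 * x' 1) * (y' 1 * K r 0 0 - y' 0 * K r 0 1) = 0 := by
      linear_combination x' 0 * h2 - x 0 * h1
    exact (mul_eq_zero.mp this).resolve_left hω
  have k1 : y' 1 * K r 1 0 - y' 0 * K r 1 1 = 0 := by
    have : (x 1 * x' 0 - x 0 * x' 1) * (y' 1 * K r 1 0 - y' 0 * K r 1 1) = 0 := by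
      linear_combination x' 1 * h2 - x 1 * h1
    exact (mul_eq_zero.mp this).resolve_left hω
  fin_cases i
  · simpa using sub_eq_zero.mp k0
  · simpa using sub_eq_zero.mp k1

/-- For `ρ = Cᴴ C` the trace is the squared Frobenius norm of `C F Cᵀ`, with `F` the flip metric;
the entries of that matrix are the polarised determinants of pairs of rows of `C`. -/
lemma detForm_eq_zero_of_trace {C : Mat4}
    (h : ((Cᴴ * C) * spinFlip (Cᴴ * C)).trace = 0) (r s : Fin 2 × Fin 2) :
    detForm (Matrix.of fun i j => C r (i, j)) (Matrix.of fun i j => C s (i, j)) = 0 := by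
  set M := C * flipMat4 * Cᵀ with hM
  have e : ((Cᴴ * C) * spinFlip (Cᴴ * C)).trace = (M * Mᴴ).trace := by
    have hMH : Mᴴ = Cᴴᵀ * flipMat4 * Cᴴ := by
      rw [hM, Matrix.conjTranspose_mul, Matrix.conjTranspose_mul, conjTranspose_flipMat4,
        ← Matrix.conjTranspose_transpose_eq_transpose_conjTranspose, Matrix.mul_assoc]
    rw [spinFlip, Matrix.transpose_mul, hMH, hM]
    calc (Cᴴ * C * (flipMat4 * (Cᵀ * Cᴴᵀ) * flipMat4)).trace
        = (Cᴴ * (C * flipMat4 * Cᵀ * Cᴴᵀ * flipMat4)).trace := by simp only [Matrix.mul_assoc]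
      _ = (C * flipMat4 * Cᵀ * Cᴴᵀ * flipMat4 * Cᴴ).trace := Matrix.trace_mul_comm _ _
      _ = _ := by simp only [Matrix.mul_assoc]
  rw [e, Matrix.trace_mul_conjTranspose_self_eq_zero_iff] at h
  have := congrFun (congrFun h r) s
  rw [hM] at this
  simp [Matrix.mul_apply, Fintype.sum_prod_type, Fin.sum_univ_two, flipMat4, flipMat] at this
  simp only [detForm, Matrix.of_apply]
  linear_combination this

lemma isProductWithPureFactor_of_kronecker {σ τ : Mat2} (hσ : σ.PosSemidef) (hτ : τ.PosSemidef)
    (hr : σ.rank ≤ 1 ∨ τ.rank ≤ 1) (h : IsState (σ ⊗ₖ τ)) : IsProductWithPureFactor (σ ⊗ₖ τ) := by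
  have htr : σ.trace * τ.trace = 1 := by rw [← Matrix.trace_kronecker]; exact h.2
  have hs0 : σ.trace ≠ 0 := left_ne_zero_of_mul_eq_one htr
  have hs1 : 0 ≤ σ.trace := hσ.trace_nonneg
  have hrank : ∀ {X : Mat2}, X.trace = 1 → X.rank ≤ 1 → X.rank = 1 := by
    intro X hX h1
    refine le_antisymm h1 (Nat.one_le_iff_ne_zero.mpr fun h0 => ?_)
    have h2 : X.mulVecLin = 0 := LinearMap.range_eq_bot.mp (Submodule.finrank_eq_zero.mp h0)
    have h3 : X = 0 := (LinearEquiv.map_eq_zero_iff Matrix.toLin').mp h2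
    rw [h3] at hX
    simp at hX
  have hsmul : ∀ (c : ℂ) {X : Mat2}, X.rank ≤ 1 → (c • X).rank ≤ 1 := by
    intro c X hX
    have : c • X = (c • (1 : Mat2)) * X := by rw [Matrix.smul_mul, Matrix.one_mul]
    rw [this]
    exact (Matrix.rank_mul_le_right _ _).trans hX
  have t1 : (σ.trace⁻¹ • σ).trace = 1 := by
    rw [Matrix.trace_smul, smul_eq_mul, inv_mul_cancel₀ hs0]
  have t2 : (σ.trace • τ).trace = 1 := by rw [Matrix.trace_smul, smul_eq_mul, htr]
  refine ⟨σ.trace⁻¹ • σ, σ.trace • τ, ⟨hσ.smul ?_, t1⟩, ⟨hτ.smul hs1, t2⟩, ?_, ?_⟩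
  · rw [trace_eq_re_of_posSemidef hσ, ← Complex.ofReal_inv]
    exact_mod_cast inv_nonneg.mpr (trace_re_nonneg hσ)
  · exact hr.imp (fun h => hrank t1 (hsmul _ h)) fun h => hrank t2 (hsmul _ h)
  · rw [Matrix.smul_kronecker, Matrix.kronecker_smul, inv_smul_smul₀ hs0]

lemma IsState.isProductWithPureFactor {ρ : Mat4} (hρ : IsState ρ) (h : FlipSpectrum ρ 0) :
    IsProductWithPureFactor ρ := by
  obtain ⟨C, rfl⟩ := exists_eq_conjTranspose_mul_self hρ.1
  have hrk : ∀ x : Fin 2 → ℂ, (Matrix.vecMulVec (star x) x).rank ≤ 1 := fun x =>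
    Matrix.rank_vecMulVec_le _ _
  rcases outer_family_of_detForm_eq_zero (fun r => Matrix.of fun i j => C r (i, j))
    (detForm_eq_zero_of_trace h.trace_eq_zero) with ⟨x, z, hz⟩ | ⟨y, z, hz⟩
  · have hC : ∀ r i j, C r (i, j) = x i * z r j := fun r i j =>
      congrFun (congrFun (hz r) i) j
    set Z : Matrix (Fin 2 × Fin 2) (Fin 2) ℂ := Matrix.of z with hZ
    have e : Cᴴ * C = Matrix.vecMulVec (star x) x ⊗ₖ (Zᴴ * Z) := by
      ext ⟨i, j⟩ ⟨k, l⟩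
      simp only [Matrix.mul_apply, Matrix.conjTranspose_apply, Matrix.kroneckerMap_apply,
        Matrix.vecMulVec_apply, hC, hZ, Matrix.of_apply, Finset.mul_sum, star_mul', Pi.star_apply]
      exact Finset.sum_congr rfl fun r _ => by ring
    rw [e] at hρ ⊢
    exact isProductWithPureFactor_of_kronecker (Matrix.posSemidef_vecMulVec_star_self _)
      (Matrix.posSemidef_conjTranspose_mul_self Z) (Or.inl (hrk x)) hρ
  · have hC : ∀ r i j, C r (i, j) = z r i * y j := fun r i j =>
      congrFun (congrFun (hz r) i) j
    set Z : Matrix (Fin 2 × Fin 2) (Fin 2) ℂ := Matrix.of z with hZ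
    have e : Cᴴ * C = (Zᴴ * Z) ⊗ₖ Matrix.vecMulVec (star y) y := by
      ext ⟨i, j⟩ ⟨k, l⟩
      simp only [Matrix.mul_apply, Matrix.conjTranspose_apply, Matrix.kroneckerMap_apply,
        Matrix.vecMulVec_apply, hC, hZ, Matrix.of_apply, Finset.sum_mul, star_mul', Pi.star_apply]
      exact Finset.sum_congr rfl fun r _ => by ring
    rw [e] at hρ ⊢
    exact isProductWithPureFactor_of_kronecker (Matrix.posSemidef_conjTranspose_mul_self Z)
      (Matrix.posSemidef_vecMulVec_star_self _) (Or.inr (hrk y)) hρ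

end CHSHFilter

namespace CHSHFilter

open Matrix

/-! ### Bell diagonal normal forms -/

instance : FirstCountableTopology Mat4 :=
  inferInstanceAs (FirstCountableTopology (Fin 2 × Fin 2 → Fin 2 × Fin 2 → ℂ))

lemma FlipSpectrum.sum_le_trace {σ : Mat4} {mu : Fin 4 → ℝ} (h : FlipSpectrum σ mu)
    (hσ : σ.PosSemidef) (hmu : Antitone mu) (hmu0 : ∀ k, 0 ≤ mu k) : ∑ k, mu k ≤ σ.trace.re := by
  obtain ⟨lam, hl⟩ := exists_chshBound hσ
  have e : lam = mu := hl.flipSpectrum.eq_of_antitone h (fun i j hij => hl.antitone i j hij) hmu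
    hl.nonneg hmu0
  exact e ▸ hl.sum_le_trace

lemma antitone_smul {c : ℝ} (hc : 0 ≤ c) {mu : Fin 4 → ℝ} (h : Antitone mu) : Antitone (c • mu) :=
  fun _ _ hij => mul_le_mul_of_nonneg_left (h hij) hc

lemma sum_smul_eq (c : ℝ) (mu : Fin 4 → ℝ) : ∑ k, (c • mu) k = c * ∑ k, mu k := by
  simp only [Pi.smul_apply, smul_eq_mul, Finset.mul_sum]

lemma admissible_of_reversible {ρ : Mat4} (hρ : IsState ρ) {A B : Mat2} (h : Reversible A B) :
    Admissible ρ A B := by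
  intro h0
  have h1 := (PosSemidef_filterRaw hρ.1 A B).trace_eq_zero_iff.mp h0
  have h2 := filterRaw_inv (ρ := ρ) h
  rw [h1] at h2
  have h3 := hρ.2
  rw [← h2] at h3
  simp [filterRaw] at h3

/-- The factor by which the flip spectrum changes under a renormalised filter. -/
def filterScale (ρ : Mat4) (A B : Mat2) : ℝ :=
  (filterRaw ρ A B).trace.re⁻¹ * (‖A.det‖ * ‖B.det‖)

lemma filterScale_nonneg {ρ : Mat4} (hρ : ρ.PosSemidef) (A B : Mat2) : 0 ≤ filterScale ρ A B :=
  mul_nonneg (inv_nonneg.mpr (trace_re_nonneg (PosSemidef_filterRaw hρ A B))) (by positivity)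

lemma FlipSpectrum.filtered {ρ : Mat4} {lam : Fin 4 → ℝ} (h : FlipSpectrum ρ lam)
    (hρ : ρ.PosSemidef) (A B : Mat2) :
    FlipSpectrum (filtered ρ A B) (filterScale ρ A B • lam) := by
  rw [filtered_eq hρ, filterScale, mul_smul]
  exact (h.filterRaw A B).smul _

lemma reversible_of_filterScale_ne_zero {ρ : Mat4} {A B : Mat2} (h : filterScale ρ A B ≠ 0) :
    Reversible A B := by
  have h1 := right_ne_zero_of_mul h
  exact ⟨isUnit_of_det_ne_zero (norm_ne_zero_iff.mp (left_ne_zero_of_mul h1)),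
    isUnit_of_det_ne_zero (norm_ne_zero_iff.mp (right_ne_zero_of_mul h1))⟩

/-- Along the orbit the spectrum is a multiple of `lam`, and the trace bounds the multiples when
`lam ≠ 0`. A convergent subsequence gives `p = c • lam`, and normalisation gives `c = 1 / ∑ lam`. If
`lam = 0`, the limit would have zero spectrum, contradicting `∑ p = 1`. -/
lemma IsBellNormalForm.exists_weights {ρ ρ₀ : Mat4} {lam : Fin 4 → ℝ} (hρ : IsState ρ)
    (h : IsBellNormalForm ρ ρ₀) (hl : FlipSpectrum ρ lam) (hla : Antitone lam)
    (hl0 : ∀ k, 0 ≤ lam k) :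
    0 < ∑ k, lam k ∧ ∃ p : Fin 4 → ℝ, Antitone p ∧ (∀ k, 0 ≤ p k) ∧ ∑ k, p k = 1 ∧
      LocallyUnitarilyEquivalent (bellMix p) ρ₀ ∧ lam = (∑ k, lam k) • p := by
  obtain ⟨hbd, hcl⟩ := h
  obtain ⟨p, hp, hp0, hp1, hpl⟩ := hbd.exists_antitone
  have hps : FlipSpectrum ρ₀ p := hpl.flipSpectrum (flipSpectrum_bellMix p)
  obtain ⟨s, hs, hslim⟩ := mem_closure_iff_seq_limit.mp hcl
  choose A B hAB hsAB using hs
  have hspec : ∀ n, FlipSpectrum (s n) (filterScale ρ (A n) (B n) • lam) := fun n => by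
    rw [hsAB n]; exact hl.filtered hρ.1 _ _
  have hst : ∀ n, IsState (s n) := fun n => by
    rw [hsAB n]; exact isState_filtered hρ.1 (admissible_of_reversible hρ (hAB n))
  have hc0 : ∀ n, 0 ≤ filterScale ρ (A n) (B n) := fun n => filterScale_nonneg hρ.1 _ _
  have hle : ∀ n, filterScale ρ (A n) (B n) * ∑ k, lam k ≤ 1 := fun n => by
    have := (hspec n).sum_le_trace (hst n).1 (antitone_smul (hc0 n) hla)
      (fun k => mul_nonneg (hc0 n) (hl0 k))
    rwa [(hst n).2, Complex.one_re, sum_smul_eq] at this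
  have hpos : 0 < ∑ k, lam k := by
    refine lt_of_le_of_ne (Finset.sum_nonneg fun k _ => hl0 k) fun h0 => ?_
    have hlz : lam = 0 := by
      ext k
      exact (Finset.sum_eq_zero_iff_of_nonneg fun k _ => hl0 k).mp h0.symm k
        (Finset.mem_univ k)
    have hz : FlipSpectrum ρ₀ 0 := by
      have := isClosed_flipSpectrum.mem_of_tendsto
        (hslim.prodMk_nhds (tendsto_const_nhds (x := (0 : Fin 4 → ℝ))))
        (Filter.Eventually.of_forall fun n => by
          have := hspec n
          rwa [hlz, smul_zero] at this)
      exact this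
    have : p = 0 := hps.eq_of_antitone hz hp antitone_const hp0 fun _ => le_rfl
    rw [this] at hp1
    simp at hp1
  refine ⟨hpos, p, hp, hp0, hp1, hpl, ?_⟩
  obtain ⟨c, ⟨hc, _⟩, φ, hφ, hclim⟩ := (isCompact_Icc (a := (0 : ℝ))
    (b := 1 / ∑ k, lam k)).tendsto_subseq (x := fun n => filterScale ρ (A n) (B n))
    fun n => ⟨hc0 n, by rw [le_div_iff₀ hpos]; exact hle n⟩
  have hspec₀ : FlipSpectrum ρ₀ (c • lam) := by
    have := isClosed_flipSpectrum.mem_of_tendsto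
      ((hslim.comp hφ.tendsto_atTop).prodMk_nhds (hclim.smul (tendsto_const_nhds (x := lam))))
      (Filter.Eventually.of_forall fun n => hspec (φ n))
    exact this
  have hpc : p = c • lam := hps.eq_of_antitone hspec₀ hp (antitone_smul hc hla) hp0
    fun k => mul_nonneg hc (hl0 k)
  have hcs : c * ∑ k, lam k = 1 := by rw [← sum_smul_eq, ← hpc, hp1]
  rw [hpc, smul_smul, mul_comm, hcs, one_smul]

lemma isBellNormalForm_filtered {ρ : Mat4} {A B : Mat2} (h : Reversible A B)
    (hbd : IsBellDiagonal (filtered ρ A B)) : IsBellNormalForm ρ (filtered ρ A B) :=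
  ⟨hbd, subset_closure ⟨A, B, h, rfl⟩⟩

/-! ### Existence of normal forms by compactness of the state space -/

lemma isCompact_entrywise_ball4 (R : ℝ) : IsCompact {A : Mat4 | ∀ p q, ‖A p q‖ ≤ R} := by
  have h : IsCompact (Set.pi Set.univ fun _ : Fin 2 × Fin 2 => Set.pi Set.univ
      fun _ : Fin 2 × Fin 2 => Metric.closedBall (0 : ℂ) R) :=
    isCompact_univ_pi fun _ => isCompact_univ_pi fun _ => isCompact_closedBall _ _
  have e : {A : Mat4 | ∀ p q, ‖A p q‖ ≤ R} = Set.pi Set.univ fun _ : Fin 2 × Fin 2 =>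
      Set.pi Set.univ fun _ : Fin 2 × Fin 2 => Metric.closedBall (0 : ℂ) R :=
    Set.ext fun A => ⟨fun h i _ j _ => mem_closedBall_zero_iff.mpr (h i j),
      fun h i j => mem_closedBall_zero_iff.mp (h i trivial j trivial)⟩
  rw [e]
  exact h

lemma exists_tendsto_subseq_of_isState {s : ℕ → Mat4} (hs : ∀ n, IsState (s n)) :
    ∃ ρ₀, IsState ρ₀ ∧ ∃ φ : ℕ → ℕ, StrictMono φ ∧
      Filter.Tendsto (s ∘ φ) Filter.atTop (nhds ρ₀) := by
  -- A factor `C` of a state has Frobenius norm one, so its entries lie in a compact set.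
  choose C hC using fun n => exists_eq_conjTranspose_mul_self (hs n).1
  have hbox : ∀ n, C n ∈ {A : Mat4 | ∀ p q, ‖A p q‖ ≤ 1} := by
    intro n p q
    have h1 : ∑ q, ∑ p, ‖C n p q‖ ^ 2 = 1 := by
      have h := (hs n).2
      rw [hC n, Matrix.trace] at h
      simp only [Matrix.diag_apply, Matrix.mul_apply, Matrix.conjTranspose_apply, Complex.star_def,
        ← Complex.normSq_eq_conj_mul_self, Complex.normSq_eq_norm_sq] at h
      exact_mod_cast h
    have h2 : ‖C n p q‖ ^ 2 ≤ 1 := by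
      rw [← h1]
      refine (Finset.single_le_sum (f := fun p => ‖C n p q‖ ^ 2) (fun p _ => by positivity)
        (Finset.mem_univ p)).trans ?_
      exact Finset.single_le_sum (f := fun q => ∑ p, ‖C n p q‖ ^ 2)
        (fun q _ => Finset.sum_nonneg fun p _ => by positivity) (Finset.mem_univ q)
    exact (sq_le_one_iff₀ (norm_nonneg _)).mp h2
  obtain ⟨D, _, φ, hφ, hD⟩ := (isCompact_entrywise_ball4 1).tendsto_subseq hbox
  have hcont : Continuous fun X : Mat4 => Xᴴ * X := by fun_prop
  have hlim : Filter.Tendsto (s ∘ φ) Filter.atTop (nhds (Dᴴ * D)) := by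
    have := (hcont.tendsto D).comp hD
    refine this.congr fun n => ?_
    simp only [Function.comp]
    rw [hC (φ n)]
  refine ⟨Dᴴ * D, ⟨Matrix.posSemidef_conjTranspose_mul_self D, ?_⟩, φ, hφ, hlim⟩
  have h1 := ((continuous_id (X := Mat4)).matrix_trace.tendsto (Dᴴ * D)).comp hlim
  exact tendsto_nhds_unique h1 (tendsto_const_nhds.congr fun n => ((hs (φ n)).2).symm)

/-- The minimising filters may diverge, but their normalised outcomes are states and accumulate.
Trace minimality passes to the limit because the infimum `m` is at least `∑ lam > 0`, so dividing by
the traces is harmless. -/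
lemma exists_isBellNormalForm {ρ : Mat4} {lam : Fin 4 → ℝ} (hρ : IsState ρ)
    (hl : FlipSpectrum ρ lam) (hla : Antitone lam) (hl0 : ∀ k, 0 ≤ lam k)
    (hpos : 0 < ∑ k, lam k) : ∃ ρ₀, IsBellNormalForm ρ ρ₀ := by
  set T : Set ℝ := {t | ∃ A B : Mat2, A.det = 1 ∧ B.det = 1 ∧ t = (filterRaw ρ A B).trace.re} with hT
  have hTle : ∀ t ∈ T, ∑ k, lam k ≤ t := by
    rintro _ ⟨A, B, hA, hB, rfl⟩
    have h := (hl.filterRaw A B)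
    rw [hA, hB, norm_one, one_mul, one_smul] at h
    exact h.sum_le_trace (PosSemidef_filterRaw hρ.1 A B) hla hl0
  have hTne : T.Nonempty := ⟨_, 1, 1, Matrix.det_one, Matrix.det_one, rfl⟩
  have hTb : BddBelow T := ⟨_, hTle⟩
  obtain ⟨t, _, htlim, htT⟩ := exists_seq_tendsto_sInf hTne hTb
  set m := sInf T with hm
  have hm0 : 0 < m := hpos.trans_le (le_csInf hTne hTle)
  choose A B hA hB ht using htT
  have hAB : ∀ n, Reversible (A n) (B n) := fun n =>
    ⟨isUnit_of_det_ne_zero (by simp [hA]), isUnit_of_det_ne_zero (by simp [hB])⟩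
  have hst : ∀ n, IsState (filtered ρ (A n) (B n)) := fun n =>
    isState_filtered hρ.1 (admissible_of_reversible hρ (hAB n))
  obtain ⟨ρ₀, hρ₀, φ, hφ, hlim⟩ := exists_tendsto_subseq_of_isState hst
  refine ⟨ρ₀, IsTraceMinimal.isBellDiagonal hρ₀ fun C D hCD => ?_,
    mem_closure_of_tendsto hlim (Filter.Eventually.of_forall fun n => ⟨_, _, hAB _, rfl⟩)⟩
  have hmin : ∀ X Y : Mat2, X.det = 1 → Y.det = 1 → m ≤ (filterRaw ρ X Y).trace.re :=
    fun X Y hX hY => csInf_le hTb ⟨X, Y, hX, hY, rfl⟩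
  have hcont : Continuous fun σ : Mat4 => (filterRaw σ C D).trace.re := by
    refine Complex.continuous_re.comp (Continuous.matrix_trace ?_)
    unfold filterRaw
    fun_prop
  have h1 := (hcont.tendsto ρ₀).comp hlim
  have h2 : Filter.Tendsto (fun n => (t (φ n))⁻¹ * (m * (‖C.det‖ * ‖D.det‖))) Filter.atTop
      (nhds (m⁻¹ * (m * (‖C.det‖ * ‖D.det‖)))) :=
    ((htlim.comp hφ.tendsto_atTop).inv₀ hm0.ne').mul_const _
  rw [inv_mul_cancel_left₀ hm0.ne'] at h2
  refine le_of_tendsto_of_tendsto' h2 h1 fun n => ?_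
  simp only [Function.comp]
  rw [trace_filterRaw_filtered_re hρ.1, ← ht]
  refine mul_le_mul_of_nonneg_left ?_
    (inv_nonneg.mpr (hpos.le.trans (hTle _ ⟨_, _, hA _, hB _, ht _⟩)))
  have := mul_norm_det_le_of_unimodular hmin (hCD.mul (hAB (φ n)))
  simpa [Matrix.det_mul, hA, hB] using this

/-! ### The best CHSH value over all filters -/

lemma beta_filtered_le {ρ ρ₀ : Mat4} (hρ : IsState ρ) (h : IsBellNormalForm ρ ρ₀) {A B : Mat2}
    (hAB : Admissible ρ A B) : beta (filtered ρ A B) ≤ max 1 (beta ρ₀) := by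
  obtain ⟨lam, hb⟩ := exists_chshBound hρ.1
  obtain ⟨hpos, p, hp, hp0, hp1, hpl, hlp⟩ := h.exists_weights hρ hb.flipSpectrum
    (fun i j hij => hb.antitone i j hij) hb.nonneg
  have hspec := hb.flipSpectrum.filtered hρ.1 A B
  rw [hlp, smul_smul] at hspec
  have hc : 0 ≤ filterScale ρ A B * ∑ k, lam k := mul_nonneg (filterScale_nonneg hρ.1 A B) hpos.le
  obtain ⟨hc1, hle⟩ := beta_le_of_flipSpectrum_smul (isState_filtered hρ.1 hAB) h.1.isState hp hp0
    hp1 hpl hc hspec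
  -- A convex combination of `1` and `beta ρ₀` is at most their maximum.
  refine hle.trans ?_
  have h1 := le_max_left 1 (beta ρ₀)
  have h2 := le_max_right 1 (beta ρ₀)
  nlinarith

lemma exists_one_le_beta_filtered {ρ : Mat4} (hρ : IsState ρ) :
    ∃ A B : Mat2, Admissible ρ A B ∧ 1 ≤ beta (filtered ρ A B) := by
  obtain ⟨⟨i, j⟩, hp⟩ : ∃ p, ρ p p ≠ 0 := by
    by_contra! h0
    have := hρ.2
    simp [Matrix.trace, h0] at this
  -- Rank-one filters reading a nonzero diagonal entry of `ρ` prepare the product state `|00⟩`,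
  -- whose CHSH value is `1` when all four directions are `z`.
  set P : Mat4 := Matrix.single (0, 0) (0, 0) 1 with hP
  have hraw : filterRaw ρ (Matrix.single 0 i 1) (Matrix.single 0 j 1) = ρ (i, j) (i, j) • P := by
    rw [filterRaw, Matrix.single_kronecker_single, Matrix.conjTranspose_single,
      Matrix.single_mul_mul_single, hP, Matrix.smul_single]
    simp
  have htr : (filterRaw ρ (Matrix.single 0 i 1) (Matrix.single 0 j 1)).trace = ρ (i, j) (i, j) := by
    rw [hraw, Matrix.trace_smul, hP, Matrix.trace_single_eq_same, smul_eq_mul, mul_one]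
  have hadm : Admissible ρ (Matrix.single 0 i 1) (Matrix.single 0 j 1) := by
    rw [Admissible, htr]; exact hp
  refine ⟨_, _, hadm, le_csSup (isState_filtered hρ.1 hadm).bddAbove_bellValues ?_⟩
  set z : EuclideanSpace ℝ (Fin 3) := EuclideanSpace.single 2 1 with hz
  have hzn : ‖z‖ = 1 := by simp [hz]
  refine ⟨z, z, z, z, hzn, hzn, hzn, hzn, ?_⟩
  have e : filtered ρ (Matrix.single 0 i 1) (Matrix.single 0 j 1) = P := by
    rw [filtered, htr, hraw, inv_smul_smul₀ hp]
  have sz : spin z = pauli 2 := by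
    simp [spin, hz]
  have e2 : (1 / 2 : ℝ) • (z + z) = z := by module
  rw [e, bellOperator_eq, e2, sub_self, smul_zero, sz]
  have s0 : spin 0 = 0 := by simp [spin]
  rw [s0, Matrix.kronecker_zero, add_zero]
  simp [hP, pauli, Matrix.trace, Matrix.mul_apply, Fintype.sum_prod_type, Matrix.single_apply]

/-- As a supremum of continuous functionals, `beta` is lower semicontinuous, which is enough for
upper bounds to pass to the closure. -/
lemma beta_le_of_mem_closure {ρ ρ₀ : Mat4} (hρ : IsState ρ) (h : ρ₀ ∈ closure (reversibleOrbit ρ))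
    {u : ℝ} (hu : ∀ A B : Mat2, Reversible A B → beta (filtered ρ A B) ≤ u) : beta ρ₀ ≤ u := by
  refine csSup_le (bellValues_nonempty ρ₀) ?_
  rintro _ ⟨a, b, c, d, ha, hb, hc, hd, rfl⟩
  have hcont : Continuous fun σ : Mat4 => (σ * bellOperator a b c d).trace.re :=
    Complex.continuous_re.comp (Continuous.matrix_trace (by fun_prop))
  have hcl : IsClosed {σ : Mat4 | (σ * bellOperator a b c d).trace.re ≤ u} :=
    isClosed_le hcont continuous_const
  refine closure_minimal ?_ hcl h
  rintro _ ⟨A, B, hAB, rfl⟩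
  exact (le_csSup (isState_filtered hρ.1 (admissible_of_reversible hρ hAB)).bddAbove_bellValues
    ⟨a, b, c, d, ha, hb, hc, hd, rfl⟩).trans (hu A B hAB)

lemma isLUB_beta_filtered {ρ ρ₀ : Mat4} (hρ : IsState ρ) (h : IsBellNormalForm ρ ρ₀) :
    IsLUB {x : ℝ | ∃ A B : Mat2, Admissible ρ A B ∧ x = beta (filtered ρ A B)}
      (max 1 (beta ρ₀)) := by
  constructor
  · rintro _ ⟨A, B, hAB, rfl⟩
    exact beta_filtered_le hρ h hAB
  · intro u hu
    refine max_le ?_ ?_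
    · obtain ⟨A, B, hAB, h1⟩ := exists_one_le_beta_filtered hρ
      exact h1.trans (hu ⟨A, B, hAB, rfl⟩)
    · exact beta_le_of_mem_closure hρ h.2 fun A B hAB =>
        hu ⟨A, B, admissible_of_reversible hρ hAB, rfl⟩

lemma IsOptimalFilter.reversible_and_isBellDiagonal {ρ : Mat4} (hρ : IsState ρ) {A B : Mat2}
    (h : IsOptimalFilter ρ A B) (hv : Violates (filtered ρ A B)) :
    Reversible A B ∧ IsBellDiagonal (filtered ρ A B) := by
  obtain ⟨lam, hb⟩ := exists_chshBound hρ.1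
  have hla : Antitone lam := fun i j hij => hb.antitone i j hij
  have hst := isState_filtered hρ.1 h.1
  have hspec := hb.flipSpectrum.filtered hρ.1 A B
  have hpos : 0 < ∑ k, lam k := by
    refine lt_of_le_of_ne (Finset.sum_nonneg fun k _ => hb.nonneg k) fun h0 => ?_
    have hlz : lam = 0 := by
      ext k
      exact (Finset.sum_eq_zero_iff_of_nonneg fun k _ => hb.nonneg k).mp h0.symm k
        (Finset.mem_univ k)
    rw [hlz, smul_zero] at hspec
    exact absurd (beta_le_one_of_flipSpectrum_zero hst hspec) (not_le.mpr hv)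
  obtain ⟨ρ₀, hn⟩ := exists_isBellNormalForm hρ hb.flipSpectrum hla hb.nonneg hpos
  obtain ⟨_, p, hp, hp0, hp1, hpl, hlp⟩ := hn.exists_weights hρ hb.flipSpectrum hla hb.nonneg
  rw [hlp, smul_smul] at hspec
  set c := filterScale ρ A B * ∑ k, lam k with hc
  have hc0 : 0 ≤ c := mul_nonneg (filterScale_nonneg hρ.1 A B) hpos.le
  obtain ⟨hc1, hle⟩ := beta_le_of_flipSpectrum_smul hst hn.1.isState hp hp0 hp1 hpl hc0 hspec
  have hβ : beta ρ₀ ≤ beta (filtered ρ A B) := by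
    refine (le_max_right 1 _).trans ((isLUB_beta_filtered hρ hn).2 ?_)
    rintro _ ⟨C, D, hCD, rfl⟩
    exact h.2 C D hCD
  -- Optimality gives `β ≤ (1 - c) + c β` for the outcome; since `β > 1`, this fails for `c < 1`.
  have hc2 : c = 1 := by
    refine le_antisymm hc1 (not_lt.mp fun hlt => ?_)
    rw [Violates] at hv
    nlinarith [mul_le_mul_of_nonneg_left hβ hc0, mul_pos (sub_pos.mpr hlt) (sub_pos.mpr hv)]
  refine ⟨reversible_of_filterScale_ne_zero (ρ := ρ) (left_ne_zero_of_mul (hc ▸ hc2 ▸ one_ne_zero)),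
    IsTraceMinimal.isBellDiagonal hst fun C D _ => ?_⟩
  -- Now the outcome has a flip spectrum summing to its trace. Since the sum never exceeds the
  -- trace, no unimodular filter can lower the trace.
  rw [hc2, one_smul] at hspec
  have := (hspec.filterRaw C D).sum_le_trace (PosSemidef_filterRaw hst.1 C D)
    (antitone_smul (by positivity) hp) fun k => mul_nonneg (by positivity) (hp0 k)
  rwa [sum_smul_eq, hp1, mul_one] at this

/-! ### Rigidity of the filters that reach the normal form -/

/-- Equality of arithmetic and geometric mean: the singular values of `N` coincide, so `N` is a
multiple of a unitary. -/
lemma mul_conjTranspose_eq_of_trace_proj {N : Mat2} (h : (proj N).trace.re = ‖N.det‖) :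
    N * Nᴴ = (‖N.det‖ : ℂ) • 1 := by
  have h1 := rowSq_mul_rowSq N
  have h2 : rowSq N 0 + rowSq N 1 = 2 * ‖N.det‖ := by
    rw [← h, trace_proj_re, rowSq, rowSq]; ring
  have h3 : ‖rowInner N‖ ^ 2 = 0 := by
    have e : rowSq N 1 = 2 * ‖N.det‖ - rowSq N 0 := by linarith
    rw [e] at h1
    exact le_antisymm (by nlinarith [sq_nonneg (rowSq N 0 - ‖N.det‖)]) (sq_nonneg _)
  have h4 : rowInner N = 0 := by simpa using h3
  have h5 : rowSq N 0 = ‖N.det‖ := by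
    have : (rowSq N 0 - ‖N.det‖) ^ 2 = 0 := by
      rw [h3] at h1
      have e : rowSq N 1 = 2 * ‖N.det‖ - rowSq N 0 := by linarith
      rw [e] at h1
      linear_combination -h1
    exact sub_eq_zero.mp (pow_eq_zero_iff (two_ne_zero) |>.mp this)
  have h6 : rowSq N 1 = ‖N.det‖ := by linarith
  have hrow : ∀ i, ((rowSq N i : ℝ) : ℂ) = N i 0 * star (N i 0) + N i 1 * star (N i 1) := by
    intro i
    simp only [Complex.star_def, Complex.mul_conj, Complex.normSq_eq_norm_sq, rowSq]
    push_cast; ring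
  have e0 := hrow 0
  have e1 := hrow 1
  rw [h5] at e0
  rw [h6] at e1
  have h4' := congrArg star h4
  rw [rowInner] at h4 h4'
  simp only [star_add, star_mul', star_star, star_zero] at h4'
  ext i j
  fin_cases i <;> fin_cases j
  · simpa [Matrix.mul_apply, Fin.sum_univ_two] using e0.symm
  · simpa [Matrix.mul_apply, Fin.sum_univ_two] using h4
  · simp only [Fin.mk_one, Fin.zero_eta, Matrix.mul_apply, Fin.sum_univ_two,
      Matrix.conjTranspose_apply, Matrix.smul_apply]
    rw [mul_comm (N 1 0), mul_comm (N 1 1), h4']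
    simp
  · simpa [Matrix.mul_apply, Fin.sum_univ_two] using e1.symm

lemma exists_unitary_of_conjTranspose_mul {A : Mat2} (hA : IsUnit A) {h : ℂ}
    (e : Aᴴ * A = h • 1) : ∃ U ∈ Matrix.unitaryGroup (Fin 2) ℂ, ∃ s : ℂ, s ≠ 0 ∧ A = s • U := by
  have h00 : h = (((‖A 0 0‖ ^ 2 + ‖A 1 0‖ ^ 2 : ℝ)) : ℂ) := by
    have := congrFun (congrFun e 0) 0
    simp only [Matrix.mul_apply, Fin.sum_univ_two, Matrix.conjTranspose_apply, Matrix.smul_apply,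
      Matrix.one_apply_eq, smul_eq_mul, mul_one, Complex.star_def,
      ← Complex.normSq_eq_conj_mul_self, Complex.normSq_eq_norm_sq] at this
    rw [← this]
    push_cast; ring
  set r : ℝ := ‖A 0 0‖ ^ 2 + ‖A 1 0‖ ^ 2 with hr
  have hr0 : 0 < r := by
    refine lt_of_le_of_ne (by positivity) fun h0 => ?_
    rw [h00, ← h0, Complex.ofReal_zero, zero_smul, Matrix.conjTranspose_mul_self_eq_zero] at e
    rw [e] at hA
    exact not_isUnit_zero hA
  have hs : ((Real.sqrt r : ℝ) : ℂ) ≠ 0 := by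
    exact_mod_cast (Real.sqrt_pos.mpr hr0).ne'
  have hss : ((Real.sqrt r : ℝ) : ℂ) * ((Real.sqrt r : ℝ) : ℂ) = h := by
    rw [← Complex.ofReal_mul, Real.mul_self_sqrt hr0.le, h00]
  refine ⟨((Real.sqrt r : ℝ) : ℂ)⁻¹ • A, ?_, _, hs, by rw [smul_inv_smul₀ hs]⟩
  rw [Matrix.mem_unitaryGroup_iff', star_eq_conjTranspose, Matrix.conjTranspose_smul,
    Matrix.smul_mul, Matrix.mul_smul, e, smul_smul, smul_smul, ← hss, Complex.star_def, map_inv₀,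
    Complex.conj_ofReal]
  field_simp
  simp

/-- The trace is a weighted sum of arithmetic-geometric mean inequalities, so equality holds for the
three Bell vectors of positive weight. Hence `Aᴴ A` has the same conjugate under `1`, `σ_z` and
`σ_x`; it commutes with the latter two and is scalar. The claim for `B` follows from the vector
`Φ⁺`. -/
lemma exists_unitary_of_trace_eq {A B : Mat2} (hAB : Reversible A B) {p : Fin 4 → ℝ}
    (hp0 : ∀ k, 0 ≤ p k) (hp : ∀ k : Fin 4, k ≠ 3 → 0 < p k)
    (h : (filterRaw (bellMix p) A B).trace.re = ‖A.det‖ * ‖B.det‖ * ∑ k, p k) :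
    (∃ U ∈ Matrix.unitaryGroup (Fin 2) ℂ, ∃ s : ℂ, s ≠ 0 ∧ A = s • U) ∧
      ∃ V ∈ Matrix.unitaryGroup (Fin 2) ℂ, ∃ t : ℂ, t ≠ 0 ∧ B = t • V := by
  set δ := ‖A.det‖ * ‖B.det‖ with hδ
  have hδ0 : 0 < δ := mul_pos (norm_pos_iff.mpr (det_ne_zero_of_isUnit hAB.1))
    (norm_pos_iff.mpr (det_ne_zero_of_isUnit hAB.2))
  have hδc : (δ : ℂ) ≠ 0 := by exact_mod_cast hδ0.ne'
  have hge : ∀ k, 0 ≤ (proj (A * bellMat k * Bᵀ)).trace.re - δ := fun k => by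
    rw [hδ, ← norm_det_mul_bellMat A B k]
    exact sub_nonneg.mpr (norm_det_le_trace_proj _)
  have hsum : ∑ k, p k * ((proj (A * bellMat k * Bᵀ)).trace.re - δ) = 0 := by
    have h1 := trace_filterRaw_bellMix_mul_re p A B 1
    simp only [Matrix.mul_one] at h1
    rw [h1] at h
    simp only [mul_sub, Finset.sum_sub_distrib, h, ← Finset.sum_mul]
    ring
  have heq : ∀ k : Fin 4, k ≠ 3 → (A * bellMat k * Bᵀ)ᴴ * (A * bellMat k * Bᵀ) = (δ : ℂ) • 1 := by
    intro k hk
    have h1 := (Finset.sum_eq_zero_iff_of_nonneg fun k _ => mul_nonneg (hp0 k) (hge k)).mp hsum k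
      (Finset.mem_univ k)
    have h2 := (mul_eq_zero.mp h1).resolve_left (hp k hk).ne'
    have h3 : (proj (A * bellMat k * Bᵀ)).trace.re = ‖(A * bellMat k * Bᵀ).det‖ := by
      rw [norm_det_mul_bellMat, ← hδ]; linarith
    have h4 := mul_conjTranspose_eq_of_trace_proj h3
    rw [norm_det_mul_bellMat, ← hδ] at h4
    set N := A * bellMat k * Bᵀ
    have h5 : N * ((δ : ℂ)⁻¹ • Nᴴ) = 1 := by
      rw [Matrix.mul_smul, h4, inv_smul_smul₀ hδc]
    have h6 := mul_eq_one_comm.mp h5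
    rw [Matrix.smul_mul] at h6
    rw [← h6, smul_inv_smul₀ hδc]
  set H := Aᴴ * A with hH
  have hBT : IsUnit Bᵀ.det := by
    rw [Matrix.det_transpose]
    exact (det_ne_zero_of_isUnit hAB.2).isUnit
  obtain ⟨X, hX⟩ : ∃ X, Bᵀ * X = 1 := ⟨_, Matrix.mul_nonsing_inv _ hBT⟩
  have hX' : Xᴴ * Bᵀᴴ = 1 := by rw [← Matrix.conjTranspose_mul, hX, Matrix.conjTranspose_one]
  have hMH : ∀ k : Fin 4, k ≠ 3 → (bellMat k)ᴴ * H * bellMat k = (δ : ℂ) • (Xᴴ * X) := by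
    intro k hk
    have h1 := congrArg (fun Y => Xᴴ * Y * X) (heq k hk)
    simp only [Matrix.mul_smul, Matrix.smul_mul, Matrix.mul_one] at h1
    rw [← h1]
    calc (bellMat k)ᴴ * H * bellMat k
        = (Xᴴ * Bᵀᴴ) * ((bellMat k)ᴴ * H * bellMat k) * (Bᵀ * X) := by
          rw [hX, hX', Matrix.one_mul, Matrix.mul_one]
      _ = _ := by
          simp only [Matrix.conjTranspose_mul, hH, Matrix.mul_assoc]
  have e0 := hMH 0 (by decide)
  have e1 := (hMH 1 (by decide)).trans e0.symm
  have e2 := (hMH 2 (by decide)).trans e0.symm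
  have hH01 : H 0 1 = 0 := by
    have := congrFun (congrFun e1 0) 1
    simp [bellMat, Matrix.mul_apply, Fin.sum_univ_two] at this
    linear_combination -this / 2
  have hH10 : H 1 0 = 0 := by
    have := congrFun (congrFun e1 1) 0
    simp [bellMat, Matrix.mul_apply, Fin.sum_univ_two] at this
    linear_combination -this / 2
  have hH11 : H 1 1 = H 0 0 := by
    have := congrFun (congrFun e2 0) 0
    simp [bellMat, Matrix.mul_apply, Fin.sum_univ_two] at this
    linear_combination this
  have hHs : H = H 0 0 • 1 := by
    ext i j
    fin_cases i <;> fin_cases j <;> simp [hH01, hH10, hH11]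
  refine ⟨exists_unitary_of_conjTranspose_mul hAB.1 hHs, ?_⟩
  obtain ⟨U, hU, s, hs, hA⟩ := exists_unitary_of_conjTranspose_mul hAB.1 hHs
  have hb : bellMat 0 = 1 := by rw [Matrix.one_fin_two]; rfl
  have hh0 : H 0 0 ≠ 0 := by
    intro h0
    rw [h0, zero_smul, hH, Matrix.conjTranspose_mul_self_eq_zero] at hHs
    have := hAB.1
    rw [hHs] at this
    exact not_isUnit_zero this
  have hB : Bᵀᴴ * Bᵀ = (δ / H 0 0) • 1 := by
    have h1 := heq 0 (by decide)
    rw [hb, Matrix.mul_one, Matrix.conjTranspose_mul] at h1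
    have h2 : Bᵀᴴ * Aᴴ * (A * Bᵀ) = H 0 0 • (Bᵀᴴ * Bᵀ) := by
      calc Bᵀᴴ * Aᴴ * (A * Bᵀ) = Bᵀᴴ * H * Bᵀ := by rw [hH]; noncomm_ring
        _ = _ := by rw [hHs]; simp
    rw [h2] at h1
    rw [div_eq_inv_mul, mul_smul, ← h1, inv_smul_smul₀ hh0]
  have hBu : IsUnit Bᵀ := (Matrix.isUnit_iff_isUnit_det _).mpr hBT
  obtain ⟨V, hV, t, ht, hBV⟩ := exists_unitary_of_conjTranspose_mul hBu hB
  refine ⟨Vᵀ, ?_, t, ht, ?_⟩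
  · rw [Matrix.mem_unitaryGroup_iff, star_eq_conjTranspose,
      show Vᵀᴴ = Vᴴᵀ from rfl, ← Matrix.transpose_mul,
      ← star_eq_conjTranspose, Matrix.mem_unitaryGroup_iff'.mp hV, Matrix.transpose_one]
  · rw [← Matrix.transpose_smul, ← hBV, Matrix.transpose_transpose]

lemma rank_filterRaw_le (ρ : Mat4) (A B : Mat2) : (filterRaw ρ A B).rank ≤ ρ.rank :=
  (Matrix.rank_mul_le_left _ _).trans (Matrix.rank_mul_le_right _ _)

lemma rank_smul_le {n : Type*} [Fintype n] [DecidableEq n] (c : ℂ) (X : Matrix n n ℂ) :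
    (c • X).rank ≤ X.rank := by
  have : c • X = (c • (1 : Matrix n n ℂ)) * X := by rw [Matrix.smul_mul, Matrix.one_mul]
  rw [this]
  exact Matrix.rank_mul_le_right _ _

lemma pos_of_three_le_rank {p : Fin 4 → ℝ} (hp : Antitone p) (hp0 : ∀ k, 0 ≤ p k)
    (h : 3 ≤ (bellMix p).rank) : ∀ k : Fin 4, k ≠ 3 → 0 < p k := by
  have h2 : p 2 ≠ 0 := by
    intro h2
    have h3 : p 3 = 0 := le_antisymm (h2 ▸ hp (by decide)) (hp0 3)
    have h4 : (bellMix p).rank ≤ 2 := by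
      rw [bellMix_eq_magic]
      refine (Matrix.rank_mul_le_left _ _).trans ((Matrix.rank_mul_le_right _ _).trans ?_)
      rw [Matrix.rank_diagonal, Fintype.card_subtype]
      refine (Finset.card_le_card (t := {0, 1}) fun k hk => ?_).trans Finset.card_le_two
      rw [Finset.mem_filter] at hk
      fin_cases k <;> simp_all
    omega
  have h2' : 0 < p 2 := lt_of_le_of_ne (hp0 2) (Ne.symm h2)
  intro k hk
  refine h2'.trans_le (hp ?_)
  fin_cases k
  · decide
  · decide
  · decide
  · exact absurd rfl hk

lemma exists_unitary_of_isBellDiagonal {ρ : Mat4} (hρ : IsState ρ) (hr : 3 ≤ ρ.rank)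
    {A B C D : Mat2} (hAB : Reversible A B) (hbAB : IsBellDiagonal (filtered ρ A B))
    (hCD : Reversible C D) (hbCD : IsBellDiagonal (filtered ρ C D)) :
    ∃ U ∈ Matrix.unitaryGroup (Fin 2) ℂ, ∃ V ∈ Matrix.unitaryGroup (Fin 2) ℂ,
      ∃ s t : ℂ, s ≠ 0 ∧ t ≠ 0 ∧ C = s • (U * A) ∧ D = t • (V * B) := by
  obtain ⟨p, hp, hp0, hp1, U₀, hU₀, V₀, hV₀, hUV⟩ := hbAB.exists_antitone
  change filtered ρ A B = filterRaw (bellMix p) U₀ V₀ at hUV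
  obtain ⟨q, hq, hq0, hq1, hql⟩ := hbCD.exists_antitone
  have hadm := admissible_of_reversible hρ hAB
  have hadm' := admissible_of_reversible hρ hCD
  have hAA : C * A⁻¹ * A = C := by
    rw [Matrix.mul_assoc, Matrix.nonsing_inv_mul _ ((Matrix.isUnit_iff_isUnit_det A).mp hAB.1),
      Matrix.mul_one]
  have hBB : D * B⁻¹ * B = D := by
    rw [Matrix.mul_assoc, Matrix.nonsing_inv_mul _ ((Matrix.isUnit_iff_isUnit_det B).mp hAB.2),
      Matrix.mul_one]
  have hrank : 3 ≤ (bellMix p).rank := by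
    refine hr.trans ?_
    have h1 := filterRaw_inv (ρ := ρ) hAB
    rw [filterRaw_eq_smul_filtered hadm, filterRaw_smul, hUV, filterRaw_filterRaw] at h1
    rw [← h1]
    exact (rank_smul_le _ _).trans (rank_filterRaw_le _ _ _)
  -- The transition filter takes a Bell mixture to a multiple of a Bell-diagonal state. Comparing
  -- the sums of the flip spectra shows that its trace meets the lower bound by the determinants,
  -- the equality case above.
  set X := C * A⁻¹ * U₀ with hX
  set Y := D * B⁻¹ * V₀ with hY
  have hUu : IsUnit U₀ := isUnit_of_det_ne_zero (by
    rw [← norm_ne_zero_iff, norm_det_of_mem_unitaryGroup hU₀]; exact one_ne_zero)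
  have hVu : IsUnit V₀ := isUnit_of_det_ne_zero (by
    rw [← norm_ne_zero_iff, norm_det_of_mem_unitaryGroup hV₀]; exact one_ne_zero)
  have hinv : ∀ {Z : Mat2}, IsUnit Z → IsUnit Z⁻¹ := fun {Z} hZ => by
    rw [Matrix.isUnit_nonsing_inv_iff]; exact hZ
  have hXY : Reversible X Y := ⟨(hCD.1.mul (hinv hAB.1)).mul hUu, (hCD.2.mul (hinv hAB.2)).mul hVu⟩
  set r := (filterRaw ρ C D).trace.re with hrdef
  set r' := (filterRaw ρ A B).trace.re with hrdef'
  have hps := PosSemidef_filterRaw hρ.1 A B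
  have hps' := PosSemidef_filterRaw hρ.1 C D
  have hr'0 : 0 < r' := lt_of_le_of_ne (trace_re_nonneg hps) fun h0 => hadm (by
    rw [trace_eq_re_of_posSemidef hps, ← hrdef', ← h0, Complex.ofReal_zero])
  have hraw : filterRaw (bellMix p) X Y = ((r'⁻¹ * r : ℝ) : ℂ) • filtered ρ C D := by
    rw [hX, hY, ← filterRaw_filterRaw, ← hUV, filtered_eq hρ.1 A B, filterRaw_smul,
      filterRaw_filterRaw, hAA, hBB, filterRaw_eq_smul_filtered hadm',
      trace_eq_re_of_posSemidef hps', smul_smul, Complex.ofReal_mul]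
  have hrr : 0 ≤ r'⁻¹ * r := mul_nonneg (inv_nonneg.mpr hr'0.le) (trace_re_nonneg hps')
  have hspec : (‖X.det‖ * ‖Y.det‖) • p = (r'⁻¹ * r) • q := by
    have h1 := (flipSpectrum_bellMix p).filterRaw X Y
    have h2 := (hql.flipSpectrum (flipSpectrum_bellMix q)).smul (r'⁻¹ * r)
    rw [← hraw] at h2
    exact h1.eq_of_antitone h2 (antitone_smul (by positivity) hp) (antitone_smul hrr hq)
      (fun k => mul_nonneg (by positivity) (hp0 k)) fun k => mul_nonneg hrr (hq0 k)
  have hδ : ‖X.det‖ * ‖Y.det‖ = r'⁻¹ * r := by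
    have h1 := congrArg (fun f : Fin 4 → ℝ => ∑ k, f k) hspec
    simpa only [sum_smul_eq, hp1, hq1, mul_one] using h1
  have htr : (filterRaw (bellMix p) X Y).trace.re = ‖X.det‖ * ‖Y.det‖ * ∑ k, p k := by
    rw [hraw, Matrix.trace_smul, hbCD.isState.2, hp1, hδ]
    simp
  obtain ⟨⟨U, hU, s, hs, hXU⟩, V, hV, t, ht, hYV⟩ :=
    exists_unitary_of_trace_eq hXY hp0 (pos_of_three_le_rank hp hp0 hrank) htr
  refine ⟨U * star U₀, mul_mem hU (Unitary.star_mem hU₀), V * star V₀,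
    mul_mem hV (Unitary.star_mem hV₀), s, t, hs, ht, ?_, ?_⟩
  · rw [← Matrix.smul_mul, ← Matrix.smul_mul, ← hXU, hX, Matrix.mul_assoc (C * A⁻¹),
      Matrix.mem_unitaryGroup_iff.mp hU₀, Matrix.mul_one, hAA]
  · rw [← Matrix.smul_mul, ← Matrix.smul_mul, ← hYV, hY, Matrix.mul_assoc (D * B⁻¹),
      Matrix.mem_unitaryGroup_iff.mp hV₀, Matrix.mul_one, hBB]

end CHSHFilter

end

theorem theorem3 (ρ : CHSHFilter.Mat4) (hρ : CHSHFilter.IsState ρ) :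
    -- optimal violating filters are exactly the reversible ones with Bell diagonal outcome
    (∀ A B : CHSHFilter.Mat2,
      (CHSHFilter.IsOptimalFilter ρ A B ∧ CHSHFilter.Violates (CHSHFilter.filtered ρ A B)) ↔
        (CHSHFilter.Reversible A B ∧ CHSHFilter.IsBellDiagonal (CHSHFilter.filtered ρ A B) ∧
          CHSHFilter.Violates (CHSHFilter.filtered ρ A B))) ∧
    -- a state of full rank is brought into Bell diagonal form by a reversible filter
    (ρ.PosDef → ∃ A B : CHSHFilter.Mat2,
      CHSHFilter.Reversible A B ∧ CHSHFilter.IsBellDiagonal (CHSHFilter.filtered ρ A B)) ∧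
    -- a normal form exists for all other states too, except for the trivial ones
    ((∃ ρ₀, CHSHFilter.IsBellNormalForm ρ ρ₀) ↔ ¬ CHSHFilter.IsProductWithPureFactor ρ) ∧
    (CHSHFilter.IsProductWithPureFactor ρ → ∀ A B : CHSHFilter.Mat2,
      CHSHFilter.Admissible ρ A B → ¬ CHSHFilter.Violates (CHSHFilter.filtered ρ A B)) ∧
    -- uniqueness of the normal form, and of the filter that leads to it
    (∀ ρ₀ ρ₁, CHSHFilter.IsBellNormalForm ρ ρ₀ → CHSHFilter.IsBellNormalForm ρ ρ₁ →
      CHSHFilter.LocallyUnitarilyEquivalent ρ₀ ρ₁) ∧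
    (3 ≤ ρ.rank → ∀ A B C D : CHSHFilter.Mat2,
      CHSHFilter.Reversible A B → CHSHFilter.IsBellDiagonal (CHSHFilter.filtered ρ A B) →
      CHSHFilter.Reversible C D → CHSHFilter.IsBellDiagonal (CHSHFilter.filtered ρ C D) →
      ∃ U ∈ Matrix.unitaryGroup (Fin 2) ℂ, ∃ V ∈ Matrix.unitaryGroup (Fin 2) ℂ,
        ∃ s t : ℂ, s ≠ 0 ∧ t ≠ 0 ∧ C = s • (U * A) ∧ D = t • (V * B)) ∧
    -- the normal form gives the best CHSH value over all local filters
    (∀ ρ₀, CHSHFilter.IsBellNormalForm ρ ρ₀ →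
      IsLUB {x : ℝ | ∃ A B : CHSHFilter.Mat2, CHSHFilter.Admissible ρ A B ∧
        x = CHSHFilter.beta (CHSHFilter.filtered ρ A B)} (max 1 (CHSHFilter.beta ρ₀))) ∧
    -- if the normal form does not violate CHSH, no filtered state does
    (∀ ρ₀, CHSHFilter.IsBellNormalForm ρ ρ₀ → ¬ CHSHFilter.Violates ρ₀ →
      ∀ A B : CHSHFilter.Mat2, CHSHFilter.Admissible ρ A B →
        ¬ CHSHFilter.Violates (CHSHFilter.filtered ρ A B)) := by
  obtain ⟨lam, hb⟩ := CHSHFilter.exists_chshBound hρ.1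
  have hl := hb.flipSpectrum
  have hla : Antitone lam := fun i j hij => hb.antitone i j hij
  have hl0 := hb.nonneg
  refine ⟨fun A B => ⟨fun h => ?_, fun h => ?_⟩, fun h => ?_, ⟨?_, fun h => ?_⟩, fun h A B hAB => ?_,
    fun ρ₀ ρ₁ h₀ h₁ => ?_, fun hr A B C D hAB hbAB hCD hbCD => ?_, fun ρ₀ h => ?_,
    fun ρ₀ h hv A B hAB => ?_⟩
  · obtain ⟨h1, h2⟩ := h.1.reversible_and_isBellDiagonal hρ h.2
    exact ⟨h1, h2, h.2⟩
  · obtain ⟨hAB, hbd, hv⟩ := h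
    refine ⟨⟨CHSHFilter.admissible_of_reversible hρ hAB, fun C D hCD => ?_⟩, hv⟩
    -- A Bell-diagonal outcome of an invertible filter is itself a normal form; as it violates CHSH,
    -- the maximum with `1` is its own value.
    exact (CHSHFilter.beta_filtered_le hρ (CHSHFilter.isBellNormalForm_filtered hAB hbd) hCD).trans
      (max_le (le_of_lt hv) le_rfl)
  · obtain ⟨A, B, h1, -, h2⟩ := CHSHFilter.exists_filtered_isBellDiagonal h
    exact ⟨A, B, h1, h2⟩
  · rintro ⟨ρ₀, h₀⟩ h
    -- A product with a pure factor has zero flip spectrum, while a normal form requires a positive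
    -- sum.
    have := (h₀.exists_weights hρ h.flipSpectrum antitone_const fun _ => le_rfl).1
    simp at this
  · rcases (Finset.sum_nonneg fun k _ => hl0 k).eq_or_lt with h0 | h0
    · have hlz : lam = 0 := by
        ext k
        exact (Finset.sum_eq_zero_iff_of_nonneg fun k _ => hl0 k).mp h0.symm k (Finset.mem_univ k)
      exact absurd (hρ.isProductWithPureFactor (hlz ▸ hl)) h
    · exact CHSHFilter.exists_isBellNormalForm hρ hl hla hl0 h0
  · have hs := h.flipSpectrum.filtered hρ.1 A B
    rw [smul_zero] at hs
    exact not_lt.mpr (CHSHFilter.beta_le_one_of_flipSpectrum_zero (CHSHFilter.isState_filtered hρ.1 hAB) hs)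
  · obtain ⟨hS, p, -, -, -, hp, ep⟩ := h₀.exists_weights hρ hl hla hl0
    obtain ⟨-, q, -, -, -, hq, eq⟩ := h₁.exists_weights hρ hl hla hl0
    -- Both lists of weights are the flip spectrum of `ρ` divided by its sum.
    have hpq : p = q := smul_right_injective _ hS.ne' (ep.symm.trans eq)
    exact hp.symm.trans (hpq ▸ hq)
  · exact CHSHFilter.exists_unitary_of_isBellDiagonal hρ hr hAB hbAB hCD hbCD
  · exact CHSHFilter.isLUB_beta_filtered hρ h
  · exact not_lt.mpr ((CHSHFilter.beta_filtered_le hρ h hAB).trans (max_le le_rfl (not_lt.mp hv)))
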